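/- **Setting.** Let $A\in\mathbb C^{N\times M}$ be a non-zero matrix with columns $\boldsymbol a_1,\dots,\boldsymbol a_M$, let $\boldsymbol b\in\mathbb C^N$, and let $n=\lceil\log_2 N\rceil$. Vectors in $\mathbb C^N$ are identified with vectors of amplitudes on $n$ qubits (padded by zeros if $N$ is not a power of two). A quantum circuit is a sequence of layers of one- and two-qubit unitary gates, the gates of one layer acting on disjoint qubits; its depth is the number of layers. Assume quantum access to $A$ and $\boldsymbol b$: numbers $\|\boldsymbol a_j\|\ge 0$, $\|\boldsymbol b\|>0$ and circuits for unitaries $U_1,\dots,U_M,U_{\boldsymbol b}$ of depth at most $d$ are given such that $\boldsymbol a_j=\|\boldsymbol a_j\|\,U_j|0^n\rangle$ and $\boldsymbol b=\|\boldsymbol b\|\,U_{\boldsymbol b}|0^n\rangle$. Write $|a_j\rangle=U_j|0^n\rangle$, $|b\rangle=U_{\boldsymbol b}|0^n\rangle$. $\|A\|$ is the spectral norm, $A^{-1}$ the Moore–Penrose pseudo-inverse, $\kappa(A)=\|A\|\|A^{-1}\|$, $\boldsymbol x^*=A^{-1}\boldsymbol b$, and $\Gamma_1=\max_j\max(\|\boldsymbol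 a_j\|\|\boldsymbol b\|,\|\boldsymbol a_j\|^2)$. The Hadamard test of $\{|0^n\rangle,U\}$ applies, on $n+1$ qubits, a Hadamard gate on an ancilla, $U$ controlled by the ancilla, a phase gate ($\mathrm{id}$ or $\mathrm{diag}(1,-i)$) and a Hadamard gate on the ancilla, and then measures the ancilla; the outcome is $0$ with probability $(1+\mathrm{Re}\langle 0|U|0\rangle)/2$, respectively $(1+\mathrm{Im}\langle 0|U|0\rangle)/2$. **Algorithm 1** (input: the quantum access data, $\varepsilon>0$, the numbers $\|A\|,\|A^{-1}\|,\|\boldsymbol x^*\|$, and a factor $\rho>0$). 1. Compute $\Gamma_1$, $\;\lambda=\dfrac{\varepsilon}{2\|A\|^2\|A^{-1}\|^4\|\boldsymbol b\|}$, $\;T=\rho\,\dfrac{M\|A^{-1}\|^4\kappa(A)^4\|\boldsymbol b\|^2(\|A\|(\|\boldsymbol x^*\|+1)+\varepsilon)^2}{\varepsilon^4}$ and $S=\lceil\Gamma_1^2T\rceil$. 2. For all $j,k\in[M]$, estimate $\langle a_j|a_k\rangle$ by $v_{jk}$, repeating the Hadamard tests of $\{|0^n\rangle,U_j^\dagger U_k\}$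 for the real and for the imaginary part independently $S$ times each and averaging; put $\hat W_{jk}=\|\boldsymbol a_j\|\|\boldsymbol a_k\|v_{jk}+\lambda\,\delta_{jk}$. 3. For all $j\in[M]$, estimate $\langle a_j|b\rangle$ by $\hat u_j$ in the same way with $\{|0^n\rangle,U_j^\dagger U_{\boldsymbol b}\}$; put $\hat q_j=\|\boldsymbol a_j\|\|\boldsymbol b\|\hat u_j$. 4. Compute $\hat{\boldsymbol x}=\hat W^{-1}\hat{\boldsymbol q}$ with a classical algorithm that solves every invertible $M\times M$ system and always stops after $O(M^3+1)$ steps, and return $\hat{\boldsymbol x}$. Time is the number of steps of a hybrid random access machine: arithmetic operations and comparisons of complex numbers (in exact arithmetic) and index operations cost one step each, rounding a real number up to a natural number $k$ costs $k+1$ steps, and running a quantum circuit costs as many steps as it has one- and two-qubit gates, plus one for the measurement. **Theorem.** The following holds for a suitable classical program for step 4, for a suitable implementation of the Hadamard tests by circuits of one- and two-qubit gates, of size linear in the sizes of the two given circuits, and for suitable universal constants $c,C>0$. Let $0<\delta<1$ and $\rho=c\log(2/\delta)$. Then for all $N,M$, $A\neq0$, $\boldsymbol b$, $d$ and $\varepsilon>0$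 as above: 1. With probability at least $1-\delta$, the output $\hat{\boldsymbol x}$ of Algorithm 1 satisfies $$\|A\hat{\boldsymbol x}-\boldsymbol b\|-\min_{\boldsymbol x\in\mathbb C^M}\|A\boldsymbol x-\boldsymbol b\|\le\varepsilon .$$ 2. With $$B=\frac{\Gamma_1^2M^3\|A^{-1}\|^4\kappa(A)^4\|\boldsymbol b\|^2\bigl(\|A\|(\|\boldsymbol x^*\|+1)+\varepsilon\bigr)^2}{\varepsilon^4},$$ every run of Algorithm 1 takes time at most $C\log(2/\delta)\,(1+d\lceil\log_2N\rceil)\,(B+M^3)$. If $B\ge M^3$, it takes time at most $C\log(2/\delta)\,(1+d\lceil\log_2N\rceil)\,B$. In particular, if $d=\mathrm{polylog}\,N$ and $B\ge M^3$, then the running time is $\tilde O(B)$, where $\tilde O$ hides factors $\mathrm{polylog}\,N$ and $\log(1/\delta)$. -/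

import Mathlib

open scoped Matrix.Norms.L2Operator

noncomputable section

namespace HybridLS

/-! ### Linear algebra -/

/-- The Moore-Penrose pseudo-inverse `A⁺ = (Aᴴ A)⁺ Aᴴ`. The pseudo-inverse of the Hermitian matrix
`Aᴴ A` is obtained from its spectral decomposition by inverting the non-zero eigenvalues
(recall `0⁻¹ = 0`). -/
def pinv {N M : ℕ} (A : Matrix (Fin N) (Fin M) ℂ) : Matrix (Fin M) (Fin N) ℂ :=
  let hA := Matrix.isHermitian_conjTranspose_mul_self A
  (hA.eigenvectorUnitary : Matrix (Fin M) (Fin M) ℂ) *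
    Matrix.diagonal (fun i => ((hA.eigenvalues i)⁻¹ : ℂ)) *
    (hA.eigenvectorUnitary : Matrix (Fin M) (Fin M) ℂ).conjTranspose * A.conjTranspose

/-- The condition number `κ(A) = ‖A‖ ‖A⁺‖` (spectral norms): the ratio of the largest to the
smallest non-zero singular value. -/
def condNumber {N M : ℕ} (A : Matrix (Fin N) (Fin M) ℂ) : ℝ := ‖A‖ * ‖pinv A‖

/-- The minimum-norm least-squares solution `x* = A⁺ b`. -/
def optSol {N M : ℕ} (A : Matrix (Fin N) (Fin M) ℂ) (b : EuclideanSpace ℂ (Fin N)) :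
    EuclideanSpace ℂ (Fin M) := Matrix.toEuclideanLin (pinv A) b

/-- The `j`-th column of `A`. -/
def column {N M : ℕ} (A : Matrix (Fin N) (Fin M) ℂ) (j : Fin M) : EuclideanSpace ℂ (Fin N) :=
  WithLp.toLp 2 fun i => A i j

/-- `Γ₁ = max_j max(‖a_j‖ ‖b‖, ‖a_j‖²)`. -/
def Gamma1 {N M : ℕ} (A : Matrix (Fin N) (Fin M) ℂ) (b : EuclideanSpace ℂ (Fin N)) : ℝ :=
  ⨆ j : Fin M, max (‖column A j‖ * ‖b‖) (‖column A j‖ ^ 2)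

/-- `Γ₁² M³ ‖A⁺‖⁴ κ(A)⁴ ‖b‖² (‖A‖ (‖x*‖ + 1) + ε)² / ε⁴`. -/
def timeTerm {N M : ℕ} (A : Matrix (Fin N) (Fin M) ℂ) (b : EuclideanSpace ℂ (Fin N))
    (ε : ℝ) : ℝ :=
  Gamma1 A b ^ 2 * (M : ℝ) ^ 3 * ‖pinv A‖ ^ 4 * condNumber A ^ 4 * ‖b‖ ^ 2 *
    (‖A‖ * (‖optSol A b‖ + 1) + ε) ^ 2 / ε ^ 4

/-- `x` solves `min_y ‖A y - b‖` up to additive error `ε`. -/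
def IsApproxSolution {N M : ℕ} (A : Matrix (Fin N) (Fin M) ℂ) (b : EuclideanSpace ℂ (Fin N))
    (ε : ℝ) (x : EuclideanSpace ℂ (Fin M)) : Prop :=
  ‖Matrix.toEuclideanLin A x - b‖ -
    (⨅ y : EuclideanSpace ℂ (Fin M), ‖Matrix.toEuclideanLin A y - b‖) ≤ ε

/-! ### Quantum circuits -/

/-- The computational basis of `n` qubits. -/
abbrev Basis (n : ℕ) : Type := Fin n → Fin 2

/-- An elementary gate: a unitary on one or two of the `n` qubits. -/
structure Gate (n : ℕ) where
  wires : Finset (Fin n)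
  nonempty : wires.Nonempty
  card_le : wires.card ≤ 2
  u : Matrix.unitaryGroup (wires → Fin 2) ℂ

/-- The matrix of a gate on all `n` qubits: the identity on the qubits it does not touch. -/
def Gate.mat {n : ℕ} (g : Gate n) : Matrix (Basis n) (Basis n) ℂ :=
  Matrix.of fun x y =>
    if ∀ q, q ∉ g.wires → x q = y q then
      (g.u : Matrix (g.wires → Fin 2) (g.wires → Fin 2) ℂ) (fun q => x q) (fun q => y q)
    else 0

theorem Gate.mat_mem {n : ℕ} (g : Gate n) : g.mat ∈ Matrix.unitaryGroup (Basis n) ℂ := by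
  have key : g.mat = ((g.u : Matrix (g.wires → Fin 2) (g.wires → Fin 2) ℂ).kronecker
      (1 : Matrix ({q // q ∉ g.wires} → Fin 2) ({q // q ∉ g.wires} → Fin 2) ℂ)).submatrix
      (Equiv.piEquivPiSubtypeProd (fun q => q ∈ g.wires) fun _ => Fin 2)
      (Equiv.piEquivPiSubtypeProd (fun q => q ∈ g.wires) fun _ => Fin 2) := by
    ext x y
    simp only [Gate.mat, Matrix.of_apply, Matrix.submatrix_apply, Matrix.kronecker,
      Matrix.kroneckerMap_apply, Equiv.piEquivPiSubtypeProd_apply, Matrix.one_apply, mul_ite,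
      mul_one, mul_zero, funext_iff, Subtype.forall]
  rw [key, Matrix.mem_unitaryGroup_iff, Matrix.star_eq_conjTranspose, Matrix.conjTranspose_submatrix,
    Matrix.submatrix_mul_equiv, ← Matrix.star_eq_conjTranspose]
  have h := Matrix.mem_unitaryGroup_iff.1 (Matrix.kronecker_mem_unitary g.u.2
    (one_mem (Matrix.unitaryGroup ({q // q ∉ g.wires} → Fin 2) ℂ)))
  rw [Matrix.kronecker, h, Matrix.submatrix_one_equiv]

/-- A circuit is a list of layers; the gates of one layer act on disjoint sets of qubits. -/
structure Circuit (n : ℕ) where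
  layers : List (List (Gate n))
  disj : ∀ l ∈ layers, l.Pairwise fun g h => Disjoint g.wires h.wires

/-- The depth: the number of layers. -/
def Circuit.depth {n : ℕ} (c : Circuit n) : ℕ := c.layers.length

/-- The gates in the order in which they are applied. -/
def Circuit.gates {n : ℕ} (c : Circuit n) : List (Gate n) := c.layers.flatten

/-- The size: the number of gates. -/
def Circuit.size {n : ℕ} (c : Circuit n) : ℕ := c.gates.length

/-- The unitary of a circuit (the first gate is the rightmost factor). -/
def Circuit.unitary {n : ℕ} (c : Circuit n) : Matrix.unitaryGroup (Basis n) ℂ :=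
  (c.gates.map fun g => (⟨g.mat, g.mat_mem⟩ : Matrix.unitaryGroup (Basis n) ℂ)).reverse.prod

/-- The matrix of a circuit. -/
def Circuit.mat {n : ℕ} (c : Circuit n) : Matrix (Basis n) (Basis n) ℂ := c.unitary

/-- The amplitudes of the state `U |0…0⟩` prepared by a circuit. -/
def Circuit.state {n : ℕ} (c : Circuit n) (x : Basis n) : ℂ := c.mat x 0

theorem Circuit.sum_state {n : ℕ} (c : Circuit n) :
    ∑ x, ENNReal.ofReal (‖c.state x‖ ^ 2) = 1 := by
  rw [← ENNReal.ofReal_sum_of_nonneg (fun _ _ => by positivity)]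
  have h := congrFun (congrFun (Matrix.mem_unitaryGroup_iff'.1 c.unitary.2) 0) 0
  rw [Matrix.mul_apply, Matrix.one_apply_eq] at h
  have h2 : ((∑ x, ‖c.state x‖ ^ 2 : ℝ) : ℂ) = 1 := by
    rw [← h]
    push_cast
    refine Finset.sum_congr rfl fun x _ => ?_
    rw [Matrix.star_apply]
    exact (Complex.conj_mul' _).symm
  rw [show (∑ x, ‖c.state x‖ ^ 2 : ℝ) = 1 by exact_mod_cast h2, ENNReal.ofReal_one]

/-- Run the circuit on `|0…0⟩` and measure qubit `q` in the computational basis (Born rule). -/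
def Circuit.measure {n : ℕ} (c : Circuit n) (q : Fin n) : PMF (Fin 2) :=
  (PMF.ofFintype (fun x : Basis n => ENNReal.ofReal (‖c.state x‖ ^ 2)) c.sum_state).map fun x => x q

/-! ### The Hadamard test -/

/-- A single-qubit matrix acting on qubit `0` of `n + 1` qubits. -/
def onAncilla {n : ℕ} (g : Matrix (Fin 2) (Fin 2) ℂ) :
    Matrix (Basis (n + 1)) (Basis (n + 1)) ℂ :=
  Matrix.of fun x y => if Fin.tail x = Fin.tail y then g (x 0) (y 0) else 0

/-- `U` on qubits `1, …, n`, controlled by qubit `0`. -/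
def controlled {n : ℕ} (U : Matrix (Basis n) (Basis n) ℂ) :
    Matrix (Basis (n + 1)) (Basis (n + 1)) ℂ :=
  Matrix.of fun x y =>
    if x 0 = y 0 then
      (if x 0 = 1 then U else 1 : Matrix (Basis n) (Basis n) ℂ) (Fin.tail x) (Fin.tail y)
    else 0

/-- The Hadamard gate. -/
def hadamardGate : Matrix (Fin 2) (Fin 2) ℂ :=
  ((Real.sqrt 2 : ℝ) : ℂ)⁻¹ • !![1, 1; 1, -1]

/-- The parts of an amplitude that a Hadamard test can estimate. -/
inductive Part
  | re
  | im

/-- The phase gate of the test: trivial for the real part, `diag(1, -i)` for the imaginary part. -/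
def phaseGate : Part → Matrix (Fin 2) (Fin 2) ℂ
  | Part.re => 1
  | Part.im => !![1, 0; 0, -Complex.I]

/-- The unitary of the Hadamard test of `{|0⟩, U}`. Measuring qubit `0` after it has been applied to
`|0…0⟩` yields `0` with probability `(1 + Re ⟨0|U|0⟩) / 2`, respectively
`(1 + Im ⟨0|U|0⟩) / 2`. -/
def hadamardTest {n : ℕ} (p : Part) (U : Matrix (Basis n) (Basis n) ℂ) :
    Matrix (Basis (n + 1)) (Basis (n + 1)) ℂ :=
  onAncilla hadamardGate * onAncilla (phaseGate p) * controlled U * onAncilla hadamardGate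

/-- A rule that turns two circuits for `U₁`, `U₂` into a circuit of one- and two-qubit gates for the
Hadamard test of `{|0⟩, U₁ᴴ U₂}`, with linear overhead. -/
def IsHadamardCompiler (comp : ∀ n : ℕ, Circuit n → Circuit n → Part → Circuit (n + 1))
    (C : ℝ) : Prop :=
  ∀ (n : ℕ) (c₁ c₂ : Circuit n) (p : Part),
    (comp n c₁ c₂ p).mat = hadamardTest p (c₁.mat.conjTranspose * c₂.mat) ∧
      ((comp n c₁ c₂ p).size : ℝ) ≤ C * (c₁.size + c₂.size + 1)

/-! ### Quantum access to the input -/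

/-- A vector of length `N`, padded by zeros to a vector of amplitudes on `⌈log₂ N⌉` qubits. -/
def pad {N : ℕ} (v : Fin N → ℂ) (x : Basis (Nat.clog 2 N)) : ℂ :=
  if h : (finFunctionFinEquiv x : ℕ) < N then v ⟨finFunctionFinEquiv x, h⟩ else 0

/-- Quantum access to a matrix: column `j` is `nrm j • U_j |0…0⟩`, where `nrm j ≥ 0` is known
and `U_j` is given by a circuit of depth at most `d`. -/
structure ColumnAccess {N M : ℕ} (A : Matrix (Fin N) (Fin M) ℂ) (nrm : Fin M → ℝ)
    (U : Fin M → Circuit (Nat.clog 2 N)) (d : ℕ) : Prop where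
  nonneg : ∀ j, 0 ≤ nrm j
  column_eq : ∀ j x, pad (fun i => A i j) x = nrm j * (U j).state x
  depth_le : ∀ j, (U j).depth ≤ d

/-- Quantum access to a vector: `b = nrm • U_b |0…0⟩`, where `nrm > 0` is known and `U_b` is given
by a circuit of depth at most `d`. -/
structure VectorAccess {N : ℕ} (b : EuclideanSpace ℂ (Fin N)) (nrm : ℝ)
    (U : Circuit (Nat.clog 2 N)) (d : ℕ) : Prop where
  pos : 0 < nrm
  vector_eq : ∀ x, pad (fun i => b i) x = nrm * U.state x
  depth_le : U.depth ≤ d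

/-! ### A hybrid random access machine

Programs with natural-number registers, two-dimensional arrays of complex numbers (exact arithmetic
at unit cost), counted loops, comparisons of real parts, and an instruction that runs a quantum
circuit and stores the measured bit. -/

/-- The memory: natural-number registers, and complex arrays `arr name row column`. -/
structure Mem where
  nat : ℕ → ℕ
  arr : ℕ → ℕ → ℕ → ℂ

/-- Write a natural-number register. -/
def Mem.setNat (m : Mem) (r v : ℕ) : Mem := { m with nat := Function.update m.nat r v }

/-- Write an array cell. -/
def Mem.setArr (m : Mem) (a i j : ℕ) (z : ℂ) : Mem :=
  { m with arr := fun a' i' j' => if a' = a ∧ i' = i ∧ j' = j then z else m.arr a' i' j' }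

/-- Index expressions. -/
inductive NExpr
  | lit (k : ℕ)
  | reg (r : ℕ)
  | add (e f : NExpr)
  | sub (e f : NExpr)

/-- The value of an index expression (subtraction is truncated). -/
def NExpr.eval (m : Mem) : NExpr → ℕ
  | lit k => k
  | reg r => m.nat r
  | add e f => e.eval m + f.eval m
  | sub e f => e.eval m - f.eval m

/-- The cost of evaluating an index expression: its number of nodes. -/
def NExpr.cost : NExpr → ℕ
  | lit _ => 1
  | reg _ => 1
  | add e f => e.cost + f.cost + 1
  | sub e f => e.cost + f.cost + 1

/-- Arithmetic expressions over the complex numbers. -/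
inductive CExpr
  | int (k : ℤ)
  | imag
  | cast (e : NExpr)
  | get (a : ℕ) (i j : NExpr)
  | add (e f : CExpr)
  | sub (e f : CExpr)
  | mul (e f : CExpr)
  | div (e f : CExpr)
  | conj (e : CExpr)

/-- The value of an arithmetic expression (with `z / 0 = 0`). -/
def CExpr.eval (m : Mem) : CExpr → ℂ
  | int k => k
  | imag => Complex.I
  | cast e => (e.eval m : ℂ)
  | get a i j => m.arr a (i.eval m) (j.eval m)
  | add e f => e.eval m + f.eval m
  | sub e f => e.eval m - f.eval m
  | mul e f => e.eval m * f.eval m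
  | div e f => e.eval m / f.eval m
  | conj e => (starRingEnd ℂ) (e.eval m)

/-- The cost of evaluating an arithmetic expression: its number of nodes. -/
def CExpr.cost : CExpr → ℕ
  | int _ => 1
  | imag => 1
  | cast e => e.cost + 1
  | get _ i j => i.cost + j.cost + 1
  | add e f => e.cost + f.cost + 1
  | sub e f => e.cost + f.cost + 1
  | mul e f => e.cost + f.cost + 1
  | div e f => e.cost + f.cost + 1
  | conj e => e.cost + 1

/-- Programs. -/
inductive Cmd
  /-- do nothing -/
  | skip
  /-- first `c`, then `d` -/
  | seq (c d : Cmd)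
  /-- natural-number register `r := e` -/
  | setNat (r : ℕ) (e : NExpr)
  /-- array cell `a[i, j] := e` -/
  | setArr (a : ℕ) (i j : NExpr) (e : CExpr)
  /-- register `r := ⌈Re e⌉`, computed by counting -/
  | ceil (r : ℕ) (e : CExpr)
  /-- if `Re e ≤ Re f` then `c` else `d` -/
  | ite (e f : CExpr) (c d : Cmd)
  /-- for `r = 0, …, e - 1` do `c` (`e` is evaluated once, at the start) -/
  | loop (r : ℕ) (e : NExpr) (c : Cmd)
  /-- cell `a[i, j] :=` the bit measured in one run of the Hadamard test number `(e, f, p)` -/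
  | test (a : ℕ) (i j : NExpr) (e f : NExpr) (p : Part)

/-- A program is classical if it runs no quantum circuit. -/
def Cmd.Classical : Cmd → Prop
  | skip => True
  | seq c d => c.Classical ∧ d.Classical
  | setNat _ _ => True
  | setArr _ _ _ _ => True
  | ceil _ _ => True
  | ite _ _ c d => c.Classical ∧ d.Classical
  | loop _ _ c => c.Classical
  | test _ _ _ _ _ _ => False

/-- Iterate a randomized step with a step count; every round costs one more step. -/
def iterate (f : ℕ → Mem → PMF (Mem × ℕ)) : ℕ → Mem → PMF (Mem × ℕ)
  | 0, m => PMF.pure (m, 1)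
  | k + 1, m => (iterate f k m).bind fun r =>
      (f k r.1).map fun s => (s.1, r.2 + s.2 + 1)

/-- The joint distribution of the final memory and the number of steps, where `circ e f p` is the
circuit of the Hadamard test number `(e, f, p)`. Running a circuit costs as many steps as it
has gates, and one more for the measurement of qubit `0`. -/
def run {n : ℕ} (circ : ℕ → ℕ → Part → Circuit (n + 1)) : Cmd → Mem → PMF (Mem × ℕ)
  | .skip, m => PMF.pure (m, 1)
  | .seq c d, m => (run circ c m).bind fun r =>
      (run circ d r.1).map fun s => (s.1, r.2 + s.2)
  | .setNat r e, m => PMF.pure (m.setNat r (e.eval m), e.cost + 1)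
  | .setArr a i j e, m =>
      PMF.pure (m.setArr a (i.eval m) (j.eval m) (e.eval m), i.cost + j.cost + e.cost + 1)
  | .ceil r e, m => PMF.pure (m.setNat r ⌈(e.eval m).re⌉₊, ⌈(e.eval m).re⌉₊ + e.cost + 1)
  | .ite e f c d, m =>
      (if (e.eval m).re ≤ (f.eval m).re then run circ c m else run circ d m).map fun s =>
        (s.1, s.2 + e.cost + f.cost + 1)
  | .loop r e c, m =>
      (iterate (fun i m' => run circ c (m'.setNat r i)) (e.eval m) m).map fun s =>
        (s.1, s.2 + e.cost)
  | .test a i j e f p, m =>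
      ((circ (e.eval m) (f.eval m) p).measure 0).map fun z =>
        (m.setArr a (i.eval m) (j.eval m) ((z : ℕ) : ℂ),
          (circ (e.eval m) (f.eval m) p).size + 1 + i.cost + j.cost + e.cost + f.cost + 1)

/-! ### The algorithm -/

/-! Natural-number registers. All others are scratch registers. -/

/-- `M` -/
abbrev rM : ℕ := 0
/-- number of repetitions of each Hadamard test -/
abbrev rS : ℕ := 1
/-- row index -/
abbrev rJ : ℕ := 2
/-- column index -/
abbrev rK : ℕ := 3
/-- repetition index -/
abbrev rT : ℕ := 4

/-! Arrays. All others are scratch arrays. A scalar is kept in cell `[0, 0]`. -/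

/-- input: cell `[j, 0]` holds `‖a_j‖` for `j < M`, cell `[M, 0]` holds `‖b‖` -/
abbrev aNrm : ℕ := 0
/-- input: `‖A‖` -/
abbrev aA : ℕ := 1
/-- input: `‖A⁺‖` -/
abbrev aAinv : ℕ := 2
/-- input: `‖x*‖` -/
abbrev aXs : ℕ := 3
/-- input: `ε` -/
abbrev aEps : ℕ := 4
/-- input: the factor hidden in the `O(·)` of the number of repetitions -/
abbrev aRho : ℕ := 5
/-- `Γ₁` -/
abbrev aGam : ℕ := 6
/-- the shift `λ` -/
abbrev aLam : ℕ := 7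
/-- accumulator for the estimates -/
abbrev aAcc : ℕ := 8
/-- the last measured bit -/
abbrev aBit : ℕ := 9
/-- the shifted estimated matrix `Ŵ` -/
abbrev aW : ℕ := 10
/-- the estimated right-hand side `q̂` -/
abbrev aQ : ℕ := 11
/-- output: cell `[j, 0]` holds `x̂_j` -/
abbrev aX : ℕ := 12

/-- Read a scalar. -/
def sc (a : ℕ) : CExpr := .get a (.lit 0) (.lit 0)

/-- Write a scalar. -/
def setSc (a : ℕ) (e : CExpr) : Cmd := .setArr a (.lit 0) (.lit 0) e

/-- Read the norm of the vector number `e` (column `a_e` if `e < M`, and `b` if `e = M`). -/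
def nrmOf (e : NExpr) : CExpr := .get aNrm e (.lit 0)

/-- Squares. -/
def CExpr.sq (e : CExpr) : CExpr := .mul e e

/-- `Γ₁ := max_j {‖a_j‖ ‖b‖, ‖a_j‖²}` -/
def computeGamma : Cmd :=
  .seq (setSc aGam (.int 0)) <|
  .loop rJ (.reg rM) <|
    .seq (.ite (sc aGam) (.mul (nrmOf (.reg rJ)) (nrmOf (.reg rM)))
        (setSc aGam (.mul (nrmOf (.reg rJ)) (nrmOf (.reg rM)))) .skip)
      (.ite (sc aGam) (nrmOf (.reg rJ)).sq
        (setSc aGam (nrmOf (.reg rJ)).sq) .skip)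

/-- `λ := ε / (2 ‖A‖² ‖A⁺‖⁴ ‖b‖)` -/
def computeLambda : Cmd :=
  setSc aLam <| .div (sc aEps) <|
    .mul (.int 2) <| .mul (sc aA).sq <| .mul (sc aAinv).sq.sq (nrmOf (.reg rM))

/-- `T := ρ M ‖A⁺‖⁴ κ(A)⁴ ‖b‖² (‖A‖ (‖x*‖ + 1) + ε)² / ε⁴` -/
def exprT : CExpr :=
  .div
    (.mul (sc aRho) <| .mul (.cast (.reg rM)) <| .mul (sc aAinv).sq.sq <|
      .mul (CExpr.mul (sc aA) (sc aAinv)).sq.sq <| .mul (nrmOf (.reg rM)).sq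
        (CExpr.add (.mul (sc aA) (.add (sc aXs) (.int 1))) (sc aEps)).sq)
    (sc aEps).sq.sq

/-- The number of repetitions `⌈Γ₁² T⌉`. -/
def computeS : Cmd := .ceil rS (.mul (sc aGam).sq exprT)

/-- Estimate `⟨0|U_eᴴ U_f|0⟩` by repeating the Hadamard tests for its real and imaginary parts
independently: a part is estimated by the average of `1 - 2 z` over the measured bits `z`. The
estimate is left in the accumulator. -/
def estimate (e f : NExpr) : Cmd :=
  .seq (setSc aAcc (.int 0)) <|
  .seq
    (.loop rT (.reg rS) <|
      .seq (.test aBit (.lit 0) (.lit 0) e f .re) <|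
      .seq (setSc aAcc (.add (sc aAcc) (.sub (.int 1) (.mul (.int 2) (sc aBit))))) <|
      .seq (.test aBit (.lit 0) (.lit 0) e f .im) <|
        setSc aAcc (.add (sc aAcc) (.mul .imag (.sub (.int 1) (.mul (.int 2) (sc aBit)))))) <|
  setSc aAcc (.div (sc aAcc) (.cast (.reg rS)))

/-- `Ŵ_jk := ‖a_j‖ ‖a_k‖ v_jk` for all `j, k`, and then `Ŵ_jj := Ŵ_jj + λ` for all `j`. -/
def computeW : Cmd :=
  .loop rJ (.reg rM) <|
    .seq
      (.loop rK (.reg rM) <|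
        .seq (estimate (.reg rJ) (.reg rK)) <|
          .setArr aW (.reg rJ) (.reg rK)
            (.mul (.mul (nrmOf (.reg rJ)) (nrmOf (.reg rK))) (sc aAcc)))
      (.setArr aW (.reg rJ) (.reg rJ) (.add (.get aW (.reg rJ) (.reg rJ)) (sc aLam)))

/-- `q̂_j := ‖a_j‖ ‖b‖ u_j` for all `j`. -/
def computeQ : Cmd :=
  .loop rJ (.reg rM) <|
    .seq (estimate (.reg rJ) (.reg rM)) <|
      .setArr aQ (.reg rJ) (.lit 0)
        (.mul (.mul (nrmOf (.reg rJ)) (nrmOf (.reg rM))) (sc aAcc))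

/-- The hybrid algorithm for over-determined systems, with the classical subroutine `solve` for
`x̂ := Ŵ⁻¹ q̂`. -/
def hybridAlgorithm (solve : Cmd) : Cmd :=
  .seq computeGamma <| .seq computeLambda <| .seq computeS <|
    .seq computeW <| .seq computeQ solve

/-- The `M × M` matrix stored in the array `aW`. -/
def Mem.matW (m : Mem) (M : ℕ) : Matrix (Fin M) (Fin M) ℂ := Matrix.of fun j k => m.arr aW j k

/-- The vector stored in the array `aQ`. -/
def Mem.vecQ (m : Mem) (M : ℕ) : Fin M → ℂ := fun j => m.arr aQ j 0

/-- The vector stored in the array `aX`. -/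
def Mem.vecX (m : Mem) (M : ℕ) : Fin M → ℂ := fun j => m.arr aX j 0

/-- A classical program that computes `W⁻¹ q` for every invertible `W` of every size `M × M`, and
that always stops after at most `C (M³ + 1)` steps. -/
def IsLinearSolver (solve : Cmd) (C : ℝ) : Prop :=
  solve.Classical ∧
  ∀ (n : ℕ) (circ : ℕ → ℕ → Part → Circuit (n + 1)) (m : Mem) (M : ℕ), m.nat rM = M →
    ∀ r ∈ (run circ solve m).support,
      (r.2 : ℝ) ≤ C * ((M : ℝ) ^ 3 + 1) ∧
      (IsUnit (m.matW M).det → r.1.vecX M = (m.matW M)⁻¹.mulVec (m.vecQ M))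

/-- The initial memory: the dimension `M`, the norms `‖a_j‖` and `‖b‖`, the parameters `‖A‖`, `‖A⁺‖`,
`‖x*‖`, `ε`, and the factor `ρ` in the number of repetitions. -/
def initMem {N M : ℕ} (A : Matrix (Fin N) (Fin M) ℂ) (b : EuclideanSpace ℂ (Fin N))
    (nrm : Fin M → ℝ) (nrmB : ℝ) (ε ρ : ℝ) : Mem where
  nat r := if r = rM then M else 0
  arr a i j :=
    if j ≠ 0 then 0
    else if a = aNrm then
      (if h : i < M then (nrm ⟨i, h⟩ : ℂ) else if i = M then (nrmB : ℂ) else 0)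
    else if i ≠ 0 then 0
    else if a = aA then (‖A‖ : ℂ)
    else if a = aAinv then (‖pinv A‖ : ℂ)
    else if a = aXs then (‖optSol A b‖ : ℂ)
    else if a = aEps then (ε : ℂ)
    else if a = aRho then (ρ : ℂ)
    else 0

/-- The Hadamard test circuits: index `j < M` refers to `U_j`, the index `M` to `U_b`. -/
def testCircuit (comp : ∀ n : ℕ, Circuit n → Circuit n → Part → Circuit (n + 1))
    {n M : ℕ} (U : Fin M → Circuit n) (Ub : Circuit n) (e f : ℕ) (p : Part) : Circuit (n + 1) :=
  comp n (if h : e < M then U ⟨e, h⟩ else Ub) (if h : f < M then U ⟨f, h⟩ else Ub) p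

/-- The joint distribution of the output `x̂` and the running time of the algorithm. -/
def runAlgorithm (solve : Cmd)
    (comp : ∀ n : ℕ, Circuit n → Circuit n → Part → Circuit (n + 1))
    {N M : ℕ} (A : Matrix (Fin N) (Fin M) ℂ) (b : EuclideanSpace ℂ (Fin N))
    (nrm : Fin M → ℝ) (U : Fin M → Circuit (Nat.clog 2 N))
    (nrmB : ℝ) (Ub : Circuit (Nat.clog 2 N)) (ε ρ : ℝ) :
    PMF (EuclideanSpace ℂ (Fin M) × ℕ) :=
  (run (testCircuit comp U Ub) (hybridAlgorithm solve) (initMem A b nrm nrmB ε ρ)).map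
    fun r => (WithLp.toLp 2 (r.1.vecX M), r.2)

end HybridLS

end

open HybridLS

/-!
Let `λ` be the regularization parameter. The matrix `Aᴴ A + λ` is invertible, and the solution `x`
of `(Aᴴ A + λ) x = Aᴴ b` is close to `x*`: since `x*` lies in the range of `Aᴴ A`, the bias is
linear in `λ`. The residual exceeds its minimum by at most `‖A (x̂ - x*)‖`, so it suffices to know
`Aᴴ A + λ` in spectral norm, and `Aᴴ b` in Euclidean norm, up to some tolerance `η`.

The errors of the `M²` entries are sums of independent centred bounded variables, hence
sub-Gaussian. For fixed unit vectors `u` and `v` the form `⟨u, (Ŵ - W) v⟩` is therefore sub-Gaussian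
with a variance proxy of order `Γ₁² / S` that does not depend on `M`, as the weights `|u j|² |v k|²`
add up to `1`. A union bound over `1/2`-nets of the unit ball, of cardinality at most `25 ^ M`,
gives `‖Ŵ - W‖ ≤ η` with probability `1 - δ` as soon as `S` is of order
`Γ₁² (M + log (1 / δ)) / η²`; this saves a factor `M` over the entrywise bound.

The probabilistic program is analysed through weakest preconditions of exponential moments, which
factor along the program; the linear solver makes the rows orthogonal by Gram–Schmidt, which needs
no pivoting. A controlled gate of at most two qubits is compiled by diagonalizing the gate: a
phase of at most two bits, controlled by a third one, is a product of one- and two-qubit gates.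
-/

noncomputable section

namespace HybridLS

/-! ### Diagonalization of unitary matrices -/

/-- The diagonal unitary matrix with the phases `exp (i θ x)`. -/
def phaseMatrix {ι : Type*} [DecidableEq ι] (θ : ι → ℝ) : Matrix ι ι ℂ :=
  Matrix.diagonal fun x => (Circle.exp (θ x) : ℂ)

section Diagonalization

variable {ι : Type*} [Fintype ι] [DecidableEq ι]

theorem phaseMatrix_add (θ φ : ι → ℝ) :
    phaseMatrix (θ + φ) = phaseMatrix θ * phaseMatrix φ := by
  simp only [phaseMatrix, Matrix.diagonal_mul_diagonal, Pi.add_apply, Circle.exp_add,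
    Circle.coe_mul]

theorem phaseMatrix_mem_unitaryGroup (θ : ι → ℝ) :
    phaseMatrix θ ∈ Matrix.unitaryGroup ι ℂ := by
  rw [Matrix.mem_unitaryGroup_iff, phaseMatrix, Matrix.star_eq_conjTranspose,
    Matrix.diagonal_conjTranspose, Matrix.diagonal_mul_diagonal, ← Matrix.diagonal_one]
  congr 1
  ext x
  simp only [Pi.star_apply, RCLike.star_def, Complex.mul_conj, Circle.normSq_coe,
    Complex.ofReal_one]

theorem exists_isHermitian_exp_eq {U : Matrix ι ι ℂ} (hU : U ∈ Matrix.unitaryGroup ι ℂ) :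
    ∃ H : Matrix ι ι ℂ, H.IsHermitian ∧ NormedSpace.exp (Complex.I • H) = U := by
  have : IsStarNormal U := ⟨(Unitary.mem_iff.1 hU).1.trans (Unitary.mem_iff.1 hU).2.symm⟩
  have hcont (f : ℂ → ℂ) : ContinuousOn f (spectrum ℂ U) := U.finite_spectrum.continuousOn f
  refine ⟨cfc (Complex.arg · : ℂ → ℂ) U, IsSelfAdjoint.cfc_arg U, ?_⟩
  rw [← cfc_smul _ _ _ (hcont _), ← CFC.exp_eq_normedSpace_exp (𝕜 := ℂ),
    ← cfc_comp' _ _ _ (by fun_prop) (hcont _)]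
  conv_rhs => rw [← cfc_id' ℂ U]
  refine cfc_congr fun z hz => ?_
  have hz1 : ‖z‖ = 1 := spectrum.norm_eq_one_of_unitary hU hz
  have := Complex.norm_mul_exp_arg_mul_I z
  rw [hz1, Complex.ofReal_one, one_mul] at this
  simpa only [smul_eq_mul, mul_comm, ← Complex.exp_eq_exp_ℂ] using this

theorem exists_eq_mul_phaseMatrix_mul {U : Matrix ι ι ℂ} (hU : U ∈ Matrix.unitaryGroup ι ℂ) :
    ∃ V ∈ Matrix.unitaryGroup ι ℂ, ∃ θ : ι → ℝ, U = V * phaseMatrix θ * V.conjTranspose := by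
  obtain ⟨H, hH, rfl⟩ := exists_isHermitian_exp_eq hU
  have hV := hH.eigenvectorUnitary.2
  refine ⟨hH.eigenvectorUnitary, hV, hH.eigenvalues, ?_⟩
  have hunit : IsUnit (hH.eigenvectorUnitary : Matrix ι ι ℂ) :=
    (Unitary.toUnits hH.eigenvectorUnitary).isUnit
  have hinv : (hH.eigenvectorUnitary : Matrix ι ι ℂ)⁻¹ =
      (hH.eigenvectorUnitary : Matrix ι ι ℂ).conjTranspose :=
    Matrix.inv_eq_right_inv (Matrix.mem_unitaryGroup_iff.1 hV)
  conv_lhs =>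
    rw [hH.spectral_theorem, Unitary.conjStarAlgAut_apply, Matrix.star_eq_conjTranspose, ← hinv,
      ← Matrix.smul_mul, ← Matrix.mul_smul, Matrix.exp_conj _ _ hunit, hinv]
  congr 2
  rw [← Matrix.diagonal_smul, Matrix.exp_diagonal, phaseMatrix]
  congr 1
  ext x
  simp [Pi.coe_exp, Complex.exp_eq_exp_ℂ, mul_comm]

end Diagonalization

/-! ### Local matrices and products of gates -/

/-- The matrix on all qubits of a matrix `u` on the qubits in `S`, acting as the identity on the
others; the matrix of a gate has this form. -/
def embed {n : ℕ} (S : Finset (Fin n)) (u : Matrix (S → Fin 2) (S → Fin 2) ℂ) :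
    Matrix (Basis n) (Basis n) ℂ :=
  Matrix.of fun x y => if ∀ q, q ∉ S → x q = y q then u (fun q => x q) (fun q => y q) else 0

section Embed

variable {n : ℕ} (S : Finset (Fin n))

open scoped Kronecker in
theorem embed_eq_submatrix (u : Matrix (S → Fin 2) (S → Fin 2) ℂ) :
    embed S u = (u ⊗ₖ (1 : Matrix ({q // q ∉ S} → Fin 2) ({q // q ∉ S} → Fin 2) ℂ)).submatrix
      (Equiv.piEquivPiSubtypeProd (fun q => q ∈ S) fun _ => Fin 2)
      (Equiv.piEquivPiSubtypeProd (fun q => q ∈ S) fun _ => Fin 2) := by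
  ext x y
  simp only [embed, Matrix.of_apply, Matrix.submatrix_apply, Matrix.kroneckerMap_apply,
    Equiv.piEquivPiSubtypeProd_apply, Matrix.one_apply, mul_ite, mul_one, mul_zero, funext_iff,
    Subtype.forall]

theorem embed_mul (u v : Matrix (S → Fin 2) (S → Fin 2) ℂ) :
    embed S (u * v) = embed S u * embed S v := by
  rw [embed_eq_submatrix, embed_eq_submatrix, embed_eq_submatrix, Matrix.submatrix_mul_equiv,
    ← Matrix.mul_kronecker_mul, one_mul]

theorem embed_conjTranspose (u : Matrix (S → Fin 2) (S → Fin 2) ℂ) :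
    embed S u.conjTranspose = (embed S u).conjTranspose := by
  rw [embed_eq_submatrix, embed_eq_submatrix, Matrix.conjTranspose_submatrix,
    Matrix.conjTranspose_kronecker, Matrix.conjTranspose_one]

theorem embed_one : embed S 1 = 1 := by
  rw [embed_eq_submatrix, Matrix.one_kronecker_one, Matrix.submatrix_one_equiv]

theorem embed_diagonal (f : (S → Fin 2) → ℂ) :
    embed S (Matrix.diagonal f) = Matrix.diagonal fun x => f fun q => x q := by
  ext x y
  simp only [embed, Matrix.of_apply, Matrix.diagonal_apply]
  by_cases hxy : x = y
  · simp [hxy]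
  · rw [if_neg hxy]
    split_ifs with h h'
    · exact absurd (funext fun q => by
        by_cases hq : q ∈ S
        exacts [congrFun h' ⟨q, hq⟩, h q hq]) hxy
    all_goals rfl

theorem embed_injective : Function.Injective (embed S) := by
  intro u v huv
  ext s t
  have := congrFun (congrFun huv fun q => if h : q ∈ S then s ⟨q, h⟩ else 0)
    fun q => if h : q ∈ S then t ⟨q, h⟩ else 0
  simpa +contextual [embed] using this

theorem embed_mem_unitaryGroup_iff {u : Matrix (S → Fin 2) (S → Fin 2) ℂ} :
    embed S u ∈ Matrix.unitaryGroup (Basis n) ℂ ↔ u ∈ Matrix.unitaryGroup (S → Fin 2) ℂ := by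
  rw [Matrix.mem_unitaryGroup_iff, Matrix.mem_unitaryGroup_iff, Matrix.star_eq_conjTranspose,
    Matrix.star_eq_conjTranspose, ← embed_conjTranspose, ← embed_mul, ← embed_one S,
    (embed_injective S).eq_iff]

end Embed

/-- `G` is a product of at most `k` elementary gates. -/
def IsGateProduct {n : ℕ} (G : Matrix (Basis n) (Basis n) ℂ) (k : ℕ) : Prop :=
  ∃ gs : List (Gate n), gs.length ≤ k ∧ (gs.map Gate.mat).reverse.prod = G

namespace IsGateProduct

variable {n : ℕ} {G H : Matrix (Basis n) (Basis n) ℂ} {k l : ℕ}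

theorem one : IsGateProduct (1 : Matrix (Basis n) (Basis n) ℂ) 0 :=
  ⟨[], le_rfl, rfl⟩

theorem mul (hG : IsGateProduct G k) (hH : IsGateProduct H l) : IsGateProduct (G * H) (k + l) := by
  obtain ⟨gs, hgs, rfl⟩ := hG
  obtain ⟨hs, hhs, rfl⟩ := hH
  exact ⟨hs ++ gs, by simpa [add_comm] using add_le_add hgs hhs, by simp⟩

theorem mono (hG : IsGateProduct G k) (h : k ≤ l) : IsGateProduct G l := by
  obtain ⟨gs, hgs, hprod⟩ := hG
  exact ⟨gs, hgs.trans h, hprod⟩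

theorem embed {S : Finset (Fin n)} (hne : S.Nonempty) (hcard : S.card ≤ 2)
    {u : Matrix (S → Fin 2) (S → Fin 2) ℂ} (hu : u ∈ Matrix.unitaryGroup (S → Fin 2) ℂ) :
    IsGateProduct (HybridLS.embed S u) 1 :=
  ⟨[⟨S, hne, hcard, u, hu⟩], le_rfl, mul_one _⟩

theorem induction {P : Matrix (Basis n) (Basis n) ℂ → ℕ → Prop} (hone : P 1 0)
    (hmul : ∀ (g : Gate n) G k, P G k → P (G * g.mat) (k + 1))
    (hmono : ∀ G k l, k ≤ l → P G k → P G l) (hG : IsGateProduct G k) : P G k := by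
  obtain ⟨gs, hgs, rfl⟩ := hG
  refine hmono _ _ _ hgs ?_
  clear hgs
  induction gs with
  | nil => simpa using hone
  | cons g gs ih => simpa using hmul g _ _ ih

theorem conjTranspose (hG : IsGateProduct G k) : IsGateProduct G.conjTranspose k := by
  refine hG.induction (P := fun G k => IsGateProduct G.conjTranspose k) (by simpa using one)
    (fun g G k ih => ?_) fun _ _ _ hle ih => ih.mono hle
  have hg : IsGateProduct g.mat.conjTranspose 1 := by
    rw [show g.mat = HybridLS.embed g.wires g.u from rfl, ← embed_conjTranspose]
    exact embed g.nonempty g.card_le (Unitary.star_mem g.u.2)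
  simpa [add_comm] using hg.mul ih

theorem mem_unitaryGroup (hG : IsGateProduct G k) : G ∈ Matrix.unitaryGroup (Basis n) ℂ :=
  hG.induction (P := fun G _ => G ∈ Matrix.unitaryGroup (Basis n) ℂ) (one_mem _)
    (fun g _ _ ih => mul_mem ih g.mat_mem) fun _ _ _ _ ih => ih

end IsGateProduct

namespace Circuit

variable {n : ℕ} (c : Circuit n)

theorem mat_eq_prod : c.mat = (c.gates.map Gate.mat).reverse.prod := by
  rw [Circuit.mat, Circuit.unitary, Submonoid.coe_list_prod, List.map_reverse, List.map_map]
  rfl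

theorem isGateProduct : IsGateProduct c.mat c.size :=
  ⟨c.gates, le_rfl, c.mat_eq_prod.symm⟩

theorem length_layer_le {l : List (Gate n)} (hl : l ∈ c.layers) : l.length ≤ n := by
  have hdisj : (l.map fun g => g.nonempty.choose).Nodup :=
    List.pairwise_map.2 <| (c.disj l hl).imp fun {g h} hgh =>
      hgh.forall_ne_finset g.nonempty.choose_spec h.nonempty.choose_spec
  simpa using hdisj.length_le_card

theorem size_le : c.size ≤ c.depth * n := by
  rw [Circuit.size, Circuit.gates, List.length_flatten, Circuit.depth]
  simpa using List.sum_le_card_nsmul (c.layers.map List.length) n fun k hk => by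
    obtain ⟨l, hl, rfl⟩ := List.mem_map.1 hk
    exact c.length_layer_le hl

end Circuit

theorem IsGateProduct.exists_circuit {n : ℕ} {G : Matrix (Basis n) (Basis n) ℂ} {k : ℕ}
    (h : IsGateProduct G k) : ∃ c : Circuit n, c.mat = G ∧ c.size ≤ k := by
  obtain ⟨gs, hgs, rfl⟩ := h
  have hflatten : (gs.map fun g => [g]).flatten = gs := by
    rw [← List.flatMap_def, List.flatMap_singleton']
  refine ⟨⟨gs.map fun g => [g], fun l hl => ?_⟩, ?_, ?_⟩
  · obtain ⟨g, -, rfl⟩ := List.mem_map.1 hl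
    exact List.pairwise_singleton _ _
  · rw [Circuit.mat_eq_prod, Circuit.gates, hflatten]
  · rwa [Circuit.size, Circuit.gates, hflatten]

/-! ### Compiling the Hadamard test -/

/-- `A` on the last `n` qubits if qubit `0` is set, and `B` if it is not. -/
def block {n : ℕ} (A B : Matrix (Basis n) (Basis n) ℂ) :
    Matrix (Basis (n + 1)) (Basis (n + 1)) ℂ :=
  (Matrix.blockDiagonal ![B, A]).submatrix
    ((Fin.consEquiv fun _ => Fin 2).symm.trans (Equiv.prodComm _ _))
    ((Fin.consEquiv fun _ => Fin 2).symm.trans (Equiv.prodComm _ _))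

section Block

variable {n : ℕ} (A B A' B' : Matrix (Basis n) (Basis n) ℂ)

theorem block_apply (x y : Basis (n + 1)) :
    block A B x y =
      if x 0 = y 0 then (if x 0 = 1 then A else B) (Fin.tail x) (Fin.tail y) else 0 := by
  rcases Fin.exists_fin_two.1 ⟨x 0, rfl⟩ with h | h <;>
    simp [block, Matrix.blockDiagonal_apply, h]

theorem block_mul : block A B * block A' B' = block (A * A') (B * B') := by
  rw [block, block, block, Matrix.submatrix_mul_equiv, ← Matrix.blockDiagonal_mul]
  congr 2
  ext z : 1
  fin_cases z <;> rfl

theorem block_one : block (1 : Matrix (Basis n) (Basis n) ℂ) 1 = 1 := by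
  have h : ![(1 : Matrix (Basis n) (Basis n) ℂ), 1] = 1 := by
    ext z : 1
    fin_cases z <;> rfl
  rw [block, h, Matrix.blockDiagonal_one, Matrix.submatrix_one_equiv]

theorem block_conjTranspose :
    (block A B).conjTranspose = block A.conjTranspose B.conjTranspose := by
  rw [block, block, Matrix.conjTranspose_submatrix, Matrix.blockDiagonal_conjTranspose]
  congr 2
  ext z : 1
  fin_cases z <;> rfl

theorem controlled_eq_block : controlled A = block A 1 := by
  ext x y
  rw [block_apply]
  rfl

theorem controlled_mul : controlled (A * A') = controlled A * controlled A' := by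
  rw [controlled_eq_block, controlled_eq_block, controlled_eq_block, block_mul, one_mul]

theorem controlled_one : controlled (1 : Matrix (Basis n) (Basis n) ℂ) = 1 := by
  rw [controlled_eq_block, block_one]

theorem controlled_conj (E G : Matrix (Basis n) (Basis n) ℂ) (hE : E * E.conjTranspose = 1) :
    controlled (E * G * E.conjTranspose) =
      block E E * controlled G * (block E E).conjTranspose := by
  rw [controlled_eq_block, controlled_eq_block, block_conjTranspose, block_mul, block_mul, mul_one,
    hE]

theorem controlled_diagonal (f : Basis n → ℂ) :
    controlled (Matrix.diagonal f) =
      Matrix.diagonal fun x => if x 0 = 1 then f (Fin.tail x) else 1 := by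
  ext x y
  cases x using Fin.consCases with | _ x₀ x
  cases y using Fin.consCases with | _ y₀ y
  simp only [controlled, Matrix.of_apply, Matrix.diagonal_apply, Fin.cons_zero,
    Fin.tail_cons, Fin.cons_inj]
  split_ifs <;> simp_all [Matrix.one_apply]

theorem block_embed (S : Finset (Fin n)) (u : Matrix (S → Fin 2) (S → Fin 2) ℂ) :
    block (embed S u) (embed S u) = embed (S.map (Fin.succEmb n)) (u.submatrix
      (fun s q => s ⟨q.1.succ, Finset.mem_map_of_mem _ q.2⟩)
      (fun s q => s ⟨q.1.succ, Finset.mem_map_of_mem _ q.2⟩)) := by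
  ext x y
  simp only [block_apply, ite_self, embed, Matrix.of_apply, ← ite_and, Fin.forall_fin_succ,
    Matrix.submatrix_apply]
  congr 1
  simp [Fin.tail, Fin.succ_ne_zero]

end Block

section ControlledGates

variable {n : ℕ}

theorem isGateProduct_phaseMatrix {S : Finset (Fin n)} (hne : S.Nonempty) (hcard : S.card ≤ 2)
    (θ : (S → Fin 2) → ℝ) :
    IsGateProduct (phaseMatrix fun x : Basis n => θ fun q => x q) 1 := by
  have := IsGateProduct.embed hne hcard (phaseMatrix_mem_unitaryGroup θ)
  rwa [phaseMatrix, embed_diagonal] at this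

theorem isGateProduct_controlled_phaseMatrix_one (a : Fin n) (α : Fin 2 → ℝ) :
    IsGateProduct (controlled (phaseMatrix fun x : Basis n => α (x a))) 1 := by
  have h : controlled (phaseMatrix fun x : Basis n => α (x a)) =
      phaseMatrix fun x => if x 0 = 1 then α (x a.succ) else 0 := by
    rw [phaseMatrix, controlled_diagonal, phaseMatrix]
    congr 1
    ext x
    split_ifs <;> simp [Fin.tail]
  rw [h]
  exact isGateProduct_phaseMatrix (S := {0, a.succ}) (by simp) Finset.card_le_two
    fun s => if s ⟨0, by simp⟩ = 1 then α (s ⟨a.succ, by simp⟩) else 0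

/-- The controlled negation of qubit `b`, with control `a`, as a permutation of basis states. -/
def cnot (a b : Fin n) (hab : a ≠ b) : Equiv.Perm (Basis n) :=
  Function.Involutive.toPerm (fun x => Function.update x b (x a + x b)) fun x => by
    have hbit (z : Fin 2) : z + z = 0 := by decide +revert
    simp only [Function.update_idem, Function.update_self, Function.update_of_ne hab, ← add_assoc,
      hbit, zero_add, Function.update_eq_self]

theorem cnot_apply_eq_iff {a b : Fin n} (hab : a ≠ b) (x y : Basis n) :
    cnot a b hab x = y ↔
      (∀ q, q ∉ ({a, b} : Finset (Fin n)) → x q = y q) ∧ x a = y a ∧ x a + x b = y b := by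
  have hupdate : cnot a b hab x = Function.update x b (x a + x b) := rfl
  rw [hupdate, Function.update_eq_iff]
  constructor
  · rintro ⟨hb, h⟩
    exact ⟨fun q hq => h q (ne_of_mem_of_not_mem (by simp) hq).symm, h a hab, hb⟩
  · rintro ⟨h, ha, hb⟩
    refine ⟨hb, fun q hq => ?_⟩
    by_cases hqa : q = a
    · rw [hqa, ha]
    · exact h q (by simp [hqa, hq])

theorem permMatrix_mem_unitaryGroup {ι : Type*} [Fintype ι] [DecidableEq ι] (σ : Equiv.Perm ι) :
    σ.permMatrix ℂ ∈ Matrix.unitaryGroup ι ℂ := by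
  rw [Matrix.mem_unitaryGroup_iff, Matrix.star_eq_conjTranspose, Matrix.conjTranspose_permMatrix,
    ← Matrix.permMatrix_mul, inv_mul_cancel, Matrix.permMatrix_one]

theorem permMatrix_conj_phaseMatrix {ι : Type*} [Fintype ι] [DecidableEq ι] (σ : Equiv.Perm ι)
    (θ : ι → ℝ) :
    σ.permMatrix ℂ * phaseMatrix θ * (σ.permMatrix ℂ).conjTranspose = phaseMatrix (θ ∘ σ) := by
  rw [Matrix.conjTranspose_permMatrix, Equiv.Perm.permMatrix, PEquiv.toMatrix_toPEquiv_mul,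
    Equiv.Perm.permMatrix, PEquiv.mul_toMatrix_toPEquiv, phaseMatrix, Matrix.submatrix_submatrix]
  exact Matrix.submatrix_diagonal_equiv _ σ

theorem isGateProduct_cnot {a b : Fin n} (hab : a ≠ b) :
    IsGateProduct ((cnot a b hab).permMatrix ℂ) 1 := by
  have h : (cnot a b hab).permMatrix ℂ = embed {a, b} (Matrix.of fun s t =>
      if s ⟨a, by simp⟩ = t ⟨a, by simp⟩ ∧ s ⟨a, by simp⟩ + s ⟨b, by simp⟩ = t ⟨b, by simp⟩
      then 1 else 0) := by
    ext x y
    simp only [Equiv.Perm.permMatrix, PEquiv.toMatrix_apply, Equiv.toPEquiv_apply,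
      Option.mem_some_iff, cnot_apply_eq_iff, embed, Matrix.of_apply, ite_and]
  rw [h]
  refine IsGateProduct.embed (by simp) Finset.card_le_two ((embed_mem_unitaryGroup_iff _).1 ?_)
  exact h ▸ permMatrix_mem_unitaryGroup _

theorem exists_parity_decomposition (θ : Fin 2 → Fin 2 → ℝ) :
    ∃ α β γ : Fin 2 → ℝ, ∀ p q, θ p q = α p + β q + γ (p + q) := by
  let a := (θ 0 0 + θ 1 0 + θ 1 1 - θ 0 1) / 2
  refine ⟨![θ 0 0, a], ![0, θ 1 1 - a], ![0, θ 1 0 - a], fun p q => ?_⟩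
  fin_cases p <;> fin_cases q <;> simp [a]
  ring

theorem IsGateProduct.block_self {G : Matrix (Basis n) (Basis n) ℂ} {k : ℕ}
    (hG : IsGateProduct G k) : IsGateProduct (block G G) k := by
  refine hG.induction (P := fun G k => IsGateProduct (block G G) k)
    (block_one (n := n) ▸ IsGateProduct.one) (fun g G k ih => ?_) fun _ _ _ hle ih => ih.mono hle
  rw [← block_mul]
  refine ih.mul ?_
  have hg : g.mat = HybridLS.embed g.wires g.u := rfl
  have h := block_embed g.wires g.u
  rw [hg, h]
  refine IsGateProduct.embed (by simpa using g.nonempty) (by simpa using g.card_le)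
    ((embed_mem_unitaryGroup_iff _).1 ?_)
  rw [← h, ← hg, Matrix.mem_unitaryGroup_iff, Matrix.star_eq_conjTranspose, block_conjTranspose,
    block_mul, ← Matrix.star_eq_conjTranspose, Matrix.mem_unitaryGroup_iff.1 g.mat_mem, block_one]

theorem IsGateProduct.controlled_conj {E G : Matrix (Basis n) (Basis n) ℂ} {k l : ℕ}
    (hE : IsGateProduct E k) (hG : IsGateProduct (controlled G) l) :
    IsGateProduct (controlled (E * G * E.conjTranspose)) (k + l + k) := by
  rw [HybridLS.controlled_conj _ _ (Matrix.mem_unitaryGroup_iff.1 hE.mem_unitaryGroup)]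
  exact (hE.block_self.mul hG).mul hE.block_self.conjTranspose

/-- Up to a controlled negation, a phase of two bits is a product of phases of single bits. -/
theorem isGateProduct_controlled_phaseMatrix_two {a b : Fin n} (hab : a ≠ b)
    (θ : Fin 2 → Fin 2 → ℝ) :
    IsGateProduct (controlled (phaseMatrix fun x : Basis n => θ (x a) (x b))) 5 := by
  obtain ⟨α, β, γ, hθ⟩ := exists_parity_decomposition θ
  have h : (phaseMatrix fun x : Basis n => θ (x a) (x b)) =
      (phaseMatrix fun x => α (x a)) * (phaseMatrix fun x => β (x b)) *
        ((cnot a b hab).permMatrix ℂ * (phaseMatrix fun x => γ (x b)) *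
          ((cnot a b hab).permMatrix ℂ).conjTranspose) := by
    rw [permMatrix_conj_phaseMatrix, ← phaseMatrix_add, ← phaseMatrix_add]
    congr 1
    ext x
    have hcnot : cnot a b hab x b = x a + x b := Function.update_self ..
    simp [hθ, hcnot]
  rw [h, controlled_mul, controlled_mul]
  exact ((isGateProduct_controlled_phaseMatrix_one a α).mul
    (isGateProduct_controlled_phaseMatrix_one b β)).mul
    ((isGateProduct_cnot hab).controlled_conj (isGateProduct_controlled_phaseMatrix_one b γ))

theorem isGateProduct_controlled_phaseMatrix {S : Finset (Fin n)} (hne : S.Nonempty)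
    (hcard : S.card ≤ 2) (θ : (S → Fin 2) → ℝ) :
    IsGateProduct (controlled (phaseMatrix fun x : Basis n => θ fun q => x q)) 5 := by
  obtain h | h : S.card = 1 ∨ S.card = 2 := by have := hne.card_pos; omega
  · obtain ⟨a, rfl⟩ := Finset.card_eq_one.1 h
    refine IsGateProduct.mono (k := 1) ?_ (by norm_num)
    convert isGateProduct_controlled_phaseMatrix_one a fun z => θ fun _ => z with x q
    exact Finset.mem_singleton.1 q.2
  · obtain ⟨a, b, hab, rfl⟩ := Finset.card_eq_two.1 h
    convert isGateProduct_controlled_phaseMatrix_two hab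
      fun z w => θ fun q => if q.1 = a then z else w with x q
    split_ifs with hq
    · rw [hq]
    · rw [(Finset.mem_insert.1 q.2).resolve_left hq |> Finset.mem_singleton.1]

/-- In an eigenbasis of the gate, the controlled gate is a controlled phase. -/
theorem isGateProduct_controlled_gate (g : Gate n) : IsGateProduct (controlled g.mat) 7 := by
  obtain ⟨V, hV, θ, hθ⟩ := exists_eq_mul_phaseMatrix_mul g.u.2
  have hg : g.mat = embed g.wires V * (phaseMatrix fun x : Basis n => θ fun q => x q) *
      (embed g.wires V).conjTranspose := by
    rw [show g.mat = embed g.wires g.u from rfl, hθ, embed_mul, embed_mul, embed_conjTranspose]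
    rw [phaseMatrix, phaseMatrix, embed_diagonal]
  rw [hg]
  exact (IsGateProduct.embed g.nonempty g.card_le hV).controlled_conj
    (isGateProduct_controlled_phaseMatrix g.nonempty g.card_le θ)

theorem IsGateProduct.controlled {G : Matrix (Basis n) (Basis n) ℂ} {k : ℕ}
    (hG : IsGateProduct G k) : IsGateProduct (controlled G) (7 * k) := by
  refine hG.induction (P := fun G k => IsGateProduct (HybridLS.controlled G) (7 * k))
    (controlled_one (n := n) ▸ IsGateProduct.one) (fun g G k ih => ?_)
    fun _ _ _ hle ih => ih.mono (Nat.mul_le_mul_left 7 hle)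
  rw [controlled_mul]
  exact ih.mul (isGateProduct_controlled_gate g)

end ControlledGates

section HadamardTest

theorem onAncilla_eq_embed {n : ℕ} (g : Matrix (Fin 2) (Fin 2) ℂ) :
    (onAncilla g : Matrix (Basis (n + 1)) _ ℂ) = embed {0} (g.submatrix
      (Equiv.funUnique _ (Fin 2)) (Equiv.funUnique _ (Fin 2))) := by
  ext x y
  simp only [onAncilla, embed, Matrix.of_apply, Matrix.submatrix_apply, Equiv.funUnique_apply,
    Fin.forall_fin_succ, funext_iff, Fin.tail]
  simp [Fin.succ_ne_zero]

theorem isGateProduct_onAncilla {n : ℕ} {g : Matrix (Fin 2) (Fin 2) ℂ}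
    (hg : g ∈ Matrix.unitaryGroup (Fin 2) ℂ) :
    IsGateProduct (onAncilla g : Matrix (Basis (n + 1)) _ ℂ) 1 := by
  rw [onAncilla_eq_embed]
  refine IsGateProduct.embed (by simp) (by simp) ?_
  rw [Matrix.mem_unitaryGroup_iff, Matrix.star_eq_conjTranspose, Matrix.conjTranspose_submatrix,
    Matrix.submatrix_mul_equiv, ← Matrix.star_eq_conjTranspose, Matrix.mem_unitaryGroup_iff.1 hg,
    Matrix.submatrix_one_equiv]

theorem hadamardGate_mem_unitaryGroup : hadamardGate ∈ Matrix.unitaryGroup (Fin 2) ℂ := by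
  have h : ((Real.sqrt 2 : ℝ) : ℂ)⁻¹ * ((Real.sqrt 2 : ℝ) : ℂ)⁻¹ = 1 / 2 := by
    rw [← mul_inv, ← Complex.ofReal_mul, Real.mul_self_sqrt (by norm_num)]
    norm_num
  rw [Matrix.mem_unitaryGroup_iff]
  ext i j
  fin_cases i <;> fin_cases j <;>
    simp [hadamardGate, Matrix.mul_apply, Fin.sum_univ_two, h] <;> norm_num

theorem phaseGate_mem_unitaryGroup (p : Part) : phaseGate p ∈ Matrix.unitaryGroup (Fin 2) ℂ := by
  cases p
  · exact one_mem _
  · rw [Matrix.mem_unitaryGroup_iff]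
    ext i j
    fin_cases i <;> fin_cases j <;> simp [phaseGate, Matrix.mul_apply, Fin.sum_univ_two]

theorem isGateProduct_hadamardTest {n : ℕ} (p : Part) {G : Matrix (Basis n) (Basis n) ℂ} {k : ℕ}
    (hG : IsGateProduct G k) : IsGateProduct (hadamardTest p G) (1 + 1 + 7 * k + 1) :=
  (((isGateProduct_onAncilla hadamardGate_mem_unitaryGroup).mul
    (isGateProduct_onAncilla (phaseGate_mem_unitaryGroup p))).mul hG.controlled).mul
    (isGateProduct_onAncilla hadamardGate_mem_unitaryGroup)

theorem exists_isHadamardCompiler :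
    ∃ comp : ∀ n : ℕ, Circuit n → Circuit n → Part → Circuit (n + 1),
      IsHadamardCompiler comp 7 := by
  choose comp hmat hsize using fun (n : ℕ) (c₁ c₂ : Circuit n) (p : Part) =>
    (isGateProduct_hadamardTest p
      (c₁.isGateProduct.conjTranspose.mul c₂.isGateProduct)).exists_circuit
  refine ⟨comp, fun n c₁ c₂ p => ⟨hmat n c₁ c₂ p, ?_⟩⟩
  have : (comp n c₁ c₂ p).size ≤ 7 * (c₁.size + c₂.size + 1) :=
    (hsize n c₁ c₂ p).trans (by omega)
  exact_mod_cast this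

end HadamardTest

/-! ### Program logic -/

namespace Mem

variable (m : Mem)

@[simp] theorem setNat_arr (r v : ℕ) : (m.setNat r v).arr = m.arr := rfl

@[simp] theorem setArr_nat (a i j : ℕ) (z : ℂ) : (m.setArr a i j z).nat = m.nat := rfl

@[simp] theorem setNat_nat_self (r v : ℕ) : (m.setNat r v).nat r = v := by
  simp [setNat]

theorem setNat_nat (r r' v : ℕ) : (m.setNat r v).nat r' = if r' = r then v else m.nat r' := by
  simp [setNat, Function.update_apply]

theorem setNat_nat_of_ne {r r' : ℕ} (v : ℕ) (h : r' ≠ r) : (m.setNat r v).nat r' = m.nat r' := by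
  rw [setNat_nat, if_neg h]

theorem setArr_arr (a i j : ℕ) (z : ℂ) (a' i' j' : ℕ) :
    (m.setArr a i j z).arr a' i' j' =
      if a' = a ∧ i' = i ∧ j' = j then z else m.arr a' i' j' := rfl

@[simp] theorem setArr_arr_self (a i j : ℕ) (z : ℂ) : (m.setArr a i j z).arr a i j = z := by
  simp [setArr_arr]

theorem setArr_arr_of_ne {a a' : ℕ} (i j : ℕ) (z : ℂ) (h : a' ≠ a) :
    (m.setArr a i j z).arr a' = m.arr a' := by
  ext i' j'
  simp [setArr_arr, h]

end Mem

section ProgramLogic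

variable {n : ℕ} {circ : ℕ → ℕ → Part → Circuit (n + 1)} {c d : Cmd} {m : Mem}

/-- Total correctness with a time bound: every run of `c` from `m` takes at most `t` steps and ends
in a memory that satisfies `Q`. -/
def Spec {n : ℕ} (circ : ℕ → ℕ → Part → Circuit (n + 1)) (c : Cmd) (m : Mem) (t : ℕ)
    (Q : Mem → Prop) : Prop :=
  ∀ r ∈ (run circ c m).support, r.2 ≤ t ∧ Q r.1

namespace Spec

variable {t t' : ℕ} {P Q : Mem → Prop}

theorem mono (h : Spec circ c m t P) (ht : t ≤ t') (hPQ : ∀ m', P m' → Q m') :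
    Spec circ c m t' Q := fun r hr => ⟨(h r hr).1.trans ht, hPQ _ (h r hr).2⟩

theorem skip (h : Q m) : Spec circ .skip m 1 Q := by
  rintro r hr
  obtain rfl := (PMF.mem_support_pure_iff _ _).1 hr
  exact ⟨le_rfl, h⟩

theorem seq (h : Spec circ c m t P) (h' : ∀ m', P m' → Spec circ d m' t' Q) :
    Spec circ (.seq c d) m (t + t') Q := by
  rintro r hr
  obtain ⟨r₁, hr₁, hr⟩ := (PMF.mem_support_bind_iff _ _ _).1 hr
  obtain ⟨r₂, hr₂, rfl⟩ := (PMF.mem_support_map_iff _ _ _).1 hr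
  have hc := h r₁ hr₁
  have hd := h' _ hc.2 r₂ hr₂
  exact ⟨add_le_add hc.1 hd.1, hd.2⟩

theorem setArr {a : ℕ} {i j : NExpr} {e : CExpr}
    (h : Q (m.setArr a (i.eval m) (j.eval m) (e.eval m))) :
    Spec circ (.setArr a i j e) m (i.cost + j.cost + e.cost + 1) Q := by
  rintro r hr
  obtain rfl := (PMF.mem_support_pure_iff _ _).1 hr
  exact ⟨le_rfl, h⟩

theorem setSc {a : ℕ} {e : CExpr} (h : Q (m.setArr a 0 0 (e.eval m))) :
    Spec circ (setSc a e) m (e.cost + 3) Q :=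
  (Spec.setArr (i := .lit 0) (j := .lit 0) (e := e) h).mono (by simp [NExpr.cost]; omega)
    fun _ h => h

theorem seqSc {a : ℕ} {e : CExpr} (t : ℕ) (ht : e.cost + 3 + t ≤ t')
    (h : Spec circ c (m.setArr a 0 0 (e.eval m)) t Q) :
    Spec circ (.seq (HybridLS.setSc a e) c) m t' Q :=
  ((Spec.setSc (Q := (· = m.setArr a 0 0 (e.eval m))) rfl).seq
    (by rintro _ rfl; exact h)).mono ht fun _ h => h

theorem ceil {r : ℕ} {e : CExpr} (h : Q (m.setNat r ⌈(e.eval m).re⌉₊)) :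
    Spec circ (.ceil r e) m (⌈(e.eval m).re⌉₊ + e.cost + 1) Q := by
  rintro r hr
  obtain rfl := (PMF.mem_support_pure_iff _ _).1 hr
  exact ⟨le_rfl, h⟩

theorem ite {e f : CExpr} (h : (e.eval m).re ≤ (f.eval m).re → Spec circ c m t Q)
    (h' : (f.eval m).re < (e.eval m).re → Spec circ d m t Q) :
    Spec circ (.ite e f c d) m (t + e.cost + f.cost + 1) Q := by
  rintro r hr
  obtain ⟨s, hs, rfl⟩ := (PMF.mem_support_map_iff _ _ _).1 hr
  have hst : s.2 ≤ t ∧ Q s.1 := by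
    split_ifs at hs with hef
    · exact h hef s hs
    · exact h' (not_le.1 hef) s hs
  exact ⟨by simpa using hst.1, hst.2⟩

theorem test {a : ℕ} {i j e f : NExpr} {p : Part}
    (h : ∀ z : ℕ, Q (m.setArr a (i.eval m) (j.eval m) (z : ℂ))) :
    Spec circ (.test a i j e f p) m
      ((circ (e.eval m) (f.eval m) p).size + 1 + i.cost + j.cost + e.cost + f.cost + 1) Q := by
  rintro r hr
  obtain ⟨z, -, rfl⟩ := (PMF.mem_support_map_iff _ _ _).1 hr
  exact ⟨le_rfl, h z⟩

theorem iterate {r k : ℕ} (I : ℕ → Mem → Prop) (h0 : I 0 m)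
    (hI : ∀ i < k, ∀ m', I i m' → Spec circ c (m'.setNat r i) t (I (i + 1))) :
    ∀ s ∈ (iterate (fun i m' => run circ c (m'.setNat r i)) k m).support,
      s.2 ≤ k * (t + 1) + 1 ∧ I k s.1 := by
  induction k with
  | zero =>
    rintro s hs
    obtain rfl := (PMF.mem_support_pure_iff _ _).1 hs
    exact ⟨by simp, h0⟩
  | succ k ih =>
    rintro s hs
    obtain ⟨s₁, hs₁, hs⟩ := (PMF.mem_support_bind_iff _ _ _).1 hs
    obtain ⟨s₂, hs₂, rfl⟩ := (PMF.mem_support_map_iff _ _ _).1 hs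
    have hk := ih (fun i hi => hI i (by omega)) s₁ hs₁
    have hc := hI k (by omega) _ hk.2 s₂ hs₂
    refine ⟨?_, hc.2⟩
    calc s₁.2 + s₂.2 + 1 ≤ (k * (t + 1) + 1) + t + 1 := by gcongr; exacts [hk.1, hc.1]
      _ = (k + 1) * (t + 1) + 1 := by ring

theorem loop {r k : ℕ} {e : NExpr} (he : e.eval m = k) (I : ℕ → Mem → Prop) (h0 : I 0 m)
    (hI : ∀ i < k, ∀ m', I i m' → Spec circ c (m'.setNat r i) t (I (i + 1))) :
    Spec circ (.loop r e c) m (k * (t + 1) + 1 + e.cost) (I k) := by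
  rintro s hs
  rw [run, PMF.mem_support_map_iff, he] at hs
  obtain ⟨s', hs', rfl⟩ := hs
  have hk := Spec.iterate I h0 hI s' hs'
  exact ⟨by simpa using hk.1, hk.2⟩

theorem seqLoop {r k : ℕ} {e : NExpr} (s t : ℕ) (he : e.eval m = k) (I : ℕ → Mem → Prop)
    (ht : k * (s + 1) + 1 + e.cost + t ≤ t') (h0 : I 0 m)
    (hI : ∀ i < k, ∀ m', I i m' → Spec circ c (m'.setNat r i) s (I (i + 1)))
    (hd : ∀ m', I k m' → Spec circ d m' t Q) : Spec circ (.seq (.loop r e c) d) m t' Q :=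
  ((Spec.loop he I h0 hI).seq hd).mono ht fun _ h => h

end Spec

end ProgramLogic

/-- The expectation `∑ a, p a * F a` of a function with values in `[0, ∞]`; no measurable structure
on `α` is needed. -/
def expect {α : Type*} (p : PMF α) (F : α → ENNReal) : ENNReal := ∑' a, p a * F a

section Expect

variable {α β : Type*}

theorem expect_pure (a : α) (F : α → ENNReal) : expect (PMF.pure a) F = F a := by
  rw [expect, tsum_eq_single a fun b hb => by simp [PMF.pure_apply, hb]]
  simp [PMF.pure_apply]

theorem expect_bind (p : PMF α) (f : α → PMF β) (F : β → ENNReal) :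
    expect (p.bind f) F = expect p fun a => expect (f a) F := by
  simp only [expect, PMF.bind_apply, ← ENNReal.tsum_mul_right, ← ENNReal.tsum_mul_left]
  rw [ENNReal.tsum_comm]
  simp only [mul_assoc]

theorem expect_map (p : PMF α) (f : α → β) (F : β → ENNReal) :
    expect (p.map f) F = expect p fun a => F (f a) := by
  simp only [PMF.map, expect_bind, Function.comp, expect_pure]

theorem expect_const (p : PMF α) (K : ENNReal) : expect p (fun _ => K) = K := by
  rw [expect, ENNReal.tsum_mul_right, PMF.tsum_coe, one_mul]

theorem expect_mono {p : PMF α} {F G : α → ENNReal} (h : ∀ a ∈ p.support, F a ≤ G a) :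
    expect p F ≤ expect p G := by
  refine ENNReal.tsum_le_tsum fun a => ?_
  by_cases ha : a ∈ p.support
  · exact mul_le_mul_right (h a ha) _
  · simp [(PMF.apply_eq_zero_iff _ _).2 ha]

theorem expect_const_mul (p : PMF α) (c : ENNReal) (F : α → ENNReal) :
    expect p (fun a => c * F a) = c * expect p F := by
  simp only [expect, ← ENNReal.tsum_mul_left, mul_left_comm]

theorem expect_add (p : PMF α) (F G : α → ENNReal) :
    expect p (fun a => F a + G a) = expect p F + expect p G := by
  simp only [expect, mul_add]
  exact ENNReal.tsum_add

end Expect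

/-- The quantitative weakest precondition: the expectation of a function of the final memory, as a
function of the initial memory. -/
def wp {n : ℕ} (circ : ℕ → ℕ → Part → Circuit (n + 1)) (c : Cmd) (F : Mem → ENNReal) (m : Mem) :
    ENNReal := expect (run circ c m) fun r => F r.1

section WeakestPrecondition

variable {n : ℕ} {circ : ℕ → ℕ → Part → Circuit (n + 1)} {c d : Cmd} {m : Mem}
  {F G : Mem → ENNReal}

theorem wp_seq : wp circ (.seq c d) F m = wp circ c (wp circ d F) m := by
  simp only [wp, run, expect_bind, expect_map]

theorem wp_setArr {a : ℕ} {i j : NExpr} {e : CExpr} :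
    wp circ (.setArr a i j e) F m = F (m.setArr a (i.eval m) (j.eval m) (e.eval m)) := by
  simp only [wp, run, expect_pure]

theorem wp_setSc {a : ℕ} {e : CExpr} : wp circ (setSc a e) F m = F (m.setArr a 0 0 (e.eval m)) :=
  wp_setArr

theorem wp_test {a : ℕ} {i j e f : NExpr} {p : Part} :
    wp circ (.test a i j e f p) F m =
      expect ((circ (e.eval m) (f.eval m) p).measure 0) fun z : Fin 2 =>
        F (m.setArr a (i.eval m) (j.eval m) ((z : ℕ) : ℂ)) := by
  rw [wp, run, expect_map]
  exact (expect_bind _ (fun z : Fin 2 => PMF.pure (z : ℕ)) _).trans (by simp only [expect_pure])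

theorem wp_mono (h : ∀ m', F m' ≤ G m') : wp circ c F m ≤ wp circ c G m :=
  expect_mono fun _ _ => h _

theorem Spec.wp_mono {t : ℕ} {Q : Mem → Prop} (hs : Spec circ c m t Q)
    (h : ∀ m', Q m' → F m' ≤ G m') : wp circ c F m ≤ wp circ c G m :=
  expect_mono fun r hr => h _ (hs r hr).2

theorem Spec.wp_le {t : ℕ} {Q : Mem → Prop} (hs : Spec circ c m t Q) {K : ENNReal}
    (h : ∀ m', Q m' → F m' ≤ K) : wp circ c F m ≤ K :=
  (hs.wp_mono h).trans_eq (expect_const _ K)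

theorem expect_iterate_le {f : ℕ → Mem → PMF (Mem × ℕ)} {k : ℕ} (Φ : ℕ → Mem → ENNReal)
    (hΦ : ∀ i < k, ∀ m', expect (f i m') (fun s => Φ (i + 1) s.1) ≤ Φ i m') :
    expect (iterate f k m) (fun s => Φ k s.1) ≤ Φ 0 m := by
  induction k with
  | zero => rw [iterate, expect_pure]
  | succ k ih =>
    simp only [iterate, expect_bind, expect_map]
    exact (expect_mono fun s _ => hΦ k (by omega) s.1).trans (ih fun i hi => hΦ i (by omega))

theorem wp_loop_le {r k : ℕ} {e : NExpr} (he : e.eval m = k) (I : ℕ → Mem → Prop)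
    (Φ : ℕ → Mem → ENNReal) (h0 : I 0 m)
    (hΦ : ∀ i < k, ∀ m', I i m' → ∀ G : Mem → ENNReal,
      (∀ m'', I (i + 1) m'' → G m'' ≤ Φ (i + 1) m'') → wp circ c G (m'.setNat r i) ≤ Φ i m')
    (hF : ∀ m', I k m' → F m' ≤ Φ k m') : wp circ (.loop r e c) F m ≤ Φ 0 m := by
  let Ψ : ℕ → Mem → ENNReal := fun i m' => ⨅ _ : I i m', Φ i m'
  calc wp circ (.loop r e c) F m ≤ wp circ (.loop r e c) (Ψ k) m :=
        wp_mono fun m' => le_iInf fun h => hF m' h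
    _ ≤ Ψ 0 m := by
        rw [wp, run, expect_map, he]
        exact expect_iterate_le Ψ fun i hi m' => le_iInf fun h =>
          hΦ i hi m' h _ fun m'' h' => iInf_le _ h'
    _ ≤ Φ 0 m := iInf_le _ h0

end WeakestPrecondition

/-! ### A linear solver: orthogonalization of the rows -/

section RowOperations

/-- The `M × M` corner of a two-dimensional array. -/
def corner (M : ℕ) (W : ℕ → ℕ → ℂ) : Matrix (Fin M) (Fin M) ℂ := Matrix.of fun j k => W j k

/-- The Hermitian inner product of rows `k` and `i` of an array, over the first `M` columns. -/
def rowInner (M : ℕ) (W : ℕ → ℕ → ℂ) (k i : ℕ) : ℂ :=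
  ∑ l ∈ Finset.range M, W k l * (starRingEnd ℂ) (W i l)

/-- The row operation `W_k ← W_k - c W_i` on the first `M` columns. -/
def rowOp (M : ℕ) (W : ℕ → ℕ → ℂ) (k i : ℕ) (c : ℂ) : ℕ → ℕ → ℂ :=
  fun j l => if j = k ∧ l < M then W k l - c * W i l else W j l

/-- The operation `q_k ← q_k - c q_i` on the vector in column `0` of an array. -/
def entryOp (q : ℕ → ℕ → ℂ) (k i : ℕ) (c : ℂ) : ℕ → ℕ → ℂ :=
  fun j l => if j = k ∧ l = 0 then q k 0 - c * q i 0 else q j l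

/-- The array `W` holds an invertible matrix, and `x` solves the system `W x = q`. -/
def IsSystem (M : ℕ) (x : Fin M → ℂ) (W q : ℕ → ℕ → ℂ) : Prop :=
  (corner M W).det ≠ 0 ∧ ∀ j < M, ∑ l : Fin M, W j l * x l = q j 0

/-- The first `k` rows of `W` are pairwise orthogonal. -/
def RowsOrthogonal (M : ℕ) (W : ℕ → ℕ → ℂ) (k : ℕ) : Prop :=
  ∀ a < k, ∀ b < k, a ≠ b → rowInner M W a b = 0

variable {M : ℕ} {x : Fin M → ℂ} {W q : ℕ → ℕ → ℂ} {k i : ℕ}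

theorem conj_rowInner (M : ℕ) (W : ℕ → ℕ → ℂ) (k i : ℕ) :
    (starRingEnd ℂ) (rowInner M W k i) = rowInner M W i k := by
  simp [rowInner, mul_comm]

theorem rowInner_self_ne_zero (h : IsSystem M x W q) (hi : i < M) : rowInner M W i i ≠ 0 := by
  intro h0
  refine h.1 (Matrix.det_eq_zero_of_row_eq_zero ⟨i, hi⟩ fun l => ?_)
  have hsum : ∑ l ∈ Finset.range M, ‖W i l‖ ^ 2 = 0 := by
    have : ((∑ l ∈ Finset.range M, ‖W i l‖ ^ 2 : ℝ) : ℂ) = 0 := by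
      rw [← h0, rowInner]
      push_cast
      exact Finset.sum_congr rfl fun l _ => (Complex.mul_conj' _).symm
    exact_mod_cast this
  rw [Finset.sum_eq_zero_iff_of_nonneg fun _ _ => by positivity] at hsum
  simpa [corner] using hsum l (Finset.mem_range.2 l.2)

theorem corner_rowOp (hk : k < M) (hi : i < M) (c : ℂ) :
    corner M (rowOp M W k i c) = (corner M W).updateRow ⟨k, hk⟩
      (corner M W ⟨k, hk⟩ + (-c) • corner M W ⟨i, hi⟩) := by
  ext j l
  simp only [Matrix.updateRow_apply, corner, Matrix.of_apply, rowOp, Fin.ext_iff, l.2, and_true]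
  split_ifs
  · simp [sub_eq_add_neg]
  · rfl

theorem IsSystem.rowOp (h : IsSystem M x W q) (hk : k < M) (hi : i < M) (hik : i ≠ k) (c : ℂ) :
    IsSystem M x (rowOp M W k i c) (entryOp q k i c) := by
  refine ⟨?_, fun j hj => ?_⟩
  · rw [corner_rowOp hk hi,
      Matrix.det_updateRow_add_smul_self _ (by simpa [Fin.ext_iff] using hik.symm)]
    exact h.1
  · obtain rfl | hjk := eq_or_ne j k
    · simp only [HybridLS.rowOp, entryOp, Fin.is_lt, and_true, if_true, sub_mul,
        Finset.sum_sub_distrib, mul_assoc, ← Finset.mul_sum, h.2 j hj, h.2 i hi]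
    · simp only [HybridLS.rowOp, entryOp, hjk, false_and, if_false, h.2 j hj]

theorem rowInner_rowOp_of_ne {a b : ℕ} (c : ℂ) (ha : a ≠ k) (hb : b ≠ k) :
    rowInner M (rowOp M W k i c) a b = rowInner M W a b := by
  simp [rowInner, rowOp, ha, hb]

theorem rowInner_rowOp_self {b : ℕ} (c : ℂ) (hb : b ≠ k) :
    rowInner M (rowOp M W k i c) k b = rowInner M W k b - c * rowInner M W i b := by
  simp only [rowInner]
  rw [Finset.mul_sum, ← Finset.sum_sub_distrib]
  refine Finset.sum_congr rfl fun l hl => ?_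
  simp only [rowOp, Finset.mem_range.1 hl, and_true, if_true, hb, if_false]
  ring

theorem RowsOrthogonal.rowOp (h : RowsOrthogonal M W k) (c : ℂ) :
    RowsOrthogonal M (rowOp M W k i c) k := fun a ha b hb hab => by
  rw [rowInner_rowOp_of_ne _ ha.ne hb.ne, h a ha b hb hab]

theorem RowsOrthogonal.succ (h : RowsOrthogonal M W k) (hk : ∀ a < k, rowInner M W k a = 0) :
    RowsOrthogonal M W (k + 1) := by
  intro a ha b hb hab
  obtain rfl | hak := eq_or_ne a k
  · exact hk b (by omega)
  · obtain rfl | hbk := eq_or_ne b k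
    · rw [← conj_rowInner, hk a (by omega), map_zero]
    · exact h a (by omega) b (by omega) hab

theorem RowsOrthogonal.rowInner_rowOp_eq_zero (h : RowsOrthogonal M W k) (hik : i < k)
    (hne : rowInner M W i i ≠ 0) (hi : ∀ a < i, rowInner M W k a = 0) :
    ∀ a < i + 1, rowInner M (HybridLS.rowOp M W k i (rowInner M W k i / rowInner M W i i)) k a = 0
    := by
  intro a ha
  rw [rowInner_rowOp_self _ (by omega)]
  obtain rfl | hai := eq_or_ne a i
  · rw [div_mul_cancel₀ _ hne, sub_self]
  · rw [hi a (by omega), h i hik a (by omega) hai.symm, mul_zero, sub_zero]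

theorem IsSystem.eq_sum_of_rowsOrthogonal (h : IsSystem M x W q) (ho : RowsOrthogonal M W M) :
    (fun l : Fin M => ∑ i ∈ Finset.range M,
      q i 0 / rowInner M W i i * (starRingEnd ℂ) (W i l)) = x := by
  have hinj : Function.Injective (corner M W).mulVec :=
    Matrix.mulVec_injective_iff_isUnit.2
      ((Matrix.isUnit_iff_isUnit_det _).2 (isUnit_iff_ne_zero.2 h.1))
  refine hinj (funext fun j => ?_)
  calc (corner M W).mulVec (fun l : Fin M => ∑ i ∈ Finset.range M,
      q i 0 / rowInner M W i i * (starRingEnd ℂ) (W i l)) j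
      = ∑ l : Fin M, W j l * ∑ i ∈ Finset.range M,
        q i 0 / rowInner M W i i * (starRingEnd ℂ) (W i l) := rfl
    _ = ∑ i ∈ Finset.range M, q i 0 / rowInner M W i i * rowInner M W j i := by
      simp only [rowInner, Finset.mul_sum, Finset.sum_range (n := M) (fun l => _ * (W j l * _))]
      rw [Finset.sum_comm]
      exact Finset.sum_congr rfl fun i _ => Finset.sum_congr rfl fun l _ => by ring
    _ = q j 0 := by
      rw [Finset.sum_eq_single (j : ℕ), div_mul_cancel₀ _ (rowInner_self_ne_zero h j.2)]
      · intro i hi hij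
        rw [ho j j.2 i (Finset.mem_range.1 hi) hij.symm, mul_zero]
      · exact fun hj => absurd (Finset.mem_range.2 j.2) hj
    _ = (corner M W).mulVec x j := (h.2 j j.2).symm

end RowOperations

/-- The array that holds the coefficient of the current row operation. -/
abbrev aCoeff : ℕ := 13

/-- The array that holds the square norm of the current row. -/
abbrev aNsq : ℕ := 14

/-- Read entry `(j, k)` of the matrix, where `j` and `k` are registers. -/
def entryW (j k : ℕ) : CExpr := .get aW (.reg j) (.reg k)

/-- Compute the inner product of the rows `rJ`, `rK`, divided by the square norm of the row `rK`. -/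
def computeCoeff : Cmd :=
  .seq (setSc aCoeff (.int 0)) <| .seq (setSc aNsq (.int 0)) <| .seq
    (.loop rT (.reg rM) <| .seq
      (setSc aCoeff (.add (sc aCoeff) (.mul (entryW rJ rT) (.conj (entryW rK rT)))))
      (setSc aNsq (.add (sc aNsq) (.mul (entryW rK rT) (.conj (entryW rK rT))))))
    (setSc aCoeff (.div (sc aCoeff) (sc aNsq)))

/-- Subtract a multiple of the row `rK` from the row `rJ`, in the matrix and in the right-hand
side. -/
def subtractRow : Cmd :=
  .seq
    (.loop rT (.reg rM) <|
      .setArr aW (.reg rJ) (.reg rT) (.sub (entryW rJ rT) (.mul (sc aCoeff) (entryW rK rT))))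
    (.setArr aQ (.reg rJ) (.lit 0) (.sub (.get aQ (.reg rJ) (.lit 0))
      (.mul (sc aCoeff) (.get aQ (.reg rK) (.lit 0)))))

/-- Make the row `rJ` orthogonal to the row `rK`. -/
def reduceRow : Cmd := .seq computeCoeff subtractRow

/-- Make the row `rJ` orthogonal to all previous rows. -/
def orthogonalizeRow : Cmd := .loop rK (.reg rJ) reduceRow

/-- Make all rows orthogonal (Gram–Schmidt, without normalization). -/
def orthogonalize : Cmd := .loop rJ (.reg rM) orthogonalizeRow

/-- Set the output vector to zero. -/
def clearX : Cmd := .loop rJ (.reg rM) <| .setArr aX (.reg rJ) (.lit 0) (.int 0)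

/-- Compute the square norm of the row `rJ`. -/
def computeNsq : Cmd :=
  .seq (setSc aNsq (.int 0)) <|
    .loop rT (.reg rM) <|
      setSc aNsq (.add (sc aNsq) (.mul (entryW rJ rT) (.conj (entryW rJ rT))))

/-- Add to the output vector its component in the direction of the conjugate of the row `rJ`. -/
def addComponent : Cmd :=
  .loop rT (.reg rM) <| .setArr aX (.reg rT) (.lit 0) (.add (.get aX (.reg rT) (.lit 0))
    (.mul (.div (.get aQ (.reg rJ) (.lit 0)) (sc aNsq)) (.conj (entryW rJ rT))))

/-- Solve a system with orthogonal rows. -/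
def solveOrthogonal : Cmd :=
  .seq clearX <| .loop rJ (.reg rM) <| .seq computeNsq addComponent

/-- The linear solver: orthogonalize the rows, then expand the solution in the conjugate rows. -/
def solver : Cmd := .seq orthogonalize solveOrthogonal

section Solver

variable {n : ℕ} {circ : ℕ → ℕ → Part → Circuit (n + 1)} {m : Mem} {M k i : ℕ}

theorem spec_computeCoeff (hM : m.nat rM = M) (hJ : m.nat rJ = k) (hK : m.nat rK = i) :
    Spec circ computeCoeff m (33 * M + 30) fun m' =>
      m'.nat rM = M ∧ m'.nat rJ = k ∧ m'.nat rK = i ∧ m'.arr aW = m.arr aW ∧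
      m'.arr aQ = m.arr aQ ∧
      m'.arr aCoeff 0 0 = rowInner M (m.arr aW) k i / rowInner M (m.arr aW) i i := by
  refine Spec.seqSc (33 * M + 26) (by simp [CExpr.cost]; omega) <|
    Spec.seqSc (33 * M + 22) (by simp [CExpr.cost]; omega) <|
    Spec.seqLoop (k := M) 32 10 (by simpa [NExpr.eval] using hM)
      (fun l m' => m'.nat rM = M ∧ m'.nat rJ = k ∧ m'.nat rK = i ∧ m'.arr aW = m.arr aW ∧
        m'.arr aQ = m.arr aQ ∧ m'.arr aCoeff 0 0 = rowInner l (m.arr aW) k i ∧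
        m'.arr aNsq 0 0 = rowInner l (m.arr aW) i i)
      (by simp [NExpr.cost]; omega) ?_ ?_ ?_
  · simp [Mem.setArr_arr, hM, hJ, hK, CExpr.eval, rowInner]
    constructor <;> rfl
  · rintro l - m' ⟨hM, hJ, hK, hW, hQ, hcoeff, hnsq⟩
    refine Spec.seqSc 16 (by simp [CExpr.cost, sc, entryW, NExpr.cost]) <| Spec.mono (Spec.setSc ?_)
      (by simp [CExpr.cost, sc, entryW, NExpr.cost]) fun _ h => h
    simp [Mem.setArr_arr, Mem.setNat_nat, CExpr.eval, rowInner, sc, entryW, NExpr.eval, hM, hJ, hK,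
      hW, hQ, hcoeff, hnsq, Finset.sum_range_succ, Mem.setArr_arr_of_ne]
  · rintro m' ⟨hM, hJ, hK, hW, hQ, hcoeff, hnsq⟩
    refine Spec.mono (Spec.setSc ?_) (by simp [CExpr.cost, sc, NExpr.cost]) fun _ h => h
    simp [CExpr.eval, sc, NExpr.eval, hM, hJ, hK, hW, hQ, hcoeff, hnsq, Mem.setArr_arr_of_ne]

theorem setArr_rowOp {m' : Mem} {W : ℕ → ℕ → ℂ} {c : ℂ} {l : ℕ} (hik : i ≠ k)
    (hW : m'.arr aW = rowOp l W k i c) :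
    (m'.setArr aW k l (m'.arr aW k l - c * m'.arr aW i l)).arr aW = rowOp (l + 1) W k i c := by
  funext j l'
  simp only [Mem.setArr_arr, hW, rowOp]
  by_cases hj : j = k <;> by_cases hl' : l' = l
  · simp [hj, hl', hik]
  · have : l' ≤ l ↔ l' < l := by omega
    simp [hj, hl', this]
  · simp [hj]
  · simp [hj]

theorem spec_subtractRow {c : ℂ} (hM : m.nat rM = M) (hJ : m.nat rJ = k) (hK : m.nat rK = i)
    (hc : m.arr aCoeff 0 0 = c) (hik : i ≠ k) :
    Spec circ subtractRow m (17 * M + 20) fun m' =>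
      m'.nat rM = M ∧ m'.nat rJ = k ∧ m'.arr aW = rowOp M (m.arr aW) k i c ∧
      m'.arr aQ = entryOp (m.arr aQ) k i c := by
  refine Spec.seqLoop (k := M) 16 16 (by simpa [NExpr.eval] using hM)
      (fun l m' => m'.nat rM = M ∧ m'.nat rJ = k ∧ m'.nat rK = i ∧
        m'.arr aW = rowOp l (m.arr aW) k i c ∧ m'.arr aQ = m.arr aQ ∧ m'.arr aCoeff 0 0 = c)
      (by simp [NExpr.cost]; omega) ⟨hM, hJ, hK, by funext j l; simp [rowOp], rfl, hc⟩ ?_ ?_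
  · rintro l - m' ⟨hM, hJ, hK, hW, hQ, hc⟩
    refine Spec.mono (Spec.setArr ?_) (by simp [CExpr.cost, sc, entryW, NExpr.cost]) fun _ h => h
    refine ⟨by simp [Mem.setNat_nat, hM], by simp [Mem.setNat_nat, hJ],
      by simp [Mem.setNat_nat, hK], ?_, by simp [Mem.setArr_arr_of_ne, hQ],
      by simp [Mem.setArr_arr_of_ne, hc]⟩
    rw [← setArr_rowOp hik hW]
    simp [CExpr.eval, sc, entryW, NExpr.eval, Mem.setNat_nat, hJ, hK, hc, Mem.setArr]
  · rintro m' ⟨hM, hJ, hK, hW, hQ, hc⟩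
    refine Spec.mono (Spec.setArr ?_) (by simp [CExpr.cost, sc, NExpr.cost]) fun _ h => h
    refine ⟨by simp [hM], by simp [hJ], by simp [Mem.setArr_arr_of_ne, hW], ?_⟩
    funext j l
    simp only [Mem.setArr_arr, CExpr.eval, sc, NExpr.eval, hJ, hK, hQ, hc, entryOp, true_and]

theorem spec_reduceRow (hM : m.nat rM = M) (hJ : m.nat rJ = k) (hK : m.nat rK = i) (hik : i ≠ k) :
    Spec circ reduceRow m (50 * M + 50) fun m' =>
      m'.nat rM = M ∧ m'.nat rJ = k ∧
      m'.arr aW = rowOp M (m.arr aW) k i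
        (rowInner M (m.arr aW) k i / rowInner M (m.arr aW) i i) ∧
      m'.arr aQ = entryOp (m.arr aQ) k i
        (rowInner M (m.arr aW) k i / rowInner M (m.arr aW) i i) := by
  refine ((spec_computeCoeff hM hJ hK).seq (t' := 17 * M + 20)
    fun m₁ ⟨hM, hJ, hK, hW, hQ, hc⟩ => ?_).mono (by omega) fun _ h => h
  rw [← hW, ← hQ]
  rw [← hW] at hc
  exact spec_subtractRow hM hJ hK hc hik

theorem spec_orthogonalizeRow {x : Fin M → ℂ} (hM : m.nat rM = M) (hJ : m.nat rJ = k)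
    (hk : k < M) :
    Spec circ orthogonalizeRow m (k * (50 * M + 51) + 2) fun m' =>
      m'.nat rM = M ∧ (IsSystem M x (m.arr aW) (m.arr aQ) ∧ RowsOrthogonal M (m.arr aW) k →
        IsSystem M x (m'.arr aW) (m'.arr aQ) ∧ RowsOrthogonal M (m'.arr aW) (k + 1)) := by
  refine (Spec.loop (k := k) (e := .reg rJ) (m := m) (t := 50 * M + 50) hJ
    (fun i m' => m'.nat rM = M ∧ m'.nat rJ = k ∧
      (IsSystem M x (m.arr aW) (m.arr aQ) ∧ RowsOrthogonal M (m.arr aW) k →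
        IsSystem M x (m'.arr aW) (m'.arr aQ) ∧ RowsOrthogonal M (m'.arr aW) k ∧
        ∀ a < i, rowInner M (m'.arr aW) k a = 0))
    ⟨hM, hJ, fun h => ⟨h.1, h.2, by simp⟩⟩ ?_).mono (by simp [NExpr.cost]) ?_
  · rintro i hi m' ⟨hM, hJ, himp⟩
    refine (spec_reduceRow (by simpa [Mem.setNat_nat] using hM)
      (by simpa [Mem.setNat_nat] using hJ) (Mem.setNat_nat_self _ _ _) hi.ne).mono le_rfl ?_
    rintro m'' ⟨hM, hJ, hW, hQ⟩
    refine ⟨hM, hJ, fun h => ?_⟩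
    obtain ⟨hsys, hrows, horth⟩ := himp h
    have hne := rowInner_self_ne_zero hsys (hi.trans hk)
    rw [hW, hQ]
    exact ⟨hsys.rowOp hk (hi.trans hk) hi.ne _, hrows.rowOp _,
      hrows.rowInner_rowOp_eq_zero hi hne horth⟩
  · rintro m' ⟨hM, -, himp⟩
    exact ⟨hM, fun h => ⟨(himp h).1, (himp h).2.1.succ (himp h).2.2⟩⟩

theorem spec_orthogonalize (hM : m.nat rM = M) (x : Fin M → ℂ) :
    Spec circ orthogonalize m (M * (M * (50 * M + 51) + 3) + 2) fun m' =>
      m'.nat rM = M ∧ (IsSystem M x (m.arr aW) (m.arr aQ) →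
        IsSystem M x (m'.arr aW) (m'.arr aQ) ∧ RowsOrthogonal M (m'.arr aW) M) := by
  refine (Spec.loop (k := M) (t := M * (50 * M + 51) + 2) (by simpa [NExpr.eval] using hM)
    (fun k m' => m'.nat rM = M ∧ (IsSystem M x (m.arr aW) (m.arr aQ) →
        IsSystem M x (m'.arr aW) (m'.arr aQ) ∧ RowsOrthogonal M (m'.arr aW) k))
    ⟨hM, fun h => ⟨h, fun a ha => by omega⟩⟩ ?_).mono (by simp [NExpr.cost]) fun _ h => h
  rintro k hk m' ⟨hM, himp⟩
  exact (spec_orthogonalizeRow (by simpa [Mem.setNat_nat] using hM) (Mem.setNat_nat_self _ _ _)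
    hk).mono (by gcongr) fun m'' h => ⟨h.1, fun hsys => h.2 (himp hsys)⟩

theorem spec_clearX (hM : m.nat rM = M) :
    Spec circ clearX m (5 * M + 2) fun m' =>
      m'.nat rM = M ∧ m'.arr aW = m.arr aW ∧ m'.arr aQ = m.arr aQ ∧ ∀ l < M, m'.arr aX l 0 = 0 := by
  refine (Spec.loop (k := M) (t := 4) (by simpa [NExpr.eval] using hM)
    (fun j m' => m'.nat rM = M ∧ m'.arr aW = m.arr aW ∧ m'.arr aQ = m.arr aQ ∧
      ∀ l < j, m'.arr aX l 0 = 0) ⟨hM, rfl, rfl, by simp⟩ ?_).mono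
    (by simp [NExpr.cost]; omega) fun _ h => h
  rintro j - m' ⟨hM, hW, hQ, hX⟩
  refine Spec.mono (Spec.setArr ?_) (by simp [CExpr.cost, NExpr.cost]) fun _ h => h
  refine ⟨by simp [Mem.setNat_nat, hM], by simp [Mem.setArr_arr_of_ne, hW],
    by simp [Mem.setArr_arr_of_ne, hQ], fun l hl => ?_⟩
  simp only [Mem.setArr_arr, NExpr.eval, CExpr.eval, Mem.setNat_nat_self, Mem.setNat_arr]
  split_ifs with h
  · simp
  · exact hX l (by simp at h; omega)

theorem spec_computeNsq (hM : m.nat rM = M) (hJ : m.nat rJ = k) :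
    Spec circ computeNsq m (17 * M + 6) fun m' =>
      m'.nat rM = M ∧ m'.nat rJ = k ∧ m'.arr aW = m.arr aW ∧ m'.arr aQ = m.arr aQ ∧
      m'.arr aX = m.arr aX ∧ m'.arr aNsq 0 0 = rowInner M (m.arr aW) k k := by
  refine Spec.seqSc (17 * M + 2) (by simp [CExpr.cost]; omega) <|
    (Spec.loop (k := M) (t := 16) (by simpa [NExpr.eval] using hM)
      (fun l m' => m'.nat rM = M ∧ m'.nat rJ = k ∧ m'.arr aW = m.arr aW ∧
        m'.arr aQ = m.arr aQ ∧ m'.arr aX = m.arr aX ∧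
        m'.arr aNsq 0 0 = rowInner l (m.arr aW) k k) ?_ ?_).mono
      (by simp [NExpr.cost]; omega) fun _ h => h
  · simp [hM, hJ, Mem.setArr_arr_of_ne, rowInner, CExpr.eval]
  · rintro l - m' ⟨hM, hJ, hW, hQ, hX, hnsq⟩
    refine Spec.mono (Spec.setSc ?_) (by simp [CExpr.cost, sc, entryW, NExpr.cost]) fun _ h => h
    simp [Mem.setNat_nat, hM, hJ, hW, hQ, hX, hnsq, Mem.setArr_arr_of_ne, rowInner, CExpr.eval,
      NExpr.eval, sc, entryW, Finset.sum_range_succ]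

theorem spec_addComponent (hM : m.nat rM = M) (hJ : m.nat rJ = k) :
    Spec circ addComponent m (21 * M + 2) fun m' =>
      m'.nat rM = M ∧ m'.arr aW = m.arr aW ∧ m'.arr aQ = m.arr aQ ∧
      ∀ l < M, m'.arr aX l 0 =
        m.arr aX l 0 + m.arr aQ k 0 / m.arr aNsq 0 0 * (starRingEnd ℂ) (m.arr aW k l) := by
  refine (Spec.loop (k := M) (t := 20) (by simpa [NExpr.eval] using hM)
    (fun l m' => m'.nat rM = M ∧ m'.nat rJ = k ∧ m'.arr aW = m.arr aW ∧ m'.arr aQ = m.arr aQ ∧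
      m'.arr aNsq = m.arr aNsq ∧ ∀ l', m'.arr aX l' 0 = m.arr aX l' 0 +
        if l' < l then m.arr aQ k 0 / m.arr aNsq 0 0 * (starRingEnd ℂ) (m.arr aW k l') else 0)
    ⟨hM, hJ, rfl, rfl, rfl, by simp⟩ ?_).mono (by simp [NExpr.cost]; omega) ?_
  · rintro l - m' ⟨hM, hJ, hW, hQ, hnsq, hX⟩
    refine Spec.mono (Spec.setArr ?_) (by simp [CExpr.cost, sc, entryW, NExpr.cost]) fun _ h => h
    refine ⟨by simp [Mem.setNat_nat, hM], by simp [Mem.setNat_nat, hJ],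
      by simp [Mem.setArr_arr_of_ne, hW], by simp [Mem.setArr_arr_of_ne, hQ],
      by simp [Mem.setArr_arr_of_ne, hnsq], fun l' => ?_⟩
    simp only [Mem.setArr_arr, NExpr.eval, CExpr.eval, Mem.setNat_nat, Mem.setNat_arr, sc, entryW]
    simp only [hJ, hW, hQ, hnsq, hX]
    obtain rfl | hl := eq_or_ne l' l
    · simp
    · have : l' < l + 1 ↔ l' < l := by omega
      simp [hl, this]
  · rintro m' ⟨hM, -, hW, hQ, -, hX⟩
    exact ⟨hM, hW, hQ, fun l hl => by rw [hX, if_pos hl]⟩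

theorem spec_solveOrthogonal (hM : m.nat rM = M) :
    Spec circ solveOrthogonal m (M * (38 * M + 40) + 10) fun m' =>
      ∀ l < M, m'.arr aX l 0 = ∑ i ∈ Finset.range M,
        m.arr aQ i 0 / rowInner M (m.arr aW) i i * (starRingEnd ℂ) (m.arr aW i l) := by
  refine ((spec_clearX hM).seq (t' := M * (38 * M + 9) + 2)
    fun m₀ ⟨hM, hW, hQ, hX⟩ => ?_).mono (by nlinarith) fun _ h => h
  refine (Spec.loop (k := M) (t := 38 * M + 8) (by simpa [NExpr.eval] using hM)
    (fun j m' => m'.nat rM = M ∧ m'.arr aW = m.arr aW ∧ m'.arr aQ = m.arr aQ ∧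
      ∀ l < M, m'.arr aX l 0 = ∑ i ∈ Finset.range j,
        m.arr aQ i 0 / rowInner M (m.arr aW) i i * (starRingEnd ℂ) (m.arr aW i l))
    ⟨hM, hW, hQ, by simpa using hX⟩ ?_).mono (by simp [NExpr.cost]) fun _ h => h.2.2.2
  rintro j - m₁ ⟨hM, hW, hQ, hX⟩
  refine ((spec_computeNsq (M := M) (k := j) (by simpa [Mem.setNat_nat] using hM)
    (Mem.setNat_nat_self _ _ _)).seq
    fun m₂ ⟨hM₂, hJ₂, hW₂, hQ₂, hX₂, hnsq₂⟩ => (spec_addComponent hM₂ hJ₂).mono le_rfl ?_).mono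
    (by omega) fun _ h => h
  rintro m₃ ⟨hM₃, hW₃, hQ₃, hX₃⟩
  refine ⟨hM₃, by simp [hW₃, hW₂, hW], by simp [hQ₃, hQ₂, hQ], fun l hl => ?_⟩
  simp [hX₃ l hl, hX₂, hX l hl, hQ₂, hQ, hnsq₂, hW₂, hW, Finset.sum_range_succ]

end Solver

theorem solver_classical : solver.Classical := by
  simp [solver, orthogonalize, orthogonalizeRow, reduceRow, subtractRow, solveOrthogonal, clearX,
    computeNsq, addComponent, computeCoeff, setSc, Cmd.Classical]

theorem spec_solver {n : ℕ} {circ : ℕ → ℕ → Part → Circuit (n + 1)} {m : Mem} {M : ℕ}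
    (hM : m.nat rM = M) (x : Fin M → ℂ) :
    Spec circ solver m (M * (M * (50 * M + 51) + 3) + 2 + (M * (38 * M + 40) + 10)) fun m' =>
      IsSystem M x (m.arr aW) (m.arr aQ) → m'.vecX M = x :=
  (spec_orthogonalize hM x).seq fun _ ⟨hM₁, himp⟩ =>
    (spec_solveOrthogonal hM₁).mono le_rfl fun m₂ hX hsys => by
      rw [← (himp hsys).1.eq_sum_of_rowsOrthogonal (himp hsys).2]
      exact funext fun l => hX l l.2

theorem isSystem_inv_mulVec {m : Mem} {M : ℕ} (h : IsUnit (m.matW M).det) :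
    IsSystem M ((m.matW M)⁻¹.mulVec (m.vecQ M)) (m.arr aW) (m.arr aQ) := by
  refine ⟨h.ne_zero, fun j hj => ?_⟩
  have hmul : (m.matW M).mulVec ((m.matW M)⁻¹.mulVec (m.vecQ M)) = m.vecQ M := by
    rw [Matrix.mulVec_mulVec, Matrix.mul_nonsing_inv _ h, Matrix.one_mulVec]
  exact congrFun hmul ⟨j, hj⟩

theorem isLinearSolver_solver : IsLinearSolver solver 300 := by
  refine ⟨solver_classical, fun n circ m M hM r hr => ?_⟩
  have h := spec_solver hM ((m.matW M)⁻¹.mulVec (m.vecQ M)) r hr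
  refine ⟨?_, fun hu => h.2 (isSystem_inv_mulVec hu)⟩
  have hsteps : (r.2 : ℝ) ≤ M * (M * (50 * M + 51) + 3) + 2 + (M * (38 * M + 40) + 10) := by
    exact_mod_cast h.1
  have h1 : (M : ℝ) ≤ M ^ 3 := by exact_mod_cast Nat.le_self_pow (by norm_num) M
  have h2 : (M : ℝ) ^ 2 ≤ M ^ 3 := by
    obtain rfl | hpos := M.eq_zero_or_pos
    · simp
    · exact_mod_cast Nat.pow_le_pow_right hpos (by norm_num)
  nlinarith

/-! ### The pseudo-inverse and the normal equations -/

section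

open scoped Matrix

section

variable {l m n : Type*} [Fintype m] [Fintype n] [DecidableEq n]

theorem toEuclideanLin_mul_apply [DecidableEq m] (A : Matrix l m ℂ) (B : Matrix m n ℂ)
    (x : EuclideanSpace ℂ n) :
    Matrix.toEuclideanLin (A * B) x = Matrix.toEuclideanLin A (Matrix.toEuclideanLin B x) := by
  simp [Matrix.toLpLin_apply, Matrix.mulVec_mulVec]

theorem toEuclideanLin_one_apply (x : EuclideanSpace ℂ n) :
    Matrix.toEuclideanLin (1 : Matrix n n ℂ) x = x := by
  simp [Matrix.toLpLin_one]

theorem inner_toEuclideanLin [DecidableEq m] (A : Matrix m n ℂ) (x : EuclideanSpace ℂ n)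
    (y : EuclideanSpace ℂ m) : inner ℂ (Matrix.toEuclideanLin A x) y =
      inner ℂ x (Matrix.toEuclideanLin Aᴴ y) := by
  rw [Matrix.toEuclideanLin_conjTranspose_eq_adjoint, LinearMap.adjoint_inner_right]

theorem norm_toEuclideanLin_le (A : Matrix m n ℂ) (x : EuclideanSpace ℂ n) :
    ‖Matrix.toEuclideanLin A x‖ ≤ ‖A‖ * ‖x‖ := Matrix.l2_opNorm_mulVec A x

theorem isUnit_det_of_injective {W : Matrix n n ℂ}
    (h : Function.Injective (Matrix.toEuclideanLin W)) : IsUnit W.det := by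
  rw [isUnit_iff_ne_zero]
  intro h0
  obtain ⟨v, hv, hv0⟩ := Matrix.exists_mulVec_eq_zero_iff.2 h0
  have h1 : WithLp.toLp 2 v = 0 := h (by
    rw [map_zero, Matrix.toLpLin_toLp, Matrix.toLin'_apply, hv0]; rfl)
  exact hv (congrArg WithLp.ofLp h1)

/-- The pseudo-inverse of a Hermitian matrix: the non-zero eigenvalues are inverted in a spectral
decomposition (recall `0⁻¹ = 0`). -/
def hermitianPinv {H : Matrix n n ℂ} (hH : H.IsHermitian) : Matrix n n ℂ :=
  Unitary.conjStarAlgAut ℂ _ hH.eigenvectorUnitary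
    (Matrix.diagonal fun i => ((hH.eigenvalues i)⁻¹ : ℂ))

variable {H : Matrix n n ℂ} (hH : H.IsHermitian)

theorem isHermitian_hermitianPinv : (hermitianPinv hH).IsHermitian := by
  rw [Matrix.IsHermitian, ← Matrix.star_eq_conjTranspose, hermitianPinv, ← map_star,
    Matrix.star_eq_conjTranspose, Matrix.diagonal_conjTranspose]
  congr 2
  ext i
  simp

theorem exists_starAlgEquiv_diagonal :
    ∃ (φ : Matrix n n ℂ ≃⋆ₐ[ℂ] Matrix n n ℂ) (v : n → ℂ),
      H = φ (Matrix.diagonal v) ∧ hermitianPinv hH = φ (Matrix.diagonal v⁻¹) :=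
  ⟨Unitary.conjStarAlgAut ℂ _ hH.eigenvectorUnitary, fun i => (hH.eigenvalues i : ℂ),
    hH.spectral_theorem, rfl⟩

theorem mul_hermitianPinv_mul : H * hermitianPinv hH * H = H := by
  obtain ⟨φ, v, hφ, hφ'⟩ := exists_starAlgEquiv_diagonal hH
  rw [hφ', hφ, ← map_mul, ← map_mul, Matrix.diagonal_mul_diagonal, Matrix.diagonal_mul_diagonal]
  simp only [Pi.inv_apply, mul_inv_mul_cancel]

theorem hermitianPinv_mul_mul_hermitianPinv :
    hermitianPinv hH * H * hermitianPinv hH = hermitianPinv hH := by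
  obtain ⟨φ, v, hφ, hφ'⟩ := exists_starAlgEquiv_diagonal hH
  rw [hφ', hφ, ← map_mul, ← map_mul, Matrix.diagonal_mul_diagonal, Matrix.diagonal_mul_diagonal]
  congr 2
  ext i
  simpa using mul_inv_mul_cancel (v i)⁻¹

theorem commute_hermitianPinv : Commute H (hermitianPinv hH) := by
  obtain ⟨φ, v, hφ, hφ'⟩ := exists_starAlgEquiv_diagonal hH
  rw [hφ', hφ]
  exact (Matrix.commute_diagonal _ _).map φ

end

variable {N M : ℕ} (A : Matrix (Fin N) (Fin M) ℂ)

/-- The pseudo-inverse of the Gram matrix `Aᴴ A`. -/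
def gramPinv : Matrix (Fin M) (Fin M) ℂ :=
  hermitianPinv (Matrix.isHermitian_conjTranspose_mul_self A)

theorem pinv_eq_gramPinv_mul : pinv A = gramPinv A * Aᴴ := rfl

theorem mul_pinv_mul : A * pinv A * A = A := by
  open scoped ComplexOrder in
  have h : Aᴴ * A * (gramPinv A * (Aᴴ * A) - 1) = 0 := by
    rw [mul_sub, mul_one, ← Matrix.mul_assoc, gramPinv, mul_hermitianPinv_mul, sub_self]
  have h0 : A * (gramPinv A * (Aᴴ * A) - 1) = 0 := by
    rw [← Matrix.conjTranspose_mul_self_eq_zero, Matrix.conjTranspose_mul, Matrix.mul_assoc,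
      ← Matrix.mul_assoc Aᴴ, h, Matrix.mul_zero]
  rw [Matrix.mul_sub, Matrix.mul_one, sub_eq_zero] at h0
  rwa [pinv_eq_gramPinv_mul, Matrix.mul_assoc, Matrix.mul_assoc]

theorem gramPinv_eq_pinv_mul_conjTranspose : gramPinv A = pinv A * (pinv A)ᴴ := by
  rw [pinv_eq_gramPinv_mul, Matrix.conjTranspose_mul, Matrix.conjTranspose_conjTranspose,
    gramPinv, (isHermitian_hermitianPinv _).eq]
  conv_lhs => rw [← hermitianPinv_mul_mul_hermitianPinv]
  simp only [Matrix.mul_assoc]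

theorem norm_gramPinv_le : ‖gramPinv A‖ ≤ ‖pinv A‖ ^ 2 := by
  rw [gramPinv_eq_pinv_mul_conjTranspose, pow_two]
  refine (Matrix.l2_opNorm_mul _ _).trans_eq ?_
  rw [Matrix.l2_opNorm_conjTranspose]

theorem gram_mul_pinv : Aᴴ * A * pinv A = Aᴴ := by
  have h : (A * pinv A).IsHermitian := by
    rw [pinv_eq_gramPinv_mul, ← Matrix.mul_assoc]
    exact Matrix.isHermitian_mul_mul_conjTranspose A (isHermitian_hermitianPinv _)
  rw [Matrix.mul_assoc, ← h.eq, ← Matrix.conjTranspose_mul, mul_pinv_mul]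

theorem gram_mul_gramPinv_mul_pinv : Aᴴ * A * (gramPinv A * pinv A) = pinv A := by
  rw [← Matrix.mul_assoc, gramPinv, (commute_hermitianPinv _).eq, Matrix.mul_assoc, gram_mul_pinv,
    ← gramPinv, pinv_eq_gramPinv_mul]

variable {A}

theorem one_le_condNumber (hA : A ≠ 0) : 1 ≤ condNumber A := by
  have h : ‖A‖ ≤ ‖A‖ * ‖pinv A‖ * ‖A‖ := by
    conv_lhs => rw [← mul_pinv_mul A]
    exact (Matrix.l2_opNorm_mul _ _).trans
      (mul_le_mul_of_nonneg_right (Matrix.l2_opNorm_mul _ _) (norm_nonneg _))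
  exact le_of_mul_le_mul_right (by rwa [one_mul]) (norm_pos_iff.2 hA)

theorem norm_pinv_pos (hA : A ≠ 0) : 0 < ‖pinv A‖ :=
  pos_of_mul_pos_right (zero_lt_one.trans_le (one_le_condNumber hA)) (norm_nonneg _)

variable (A) (b : EuclideanSpace ℂ (Fin N))

theorem normal_equations :
    Matrix.toEuclideanLin (Aᴴ * A) (optSol A b) = Matrix.toEuclideanLin Aᴴ b := by
  rw [optSol, ← toEuclideanLin_mul_apply, gram_mul_pinv]

/-- The source condition `x* ∈ range (Aᴴ A)` is what makes the bias of the regularization linear in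
the regularization parameter. -/
theorem gram_apply_gramPinv_optSol :
    Matrix.toEuclideanLin (Aᴴ * A) (Matrix.toEuclideanLin (gramPinv A) (optSol A b))
      = optSol A b := by
  rw [optSol, ← toEuclideanLin_mul_apply, ← toEuclideanLin_mul_apply, Matrix.mul_assoc,
    gram_mul_gramPinv_mul_pinv]

theorem iInf_norm_sub : ⨅ y : EuclideanSpace ℂ (Fin M), ‖Matrix.toEuclideanLin A y - b‖
    = ‖Matrix.toEuclideanLin A (optSol A b) - b‖ := by
  refine le_antisymm (ciInf_le ⟨0, by rintro _ ⟨y, rfl⟩; positivity⟩ _) (le_ciInf fun y => ?_)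
  have h_orth : inner ℂ (Matrix.toEuclideanLin A (y - optSol A b))
      (Matrix.toEuclideanLin A (optSol A b) - b) = 0 := by
    rw [inner_toEuclideanLin, map_sub, ← toEuclideanLin_mul_apply, normal_equations, sub_self,
      inner_zero_right]
  have h_pyth := norm_add_sq (𝕜 := ℂ) (Matrix.toEuclideanLin A (y - optSol A b))
    (Matrix.toEuclideanLin A (optSol A b) - b)
  rw [h_orth, map_zero, mul_zero, add_zero, map_sub, sub_add_sub_cancel] at h_pyth
  refine le_of_sq_le_sq ?_ (norm_nonneg _)
  rw [h_pyth]
  exact le_add_of_nonneg_left (sq_nonneg _)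

variable {A b}

theorem isApproxSolution_of_norm_le {ε : ℝ} {x : EuclideanSpace ℂ (Fin M)}
    (h : ‖Matrix.toEuclideanLin A (x - optSol A b)‖ ≤ ε) : IsApproxSolution A b ε x := by
  rw [IsApproxSolution, iInf_norm_sub]
  refine (norm_sub_norm_le _ _).trans ?_
  rwa [sub_sub_sub_cancel_right, ← map_sub]

end

/-! ### The regularized normal equations -/

section

open scoped Matrix

section

variable {m n : Type*} [Fintype m] [Fintype n] [DecidableEq n]

/-- The Gram matrix of the columns of `A`, regularized by a multiple of the identity. -/
def regularizedGram (A : Matrix m n ℂ) (μ : ℝ) : Matrix n n ℂ := Aᴴ * A + (μ : ℂ) • 1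

variable (A : Matrix m n ℂ) (μ : ℝ) {E : Matrix n n ℂ} {f g x y z w : EuclideanSpace ℂ n}

theorem regularizedGram_apply (z : EuclideanSpace ℂ n) :
    Matrix.toEuclideanLin (regularizedGram A μ) z
      = Matrix.toEuclideanLin (Aᴴ * A) z + (μ : ℂ) • z := by
  rw [regularizedGram, map_add, map_smul, LinearMap.add_apply, LinearMap.smul_apply,
    toEuclideanLin_one_apply]

theorem re_inner_regularizedGram (z : EuclideanSpace ℂ n) :
    RCLike.re (inner ℂ z (Matrix.toEuclideanLin (regularizedGram A μ) z))
      = ‖Matrix.toEuclideanLin A z‖ ^ 2 + μ * ‖z‖ ^ 2 := by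
  classical
  rw [regularizedGram_apply, inner_add_right, toEuclideanLin_mul_apply,
    ← inner_toEuclideanLin, inner_smul_right, map_add, inner_self_eq_norm_sq,
    inner_self_eq_norm_sq_to_K]
  simp [← Complex.ofReal_pow]

theorem mul_norm_le_norm_regularizedGram (z : EuclideanSpace ℂ n) :
    μ * ‖z‖ ≤ ‖Matrix.toEuclideanLin (regularizedGram A μ) z‖ := by
  obtain h | h := (norm_nonneg z).eq_or_lt
  · rw [← h, mul_zero]; exact norm_nonneg _
  refine le_of_mul_le_mul_left ?_ h
  calc ‖z‖ * (μ * ‖z‖) ≤ ‖Matrix.toEuclideanLin A z‖ ^ 2 + μ * ‖z‖ ^ 2 := by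
        nlinarith [sq_nonneg ‖Matrix.toEuclideanLin A z‖]
    _ ≤ _ := by
        rw [← re_inner_regularizedGram]
        exact re_inner_le_norm _ _

variable {A μ}

theorem isUnit_det_regularizedGram_add (hE : ‖E‖ < μ) : IsUnit (regularizedGram A μ + E).det := by
  refine isUnit_det_of_injective ((injective_iff_map_eq_zero _).2 fun z hz => ?_)
  rw [map_add, LinearMap.add_apply, add_eq_zero_iff_eq_neg] at hz
  have h1 := mul_norm_le_norm_regularizedGram A μ z
  rw [hz, norm_neg] at h1
  by_contra h0
  exact hE.not_ge (le_of_mul_le_mul_right (h1.trans (norm_toEuclideanLin_le E z))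
    (norm_pos_iff.2 h0))

theorem exists_regularizedGram_apply_eq (hμ : 0 < μ) (g : EuclideanSpace ℂ n) :
    ∃ y, Matrix.toEuclideanLin (regularizedGram A μ) y = g := by
  refine LinearMap.surjective_of_injective ((injective_iff_map_eq_zero _).2 fun z hz => ?_) g
  have h1 := mul_norm_le_norm_regularizedGram A μ z
  rw [hz, norm_zero] at h1
  exact norm_le_zero_iff.1 (by nlinarith)

theorem norm_apply_le_of_regularizedGram_apply_eq (hμ : 0 ≤ μ)
    (h : Matrix.toEuclideanLin (regularizedGram A μ) z
      = (μ : ℂ) • Matrix.toEuclideanLin (Aᴴ * A) w) :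
    ‖Matrix.toEuclideanLin A z‖ ≤ μ * ‖Matrix.toEuclideanLin A w‖ := by
  classical
  have h_energy := re_inner_regularizedGram A μ z
  rw [h, toEuclideanLin_mul_apply, inner_smul_right, ← inner_toEuclideanLin] at h_energy
  have h_cauchy : RCLike.re ((μ : ℂ) * inner ℂ (Matrix.toEuclideanLin A z)
      (Matrix.toEuclideanLin A w)) ≤ μ * (‖Matrix.toEuclideanLin A z‖ *
        ‖Matrix.toEuclideanLin A w‖) := by
    refine (RCLike.re_le_norm _).trans ?_
    rw [norm_mul, Complex.norm_real, Real.norm_of_nonneg hμ]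
    exact mul_le_mul_of_nonneg_left (norm_inner_le_norm _ _) hμ
  obtain h0 | h0 := (norm_nonneg (Matrix.toEuclideanLin A z)).eq_or_lt
  · rw [← h0]; positivity
  · have : 0 ≤ μ * ‖z‖ ^ 2 := by positivity
    refine le_of_mul_le_mul_left ?_ h0
    nlinarith

theorem norm_sub_le_of_perturbed {θ : ℝ} (hμ : 0 < μ) (hθ : θ ≤ 1 / 2) (hE : ‖E‖ ≤ θ * μ)
    (hf : ‖f‖ ≤ θ * μ) (hy : Matrix.toEuclideanLin (regularizedGram A μ) y = g)
    (hx : Matrix.toEuclideanLin (regularizedGram A μ + E) x = g + f) :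
    ‖x - y‖ ≤ 2 * θ * (1 + ‖y‖) := by
  have h_diff : Matrix.toEuclideanLin (regularizedGram A μ) (x - y)
      = f - Matrix.toEuclideanLin E x := by
    rw [map_add, LinearMap.add_apply] at hx
    rw [map_sub, hy, eq_sub_of_add_eq hx]
    abel
  have h_x : ‖x - y‖ ≤ θ * (1 + ‖x‖) := by
    refine le_of_mul_le_mul_left ?_ hμ
    calc μ * ‖x - y‖ ≤ ‖f - Matrix.toEuclideanLin E x‖ := by
          rw [← h_diff]
          exact mul_norm_le_norm_regularizedGram A μ _
      _ ≤ θ * μ + θ * μ * ‖x‖ := (norm_sub_le _ _).trans (add_le_add hf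
          ((norm_toEuclideanLin_le E x).trans (mul_le_mul_of_nonneg_right hE (norm_nonneg _))))
      _ = μ * (θ * (1 + ‖x‖)) := by ring
  have h_norm : ‖x‖ ≤ ‖y‖ + ‖x - y‖ := norm_le_norm_add_norm_sub' x y
  have hθ0 : 0 ≤ θ := nonneg_of_mul_nonneg_left ((norm_nonneg E).trans hE) hμ
  nlinarith [norm_nonneg (x - y)]

end

variable {N M : ℕ} {A : Matrix (Fin N) (Fin M) ℂ} {b : EuclideanSpace ℂ (Fin N)}
  {E : Matrix (Fin M) (Fin M) ℂ} {f x y : EuclideanSpace ℂ (Fin M)} {β ε μ : ℝ}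

theorem regularizedGram_apply_optSol_sub
    (hy : Matrix.toEuclideanLin (regularizedGram A μ) y = Matrix.toEuclideanLin Aᴴ b) :
    Matrix.toEuclideanLin (regularizedGram A μ) (optSol A b - y) = (μ : ℂ) • optSol A b := by
  rw [map_sub, hy, regularizedGram_apply, normal_equations, add_sub_cancel_left]

theorem norm_regularized_sub_optSol_le (hμ : 0 < μ)
    (hy : Matrix.toEuclideanLin (regularizedGram A μ) y = Matrix.toEuclideanLin Aᴴ b) :
    ‖y - optSol A b‖ ≤ ‖optSol A b‖ := by
  have h := mul_norm_le_norm_regularizedGram A μ (optSol A b - y)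
  rw [regularizedGram_apply_optSol_sub hy, norm_smul, Complex.norm_real,
    Real.norm_of_nonneg hμ.le, norm_sub_rev] at h
  exact le_of_mul_le_mul_left h hμ

theorem norm_apply_regularized_sub_optSol_le (hμ : 0 ≤ μ)
    (hy : Matrix.toEuclideanLin (regularizedGram A μ) y = Matrix.toEuclideanLin Aᴴ b) :
    ‖Matrix.toEuclideanLin A (y - optSol A b)‖ ≤ μ * (‖A‖ * (‖pinv A‖ ^ 3 * ‖b‖)) := by
  set w := Matrix.toEuclideanLin (gramPinv A) (optSol A b) with hw
  have hAw : ‖Matrix.toEuclideanLin A w‖ ≤ ‖A‖ * (‖pinv A‖ ^ 3 * ‖b‖) := by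
    refine (norm_toEuclideanLin_le A w).trans (mul_le_mul_of_nonneg_left ?_ (norm_nonneg _))
    calc ‖w‖ ≤ ‖gramPinv A‖ * ‖optSol A b‖ := norm_toEuclideanLin_le _ _
      _ ≤ ‖pinv A‖ ^ 2 * (‖pinv A‖ * ‖b‖) :=
          mul_le_mul (norm_gramPinv_le A) (norm_toEuclideanLin_le _ _) (norm_nonneg _)
            (by positivity)
      _ = ‖pinv A‖ ^ 3 * ‖b‖ := by ring
  rw [← norm_neg, ← map_neg, neg_sub]
  refine (norm_apply_le_of_regularizedGram_apply_eq (w := w) hμ ?_).trans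
    (mul_le_mul_of_nonneg_left hAw hμ)
  rw [regularizedGram_apply_optSol_sub hy, hw, gram_apply_gramPinv_optSol]

/-- The regularization parameter `λ` of the algorithm, for a right-hand side of norm `β`. -/
def regularization (A : Matrix (Fin N) (Fin M) ℂ) (β ε : ℝ) : ℝ :=
  ε / (2 * ‖A‖ ^ 2 * ‖pinv A‖ ^ 4 * β)

/-- The accuracy with which the regularized normal equations have to be known: it is the fraction
`ε / (8 (‖A‖ (‖x*‖ + 1) + ε))` of the regularization parameter. -/
def tolerance (A : Matrix (Fin N) (Fin M) ℂ) (b : EuclideanSpace ℂ (Fin N)) (ε : ℝ) : ℝ :=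
  ε / (8 * (‖A‖ * (‖optSol A b‖ + 1) + ε)) * regularization A ‖b‖ ε

theorem regularization_pos (hA : A ≠ 0) (hβ : 0 < β) (hε : 0 < ε) :
    0 < regularization A β ε := by
  have : 0 < ‖A‖ := norm_pos_iff.2 hA
  have := norm_pinv_pos hA
  rw [regularization]
  positivity

theorem tolerance_pos (hA : A ≠ 0) (hb : b ≠ 0) (hε : 0 < ε) : 0 < tolerance A b ε :=
  mul_pos (by positivity) (regularization_pos hA (norm_pos_iff.2 hb) hε)

theorem div_tolerance_le (hε : 0 < ε) : ε / (8 * (‖A‖ * (‖optSol A b‖ + 1) + ε)) ≤ 1 / 8 := by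
  have : 0 ≤ ‖A‖ * (‖optSol A b‖ + 1) := by positivity
  rw [div_le_iff₀ (by positivity)]
  linarith

theorem isUnit_det_of_norm_le_tolerance (hA : A ≠ 0) (hb : b ≠ 0) (hε : 0 < ε)
    (hE : ‖E‖ ≤ tolerance A b ε) :
    IsUnit (regularizedGram A (regularization A ‖b‖ ε) + E).det := by
  have hμ := regularization_pos hA (norm_pos_iff.2 hb) hε
  refine isUnit_det_regularizedGram_add (hE.trans_lt ?_)
  rw [tolerance]
  nlinarith [div_tolerance_le (A := A) (b := b) hε]

theorem norm_apply_regularized_sub_optSol_le_half (hA : A ≠ 0) (hb : b ≠ 0) (hε : 0 < ε)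
    (hy : Matrix.toEuclideanLin (regularizedGram A (regularization A ‖b‖ ε)) y
      = Matrix.toEuclideanLin Aᴴ b) :
    ‖Matrix.toEuclideanLin A (y - optSol A b)‖ ≤ ε / 2 := by
  have : 0 < ‖A‖ := norm_pos_iff.2 hA
  have := norm_pinv_pos hA
  have hβ : 0 < ‖b‖ := norm_pos_iff.2 hb
  have hμ := regularization_pos hA hβ hε
  refine (norm_apply_regularized_sub_optSol_le hμ.le hy).trans ?_
  calc regularization A ‖b‖ ε * (‖A‖ * (‖pinv A‖ ^ 3 * ‖b‖))
      ≤ regularization A ‖b‖ ε * (‖A‖ * (‖pinv A‖ ^ 3 * ‖b‖)) * condNumber A :=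
        le_mul_of_one_le_right (by positivity) (one_le_condNumber hA)
    _ = ε / 2 := by
        rw [regularization, condNumber]
        field_simp

theorem isApproxSolution_of_norm_le_tolerance (hA : A ≠ 0) (hb : b ≠ 0) (hε : 0 < ε)
    (hE : ‖E‖ ≤ tolerance A b ε) (hf : ‖f‖ ≤ tolerance A b ε)
    (hx : Matrix.toEuclideanLin (regularizedGram A (regularization A ‖b‖ ε) + E) x
      = Matrix.toEuclideanLin Aᴴ b + f) : IsApproxSolution A b ε x := by
  have hμ := regularization_pos hA (norm_pos_iff.2 hb) hε
  obtain ⟨y, hy⟩ := exists_regularizedGram_apply_eq (A := A) hμ (Matrix.toEuclideanLin Aᴴ b)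
  set R := ‖A‖ * (‖optSol A b‖ + 1) + ε with hR
  have hR0 : 0 < R := by positivity
  have hy_norm : ‖y‖ ≤ 2 * ‖optSol A b‖ := by
    have := norm_le_norm_add_norm_sub' y (optSol A b)
    have := norm_regularized_sub_optSol_le hμ hy
    linarith
  have h_noise : ‖Matrix.toEuclideanLin A (x - y)‖ ≤ ε / 2 := by
    calc ‖Matrix.toEuclideanLin A (x - y)‖ ≤ ‖A‖ * ‖x - y‖ := norm_toEuclideanLin_le A _
      _ ≤ ‖A‖ * (2 * (ε / (8 * R)) * (1 + 2 * ‖optSol A b‖)) := by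
          refine mul_le_mul_of_nonneg_left ?_ (norm_nonneg _)
          refine (norm_sub_le_of_perturbed hμ ?_ hE hf hy hx).trans (by gcongr)
          exact (div_tolerance_le hε).trans (by norm_num)
      _ ≤ 2 * (ε / (8 * R)) * (2 * R) := by
          have : ‖A‖ * (1 + 2 * ‖optSol A b‖) ≤ 2 * R := by
            rw [hR]
            linarith [norm_nonneg A]
          calc _ = 2 * (ε / (8 * R)) * (‖A‖ * (1 + 2 * ‖optSol A b‖)) := by ring
            _ ≤ _ := by gcongr
      _ = ε / 2 := by
          field_simp
          norm_num
  refine isApproxSolution_of_norm_le ?_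
  rw [← sub_add_sub_cancel x y, map_add]
  linarith [norm_add_le (Matrix.toEuclideanLin A (x - y))
    (Matrix.toEuclideanLin A (y - optSol A b)),
    norm_apply_regularized_sub_optSol_le_half hA hb hε hy]

end

/-! ### Nets of the unit ball -/

section

open Metric

theorem packingNumber_closedBall_le (E : Type*) [NormedAddCommGroup E] [NormedSpace ℝ E]
    [FiniteDimensional ℝ E] :
    packingNumber (1 / 2) (closedBall (0 : E) 1) ≤ (5 ^ Module.finrank ℝ E : ℕ) := by
  classical
  refine iSup_le fun C => iSup_le fun hC => iSup_le fun hsep => ?_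
  by_contra! h
  obtain ⟨F, hFC, hF⟩ := Set.exists_subset_encard_eq (Order.add_one_le_of_lt h)
  lift F to Finset E using Set.finite_of_encard_eq_coe hF
  rw [Set.encard_coe_eq_coe_finsetCard, ← Nat.cast_add_one, Nat.cast_inj] at hF
  have hcard := Besicovitch.card_le_of_separated (F.image ((2 : ℝ) • ·)) ?_ ?_
  · rw [Finset.card_image_of_injective F (smul_right_injective E two_ne_zero)] at hcard
    omega
  · simp only [Finset.forall_mem_image, norm_smul, Real.norm_ofNat]
    intro u hu
    linarith [mem_closedBall_zero_iff.1 (hC (hFC hu))]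
  · simp only [Finset.forall_mem_image, ← smul_sub, norm_smul, Real.norm_ofNat]
    intro u hu v hv huv
    have huv' : (1 / 2 : NNReal) < nndist u v := by
      simpa only [edist_nndist, ENNReal.coe_lt_coe] using
        hsep (hFC hu) (hFC hv) (ne_of_apply_ne _ huv)
    rw [← NNReal.coe_lt_coe, coe_nndist, dist_eq_norm] at huv'
    push_cast at huv'
    linarith

theorem exists_finset_isCover_closedBall (E : Type*) [NormedAddCommGroup E] [NormedSpace ℝ E]
    [FiniteDimensional ℝ E] :
    ∃ s : Finset E, s.card ≤ 5 ^ Module.finrank ℝ E ∧ (s : Set E) ⊆ closedBall 0 1 ∧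
      IsCover (1 / 2) (closedBall 0 1) (s : Set E) := by
  have hle := (coveringNumber_le_packingNumber _ _).trans (packingNumber_closedBall_le E)
  obtain ⟨s, hs, hfin, hcover, hcard⟩ :=
    exists_set_encard_eq_coveringNumber (ne_top_of_le_ne_top (ENat.natCast_ne_top _) hle)
  lift s to Finset E using hfin
  rw [← hcard, Set.encard_coe_eq_coe_finsetCard, Nat.cast_le] at hle
  exact ⟨s, hle, hs, hcover⟩

theorem exists_norm_sub_le_of_isCover {E : Type*} [NormedAddCommGroup E] {s : Set E}
    (hs : IsCover (1 / 2) (closedBall 0 1) s) {x : E} (hx : ‖x‖ ≤ 1) :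
    ∃ u ∈ s, ‖x - u‖ ≤ 1 / 2 := by
  obtain ⟨u, hu, hxu⟩ := hs (mem_closedBall_zero_iff.2 hx)
  refine ⟨u, hu, ?_⟩
  have hxu : edist x u ≤ (1 / 2 : NNReal) := hxu
  rw [edist_nndist, ENNReal.coe_le_coe, ← NNReal.coe_le_coe, coe_nndist, dist_eq_norm] at hxu
  exact_mod_cast hxu

variable {E F : Type*} [NormedAddCommGroup E] [InnerProductSpace ℂ E] [NormedAddCommGroup F]
  [InnerProductSpace ℂ F] {s : Set E} {s' : Set F} {t : ℝ}

theorem norm_le_of_isCover (hs : IsCover (1 / 2) (closedBall 0 1) s) {y : E}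
    (h : ∀ u ∈ s, (inner ℂ u y).re ≤ t) : ‖y‖ ≤ 2 * t := by
  set x : E := ((‖y‖⁻¹ : ℝ) : ℂ) • y with hx
  have hx1 : ‖x‖ ≤ 1 := by
    rw [hx, norm_smul, Complex.norm_real, norm_inv, norm_norm]
    exact inv_mul_le_one
  have hxy : (inner ℂ x y).re = ‖y‖ := by
    rw [hx, inner_smul_left, Complex.conj_ofReal, Complex.re_ofReal_mul,
      ← RCLike.re_eq_complex_re, inner_self_eq_norm_mul_norm, ← mul_assoc]
    obtain h0 | h0 := eq_or_ne ‖y‖ 0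
    · rw [h0, mul_zero]
    · rw [inv_mul_cancel₀ h0, one_mul]
  obtain ⟨u, hu, hxu⟩ := exists_norm_sub_le_of_isCover hs hx1
  have key : ‖y‖ ≤ t + 1 / 2 * ‖y‖ := calc
    ‖y‖ = (inner ℂ u y).re + (inner ℂ (x - u) y).re := by
      rw [← Complex.add_re, ← inner_add_left, add_sub_cancel, hxy]
    _ ≤ t + ‖x - u‖ * ‖y‖ := add_le_add (h u hu) (re_inner_le_norm (𝕜 := ℂ) _ _)
    _ ≤ t + 1 / 2 * ‖y‖ := by gcongr
  linarith

theorem opNorm_le_of_isCover (hs : IsCover (1 / 2) (closedBall 0 1) s)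
    (hs' : IsCover (1 / 2) (closedBall 0 1) s') {T : E →L[ℂ] F}
    (h : ∀ u ∈ s', ∀ v ∈ s, (inner ℂ u (T v)).re ≤ t) : ‖T‖ ≤ 4 * t := by
  have hTs : ∀ v ∈ s, ‖T v‖ ≤ 2 * t := fun v hv => norm_le_of_isCover hs' fun u hu => h u hu v hv
  have hball : ∀ x ∈ closedBall (0 : E) 1, ‖T x‖ ≤ 2 * t + ‖T‖ * (1 / 2) := fun x hx => by
    obtain ⟨v, hv, hxv⟩ := exists_norm_sub_le_of_isCover hs (mem_closedBall_zero_iff.1 hx)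
    calc ‖T x‖ = ‖T v + T (x - v)‖ := by rw [← map_add, add_sub_cancel]
      _ ≤ 2 * t + ‖T‖ * (1 / 2) :=
        norm_add_le_of_le (hTs v hv) (T.le_opNorm_of_le hxv)
  have hT : ‖T‖ ≤ 2 * t + ‖T‖ * (1 / 2) := by
    conv_lhs => rw [← ContinuousLinearMap.sSup_unitClosedBall_eq_norm]
    refine csSup_le ((nonempty_closedBall.2 zero_le_one).image _) ?_
    simpa only [Set.forall_mem_image] using hball
  linarith

end

/-! ### The distribution of a Hadamard test -/

section

open MeasureTheory

variable {α : Type*} [MeasurableSpace α]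

theorem expect_eq_lintegral [Countable α] [MeasurableSingletonClass α] (p : PMF α)
    (F : α → ENNReal) : expect p F = ∫⁻ a, F a ∂p.toMeasure := by
  rw [lintegral_countable']
  exact tsum_congr fun a => by rw [p.toMeasure_apply_singleton a (measurableSet_singleton a),
    mul_comm]

theorem expect_exp_sub_le [Countable α] [MeasurableSingletonClass α] (p : PMF α) {X : α → ℝ}
    (hX : ∀ a, X a ∈ Set.Icc (-1) 1) (t : ℝ) :
    expect p (fun a => ENNReal.ofReal
      (Real.exp (t * (X a - ∫ a, X a ∂p.toMeasure) - t ^ 2 / 2))) ≤ 1 := by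
  have hmgf := ProbabilityTheory.hasSubgaussianMGF_of_mem_Icc (μ := p.toMeasure)
    (measurable_of_countable X).aemeasurable (ae_of_all _ hX)
  have hle := hmgf.mgf_le t
  norm_num [coe_nnnorm] at hle
  simp only [Real.exp_sub, div_eq_mul_inv, ENNReal.ofReal_mul (Real.exp_pos _).le, mul_comm _
    (ENNReal.ofReal (Real.exp _)⁻¹)]
  rw [expect_const_mul, expect_eq_lintegral, ← ofReal_integral_eq_lintegral_ofReal
    (hmgf.integrable_exp_mul t) (ae_of_all _ fun _ => (Real.exp_pos _).le),
    ← ENNReal.ofReal_mul (by positivity), ENNReal.ofReal_le_one,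
    inv_mul_le_one₀ (Real.exp_pos _), ← div_eq_mul_inv]
  exact hle

end

section

open MeasureTheory

variable {n : ℕ}

theorem sum_basis_succ {α : Type*} [AddCommMonoid α] (f : Basis (n + 1) → α) :
    ∑ x, f x = ∑ z : Fin 2, ∑ y : Basis n, f (Fin.cons z y) := by
  rw [← (Fin.consEquiv fun _ => Fin 2).sum_comp, Fintype.sum_prod_type]
  rfl

/-- The expected value of `1 - 2 z` for the bit `z` that is measured on qubit `0`. -/
def Circuit.bias (c : Circuit (n + 1)) : ℝ :=
  ∫ z : Fin 2, (1 - 2 * ((z : ℕ) : ℝ)) ∂(c.measure 0).toMeasure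

theorem Circuit.expect_exp_sub_bias_le (c : Circuit (n + 1)) (t : ℝ) :
    expect (c.measure 0) (fun z => ENNReal.ofReal
      (Real.exp (t * (1 - 2 * ((z : ℕ) : ℝ) - c.bias) - t ^ 2 / 2))) ≤ 1 :=
  expect_exp_sub_le _ (X := fun z : Fin 2 => 1 - 2 * ((z : ℕ) : ℝ))
    (fun z => by fin_cases z <;> norm_num) t

theorem Circuit.bias_eq_sum (c : Circuit (n + 1)) :
    c.bias = ∑ y, (‖c.state (Fin.cons 0 y)‖ ^ 2 - ‖c.state (Fin.cons 1 y)‖ ^ 2) := by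
  rw [bias, measure, ← PMF.toMeasure_map _ _ (measurable_pi_apply 0),
    integral_map (measurable_pi_apply 0).aemeasurable (by fun_prop), PMF.integral_eq_sum,
    sum_basis_succ, Fin.sum_univ_two, ← Finset.sum_add_distrib]
  refine Finset.sum_congr rfl fun y _ => ?_
  simp only [PMF.ofFintype_apply, Fin.cons_zero, smul_eq_mul,
    ENNReal.toReal_ofReal (sq_nonneg _), Fin.val_zero, Fin.val_one]
  push_cast
  ring

theorem onAncilla_mul_apply (g : Matrix (Fin 2) (Fin 2) ℂ)
    (X : Matrix (Basis (n + 1)) (Basis (n + 1)) ℂ) (z : Fin 2) (y : Basis n) (w : Basis (n + 1)) :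
    (onAncilla (n := n) g * X) (Fin.cons z y) w = ∑ z', g z z' * X (Fin.cons z' y) w := by
  rw [Matrix.mul_apply, sum_basis_succ]
  simp [onAncilla]

theorem mul_onAncilla_apply_zero (g : Matrix (Fin 2) (Fin 2) ℂ)
    (X : Matrix (Basis (n + 1)) (Basis (n + 1)) ℂ) (w : Basis (n + 1)) :
    (X * onAncilla (n := n) g) w 0 = ∑ z', X w (Fin.cons z' 0) * g z' 0 := by
  have htail : Fin.tail (0 : Basis (n + 1)) = 0 := rfl
  rw [Matrix.mul_apply, sum_basis_succ]
  simp [onAncilla, htail]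

/-- The relative phase `1` or `-i` introduced by the phase gate of the Hadamard test. -/
def Part.phase : Part → ℂ
  | .re => 1
  | .im => -Complex.I

theorem controlled_mul_onAncilla_hadamardGate_apply_zero (U : Matrix (Basis n) (Basis n) ℂ)
    (z : Fin 2) (y : Basis n) :
    (controlled U * onAncilla (n := n) hadamardGate) (Fin.cons z y) 0 =
      (if z = 1 then U else 1) y 0 * ((Real.sqrt 2 : ℝ) : ℂ)⁻¹ := by
  rw [mul_onAncilla_apply_zero]
  fin_cases z <;> simp only [controlled, hadamardGate, Matrix.of_apply, Fin.tail_cons] <;> simp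

theorem hadamardTest_apply_zero (p : Part) (U : Matrix (Basis n) (Basis n) ℂ) (z : Fin 2)
    (y : Basis n) : hadamardTest p U (Fin.cons z y) 0 =
      1 / 2 * ((1 : Matrix (Basis n) (Basis n) ℂ) y 0 +
        (if z = 0 then 1 else -1) * (p.phase * U y 0)) := by
  have hsqrt : ((Real.sqrt 2 : ℝ) : ℂ)⁻¹ * ((Real.sqrt 2 : ℝ) : ℂ)⁻¹ = 1 / 2 := by
    rw [← mul_inv, ← Complex.ofReal_mul, Real.mul_self_sqrt zero_le_two]
    norm_num
  rw [hadamardTest, Matrix.mul_assoc, Matrix.mul_assoc, onAncilla_mul_apply, ← hsqrt]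
  simp only [onAncilla_mul_apply, controlled_mul_onAncilla_hadamardGate_apply_zero,
    Fin.sum_univ_two]
  cases p <;> fin_cases z <;> simp [hadamardGate, phaseGate, Part.phase] <;> ring

theorem Circuit.bias_of_mat_eq_hadamardTest {c : Circuit (n + 1)}
    {U : Matrix (Basis n) (Basis n) ℂ} {p : Part} (hc : c.mat = hadamardTest p U) :
    c.bias = (p.phase * U 0 0).re := by
  have polarization (δ w : ℂ) : ‖1 / 2 * (δ + 1 * w)‖ ^ 2 - ‖1 / 2 * (δ + -1 * w)‖ ^ 2 =
      (star δ * w).re := by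
    simp only [← Complex.normSq_eq_norm_sq, Complex.normSq_apply]
    simp
    ring
  simp only [bias_eq_sum, state, hc, hadamardTest_apply_zero, if_true, one_ne_zero, if_false,
    polarization]
  rw [Finset.sum_eq_single 0 (fun y _ hy => by simp [Matrix.one_apply_ne hy]) (by simp)]
  simp

end

/-! ### Exponential moments of the estimates -/

/-- The memory `m'` differs from `m` at most in the places that `estimate` writes to. -/
structure AgreesForEstimate (m m' : Mem) : Prop where
  nat : ∀ r, r ≠ rT → m'.nat r = m.nat r
  arr : ∀ a, a ≠ aAcc → a ≠ aBit → m'.arr a = m.arr a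

namespace AgreesForEstimate

theorem refl (m : Mem) : AgreesForEstimate m m :=
  ⟨fun _ _ => rfl, fun _ _ _ => rfl⟩

theorem trans {m m' m'' : Mem} (h : AgreesForEstimate m m') (h' : AgreesForEstimate m' m'') :
    AgreesForEstimate m m'' :=
  ⟨fun r hr => (h'.nat r hr).trans (h.nat r hr),
    fun a ha ha' => (h'.arr a ha ha').trans (h.arr a ha ha')⟩

theorem setNat (m : Mem) (t : ℕ) : AgreesForEstimate m (m.setNat rT t) :=
  ⟨fun _ hr => Mem.setNat_nat_of_ne _ _ hr, fun _ _ _ => rfl⟩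

theorem setArr (m : Mem) {a : ℕ} (ha : a = aAcc ∨ a = aBit) (i j : ℕ) (z : ℂ) :
    AgreesForEstimate m (m.setArr a i j z) :=
  ⟨fun _ _ => rfl, fun a' h h' =>
    Mem.setArr_arr_of_ne _ _ _ _ (by rintro rfl; exact ha.elim h h')⟩

end AgreesForEstimate

section

variable {n : ℕ} {circ : ℕ → ℕ → Part → Circuit (n + 1)} {m : Mem} {e f : NExpr} {E F : ℕ}
  {H : Mem → ENNReal} {c : ℝ}

theorem wp_test_accumulate_le {p : Part} {x : CExpr} {ζ : ℂ} (a : ℂ)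
    (he : e.eval m = E) (hf : f.eval m = F)
    (hx : ∀ z : ℂ, x.eval (m.setArr aBit 0 0 z) = m.arr aAcc 0 0 + ζ * (1 - 2 * z))
    (hH : ∀ m', AgreesForEstimate m m' → H m' ≤ ENNReal.ofReal (Real.exp
      (c + (a * (m'.arr aAcc 0 0 - ζ * (circ E F p).bias)).re - (a * ζ).re ^ 2 / 2))) :
    wp circ (.seq (.test aBit (.lit 0) (.lit 0) e f p) (setSc aAcc x)) H m ≤
      ENNReal.ofReal (Real.exp (c + (a * m.arr aAcc 0 0).re)) := by
  rw [wp_seq, wp_test, he, hf]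
  calc _ ≤ expect ((circ E F p).measure 0) (fun z => ENNReal.ofReal
          (Real.exp (c + (a * m.arr aAcc 0 0).re)) * ENNReal.ofReal (Real.exp
          ((a * ζ).re * (1 - 2 * ((z : ℕ) : ℝ) - (circ E F p).bias) - (a * ζ).re ^ 2 / 2))) := by
        refine expect_mono fun z _ => ?_
        rw [wp_setSc]
        refine (hH _ ((AgreesForEstimate.setArr m (.inr rfl) 0 0 _).trans
          (AgreesForEstimate.setArr _ (.inl rfl) 0 0 _))).trans_eq ?_
        rw [← ENNReal.ofReal_mul (Real.exp_pos _).le, ← Real.exp_add, Mem.setArr_arr_self]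
        simp only [NExpr.eval]
        rw [hx]
        have hacc : a * (m.arr aAcc 0 0 + ζ * (1 - 2 * (z : ℕ)) - ζ * (circ E F p).bias) =
            a * m.arr aAcc 0 0 +
              a * ζ * ((1 - 2 * ((z : ℕ) : ℝ) - (circ E F p).bias : ℝ) : ℂ) := by
          push_cast
          ring
        rw [hacc, Complex.add_re, Complex.re_mul_ofReal]
        ring_nf
    _ ≤ _ := by
        rw [expect_const_mul]
        exact mul_le_of_le_one_right' (Circuit.expect_exp_sub_bias_le _ _)

/-- The body of the loop in `estimate`: the Hadamard tests for the real and the imaginary part. -/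
def estimateRound (e f : NExpr) : Cmd :=
  .seq (.test aBit (.lit 0) (.lit 0) e f .re) <|
  .seq (setSc aAcc (.add (sc aAcc) (.sub (.int 1) (.mul (.int 2) (sc aBit))))) <|
  .seq (.test aBit (.lit 0) (.lit 0) e f .im) <|
    setSc aAcc (.add (sc aAcc) (.mul .imag (.sub (.int 1) (.mul (.int 2) (sc aBit)))))

theorem wp_estimateRound_le {v : ℂ} (a : ℂ) (he : ∀ m', AgreesForEstimate m m' → e.eval m' = E)
    (hf : ∀ m', AgreesForEstimate m m' → f.eval m' = F)
    (hbias : ∀ p, (circ E F p).bias = (p.phase * v).re)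
    (hH : ∀ m', AgreesForEstimate m m' → H m' ≤ ENNReal.ofReal (Real.exp
      (c + (a * (m'.arr aAcc 0 0 - v)).re - ‖a‖ ^ 2 / 2))) :
    wp circ (estimateRound e f) H m ≤ ENNReal.ofReal (Real.exp (c + (a * m.arr aAcc 0 0).re)) := by
  have hassoc (c₁ c₂ c₃ c₄ : Cmd) : wp circ (.seq c₁ (.seq c₂ (.seq c₃ c₄))) H m =
      wp circ (.seq c₁ c₂) (wp circ (.seq c₃ c₄) H) m := by
    rw [wp_seq, wp_seq]
    exact congrFun (congrArg _ (funext fun _ => wp_seq)) m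
  rw [estimateRound, hassoc]
  refine wp_test_accumulate_le a (he m (.refl m)) (hf m (.refl m)) (ζ := 1) (fun z => ?_)
    fun m₁ h₁ => ?_
  · simp [CExpr.eval, sc, NExpr.eval, Mem.setArr_arr]
  refine (wp_test_accumulate_le (ζ := Complex.I)
    (c := c - (a * (1 * (circ E F .re).bias)).re - (a * 1).re ^ 2 / 2) a (he m₁ h₁) (hf m₁ h₁)
    (fun z => ?_) fun m₂ h₂ => ?_).trans_eq ?_
  · simp [CExpr.eval, sc, NExpr.eval, Mem.setArr_arr]
  · refine (hH m₂ (h₁.trans h₂)).trans_eq ?_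
    rw [hbias, hbias, ← Complex.normSq_eq_norm_sq, Complex.normSq_apply]
    simp [Part.phase]
    ring_nf
  · rw [mul_sub, Complex.sub_re]
    ring_nf

theorem wp_estimate_le {S : ℕ} (hS : m.nat rS = S) (hS0 : 0 < S)
    (he : ∀ m', AgreesForEstimate m m' → e.eval m' = E)
    (hf : ∀ m', AgreesForEstimate m m' → f.eval m' = F) {v : ℂ}
    (hbias : ∀ p, (circ E F p).bias = (p.phase * v).re) (α : ℂ)
    (hH : ∀ m', AgreesForEstimate m m' → H m' ≤ ENNReal.ofReal
      (Real.exp (c + (α * (m'.arr aAcc 0 0 - v)).re - ‖α‖ ^ 2 / (2 * S)))) :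
    wp circ (estimate e f) H m ≤ ENNReal.ofReal (Real.exp c) := by
  have hSc : (S : ℂ) ≠ 0 := by exact_mod_cast hS0.ne'
  have hagree : AgreesForEstimate m (m.setArr aAcc 0 0 0) := .setArr m (.inl rfl) _ _ _
  let Φ : ℕ → Mem → ENNReal := fun t m' => ENNReal.ofReal
    (Real.exp (c + (α / S * (m'.arr aAcc 0 0 - t * v)).re - t * ‖α / S‖ ^ 2 / 2))
  have hzero : CExpr.eval m (.int 0) = 0 := by simp [CExpr.eval]
  rw [estimate, wp_seq, wp_setSc, hzero, wp_seq]
  refine (wp_loop_le (e := .reg rS) (k := S)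
    ((hagree.nat rS (by decide)).trans hS) (fun _ => AgreesForEstimate m) Φ hagree
    (fun t _ m' h G hG => ?_)
    fun m' h => ?_).trans_eq (by simp [Φ])
  · have h' := h.trans (.setNat m' t)
    refine (wp_estimateRound_le (c := c - (α / S * (t * v)).re - t * ‖α / S‖ ^ 2 / 2) (α / S)
      (fun m'' h'' => he m'' (h'.trans h'')) (fun m'' h'' => hf m'' (h'.trans h'')) hbias
      fun m'' h'' => (hG m'' (h'.trans h'')).trans_eq ?_).trans_eq ?_
    · simp only [Φ, mul_sub, Complex.sub_re]
      push_cast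
      simp only [add_mul, mul_add, Complex.add_re, one_mul]
      ring_nf
    · simp only [Φ, mul_sub, Complex.sub_re, Mem.setNat_arr]
      ring_nf
  · have hrS : m'.nat rS = S := (h.nat rS (by decide)).trans hS
    rw [wp_setSc]
    refine (hH _ (h.trans (.setArr _ (.inl rfl) _ _ _))).trans_eq ?_
    simp only [Φ, Mem.setArr_arr_self, CExpr.eval, sc, NExpr.eval, hrS, norm_div,
      Complex.norm_natCast]
    congr 3
    · field_simp
    · field_simp

end

/-- The memory holds the dimension `M`, the number `S` of repetitions, the norms `nrm` of the
columns and of the right-hand side, and the regularization parameter `μ`. -/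
structure IsReady (M S : ℕ) (nrm : ℕ → ℝ) (μ : ℂ) (m : Mem) : Prop where
  rM : m.nat rM = M
  rS : m.nat rS = S
  nrm : ∀ e, m.arr aNrm e 0 = nrm e
  lam : m.arr aLam 0 0 = μ

/-- A weighted deviation of the value `z` from its mean `r v`, reduced by the exponent in the bound
for its exponential moment: `z` is `r` times an average of `S` pairs of tests. -/
def deviation (S : ℕ) (α : ℂ) (r : ℝ) (v z : ℂ) : ℝ :=
  (α * (z - r * v)).re - (‖α‖ * r) ^ 2 / (2 * S)

/-- The sum of the deviations of the first `i` entries of row `j` of the estimated matrix, before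
its diagonal entry is shifted. -/
def deviationRow (S : ℕ) (nrm : ℕ → ℝ) (v α : ℕ → ℕ → ℂ) (m : Mem) (j i : ℕ) : ℝ :=
  ∑ k ∈ Finset.range i, deviation S (α j k) (nrm j * nrm k) (v j k) (m.arr aW j k)

/-- The sum of the deviations of the entries of the first `j` rows of the estimated matrix, whose
diagonal entries have been shifted by `μ`. -/
def deviationW (M S : ℕ) (nrm : ℕ → ℝ) (μ : ℂ) (v α : ℕ → ℕ → ℂ) (m : Mem) (j : ℕ) : ℝ :=
  ∑ j' ∈ Finset.range j, ∑ k ∈ Finset.range M, deviation S (α j' k) (nrm j' * nrm k) (v j' k)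
    (m.arr aW j' k - if j' = k then μ else 0)

/-- The sum of the deviations of the first `j` entries of the estimated right-hand side. -/
def deviationQ (M S : ℕ) (nrm : ℕ → ℝ) (v : ℕ → ℕ → ℂ) (β : ℕ → ℂ) (m : Mem) (j : ℕ) : ℝ :=
  ∑ j' ∈ Finset.range j, deviation S (β j') (nrm j' * nrm M) (v j' M) (m.arr aQ j' 0)

section

variable {n : ℕ} {circ : ℕ → ℕ → Part → Circuit (n + 1)} {M S : ℕ} {nrm : ℕ → ℝ} {μ : ℂ}
  {v α : ℕ → ℕ → ℂ} {β : ℕ → ℂ} {m m' : Mem} {H : Mem → ENNReal} {c : ℝ}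

namespace IsReady

theorem of_agreesForEstimate (h : IsReady M S nrm μ m) (h' : AgreesForEstimate m m') :
    IsReady M S nrm μ m' where
  rM := (h'.nat _ (by decide)).trans h.rM
  rS := (h'.nat _ (by decide)).trans h.rS
  nrm e := by rw [h'.arr _ (by decide) (by decide), h.nrm]
  lam := by rw [h'.arr _ (by decide) (by decide), h.lam]

theorem setNat (h : IsReady M S nrm μ m) {r : ℕ} (h0 : 0 ≠ r) (h1 : 1 ≠ r) (t : ℕ) :
    IsReady M S nrm μ (m.setNat r t) :=
  ⟨(Mem.setNat_nat_of_ne _ _ h0).trans h.rM, (Mem.setNat_nat_of_ne _ _ h1).trans h.rS,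
    h.nrm, h.lam⟩

theorem setArr (h : IsReady M S nrm μ m) {a : ℕ} (h0 : aNrm ≠ a) (h1 : aLam ≠ a) (i j : ℕ)
    (z : ℂ) : IsReady M S nrm μ (m.setArr a i j z) :=
  ⟨h.rM, h.rS, fun e => by rw [Mem.setArr_arr_of_ne _ _ _ _ h0, h.nrm],
    by rw [Mem.setArr_arr_of_ne _ _ _ _ h1, h.lam]⟩

end IsReady

theorem deviationRow_congr {j i : ℕ} (h : ∀ k < i, m'.arr aW j k = m.arr aW j k) :
    deviationRow S nrm v α m' j i = deviationRow S nrm v α m j i :=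
  Finset.sum_congr rfl fun k hk => by rw [h k (Finset.mem_range.1 hk)]

theorem deviationW_congr {j : ℕ} (h : ∀ i < j, m'.arr aW i = m.arr aW i) :
    deviationW M S nrm μ v α m' j = deviationW M S nrm μ v α m j :=
  Finset.sum_congr rfl fun i hi => by rw [h i (Finset.mem_range.1 hi)]

theorem deviationQ_congr {j : ℕ} (h : ∀ i < j, m'.arr aQ i 0 = m.arr aQ i 0) :
    deviationQ M S nrm v β m' j = deviationQ M S nrm v β m j :=
  Finset.sum_congr rfl fun i hi => by rw [h i (Finset.mem_range.1 hi)]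

theorem deviationW_setArr_diagonal (m : Mem) (j : ℕ) :
    deviationW M S nrm μ v α (m.setArr aW j j (m.arr aW j j + μ)) (j + 1) =
      deviationW M S nrm μ v α m j + deviationRow S nrm v α m j M := by
  rw [deviationW, Finset.sum_range_succ, ← deviationW,
    deviationW_congr (m := m) fun i hi => funext fun k => by simp [Mem.setArr_arr, hi.ne]]
  congr 1
  refine Finset.sum_congr rfl fun k _ => ?_
  obtain rfl | hk := eq_or_ne j k
  · simp
  · simp [Mem.setArr_arr, hk, hk.symm]

theorem wp_estimate_store_le (hm : IsReady M S nrm μ m) (hS0 : 0 < S) {e f i j : NExpr}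
    {E F I J : ℕ} (he : ∀ m', AgreesForEstimate m m' → e.eval m' = E)
    (hf : ∀ m', AgreesForEstimate m m' → f.eval m' = F)
    (hi : ∀ m', AgreesForEstimate m m' → i.eval m' = I)
    (hj : ∀ m', AgreesForEstimate m m' → j.eval m' = J) {w : ℂ}
    (hbias : ∀ p, (circ E F p).bias = (p.phase * w).re) (ζ : ℂ) {a : ℕ}
    (hH : ∀ m', AgreesForEstimate m m' → ∀ z : ℂ, H (m'.setArr a I J z) ≤ ENNReal.ofReal
      (Real.exp (c + deviation S ζ (nrm E * nrm F) w z))) :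
    wp circ (.seq (estimate e f) (.setArr a i j (.mul (.mul (nrmOf e) (nrmOf f)) (sc aAcc)))) H m
      ≤ ENNReal.ofReal (Real.exp c) := by
  rw [wp_seq]
  refine wp_estimate_le hm.rS hS0 he hf hbias (ζ * (nrm E * nrm F : ℝ)) fun m' h => ?_
  rw [wp_setArr, hi m' h, hj m' h]
  refine (hH m' h _).trans_eq ?_
  have hnrm := (hm.of_agreesForEstimate h).nrm
  simp only [deviation, CExpr.eval, nrmOf, NExpr.eval, he m' h, hf m' h, sc, hnrm, norm_mul,
    Complex.norm_real, mul_pow, Real.norm_eq_abs, sq_abs, ← add_sub_assoc]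
  congr 5
  push_cast
  ring

theorem wp_computeW_row_le (hS0 : 0 < S) {j : ℕ}
    (hbias : ∀ k < M, ∀ p, (circ j k p).bias = (p.phase * v j k).re) (hm : IsReady M S nrm μ m)
    (hj : m.nat rJ = j)
    (hH : ∀ m', IsReady M S nrm μ m' → m'.nat rJ = j → (∀ i < j, m'.arr aW i = m.arr aW i) →
      H m' ≤ ENNReal.ofReal (Real.exp (c + deviationRow S nrm v α m' j M))) :
    wp circ (.loop rK (.reg rM) (.seq (estimate (.reg rJ) (.reg rK))
      (.setArr aW (.reg rJ) (.reg rK)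
        (.mul (.mul (nrmOf (.reg rJ)) (nrmOf (.reg rK))) (sc aAcc))))) H m ≤
      ENNReal.ofReal (Real.exp c) := by
  refine (wp_loop_le (e := .reg rM) (k := M) hm.rM
    (fun _ m' => IsReady M S nrm μ m' ∧ m'.nat rJ = j ∧ ∀ i < j, m'.arr aW i = m.arr aW i)
    (fun i m' => ENNReal.ofReal (Real.exp (c + deviationRow S nrm v α m' j i)))
    ⟨hm, hj, fun _ _ => rfl⟩ (fun k hk m₁ h₁ G hG => ?_)
    fun m' h => hH m' h.1 h.2.1 h.2.2).trans_eq (by simp [deviationRow])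
  obtain ⟨h₁, hj₁, hW₁⟩ := h₁
  have h₁k := h₁.setNat (r := rK) (by decide) (by decide) k
  have hJ : ∀ m', AgreesForEstimate (m₁.setNat rK k) m' → m'.nat rJ = j := fun m' h =>
    (h.nat _ (by decide)).trans hj₁
  have hK : ∀ m', AgreesForEstimate (m₁.setNat rK k) m' → m'.nat rK = k := fun m' h =>
    (h.nat _ (by decide)).trans (Mem.setNat_nat_self _ _ _)
  refine wp_estimate_store_le (e := .reg rJ) (f := .reg rK) (i := .reg rJ) (j := .reg rK)
    h₁k hS0 hJ hK hJ hK (hbias k hk) (α j k) fun m' h z => ?_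
  have hW : m'.arr aW = m₁.arr aW := h.arr _ (by decide) (by decide)
  refine (hG _ ⟨(h₁k.of_agreesForEstimate h).setArr (by decide) (by decide) _ _ _, hJ m' h,
    fun i hi => funext fun l => ?_⟩).trans_eq ?_
  · simp [Mem.setArr_arr, hi.ne, hW, hW₁ i hi]
  · rw [deviationRow, Finset.sum_range_succ, Mem.setArr_arr_self, ← deviationRow, ← add_assoc,
      deviationRow_congr (m := m₁) fun l hl => by simp [Mem.setArr_arr, hl.ne, hW]]

theorem wp_computeW_le (hS0 : 0 < S)
    (hbias : ∀ j < M, ∀ k < M, ∀ p, (circ j k p).bias = (p.phase * v j k).re)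
    (hm : IsReady M S nrm μ m)
    (hH : ∀ m', IsReady M S nrm μ m' →
      H m' ≤ ENNReal.ofReal (Real.exp (deviationW M S nrm μ v α m' M))) :
    wp circ computeW H m ≤ 1 := by
  refine (wp_loop_le (e := .reg rM) (k := M) hm.rM (fun _ => IsReady M S nrm μ)
    (fun j m' => ENNReal.ofReal (Real.exp (deviationW M S nrm μ v α m' j))) hm
    (fun j hj m₁ h₁ G hG => ?_) hH).trans_eq (by simp [deviationW])
  rw [wp_seq]
  refine wp_computeW_row_le (α := α) hS0 (hbias j hj) (h₁.setNat (by decide) (by decide) j)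
    (Mem.setNat_nat_self _ _ _) fun m' h hJ hW => ?_
  rw [wp_setArr]
  simp only [NExpr.eval, CExpr.eval, hJ, sc, h.lam]
  refine (hG _ (h.setArr (by decide) (by decide) _ _ _)).trans_eq ?_
  rw [deviationW_setArr_diagonal, deviationW_congr hW]
  rfl

theorem wp_computeQ_le (hS0 : 0 < S)
    (hbias : ∀ j < M, ∀ p, (circ j M p).bias = (p.phase * v j M).re) (hm : IsReady M S nrm μ m)
    (hH : ∀ m', m'.arr aW = m.arr aW →
      H m' ≤ ENNReal.ofReal (Real.exp (c + deviationQ M S nrm v β m' M))) :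
    wp circ computeQ H m ≤ ENNReal.ofReal (Real.exp c) := by
  refine (wp_loop_le (e := .reg rM) (k := M) hm.rM
    (fun _ m' => IsReady M S nrm μ m' ∧ m'.arr aW = m.arr aW)
    (fun j m' => ENNReal.ofReal (Real.exp (c + deviationQ M S nrm v β m' j))) ⟨hm, rfl⟩
    (fun j hj m₁ h₁ G hG => ?_) fun m' h => hH m' h.2).trans_eq (by simp [deviationQ])
  obtain ⟨h₁, hW₁⟩ := h₁
  have h₁j := h₁.setNat (r := rJ) (by decide) (by decide) j
  have hJ : ∀ m', AgreesForEstimate (m₁.setNat rJ j) m' → m'.nat rJ = j := fun m' h =>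
    (h.nat _ (by decide)).trans (Mem.setNat_nat_self _ _ _)
  refine wp_estimate_store_le (e := .reg rJ) (f := .reg rM) (i := .reg rJ) (j := .lit 0) (J := 0)
    h₁j hS0 hJ (fun m' h => (h₁j.of_agreesForEstimate h).rM) hJ (fun _ _ => rfl) (hbias j hj)
    (β j) fun m' h z => ?_
  have hQ : m'.arr aQ = m₁.arr aQ := h.arr _ (by decide) (by decide)
  refine (hG _ ⟨(h₁j.of_agreesForEstimate h).setArr (by decide) (by decide) _ _ _, ?_⟩).trans_eq ?_
  · rw [Mem.setArr_arr_of_ne _ _ _ _ (by decide), h.arr _ (by decide) (by decide), ← hW₁]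
    rfl
  · rw [deviationQ, Finset.sum_range_succ, Mem.setArr_arr_self, ← deviationQ, ← add_assoc,
      deviationQ_congr (m := m₁) fun i hi => by simp [Mem.setArr_arr, hi.ne, hQ]]

theorem wp_estimates_le (hS0 : 0 < S)
    (hbias : ∀ j < M, ∀ k ≤ M, ∀ p, (circ j k p).bias = (p.phase * v j k).re)
    (α : ℕ → ℕ → ℂ) (β : ℕ → ℂ) (hm : IsReady M S nrm μ m) :
    wp circ (.seq computeW computeQ) (fun m' => ENNReal.ofReal
      (Real.exp (deviationW M S nrm μ v α m' M + deviationQ M S nrm v β m' M))) m ≤ 1 := by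
  rw [wp_seq]
  refine wp_computeW_le (α := α) hS0 (fun j hj k hk => hbias j hj k hk.le) hm fun m' hm' =>
    wp_computeQ_le (c := deviationW M S nrm μ v α m' M) (β := β) hS0
      (fun j hj => hbias j hj M le_rfl) hm' fun m'' hW => ?_
  rw [deviationW_congr fun i _ => congrFun hW i]

end

/-! ### Costs of the estimates and of the preprocessing -/

/-- The value of `Γ₁` after `j` rounds of `computeGamma`, where `nrm M` is the norm of the
right-hand side. -/
def runningMax (nrm : ℕ → ℝ) (M : ℕ) : ℕ → ℝ
  | 0 => 0
  | j + 1 => max (max (runningMax nrm M j) (nrm j * nrm M)) (nrm j * nrm j)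

theorem runningMax_le {nrm : ℕ → ℝ} {M : ℕ} {Γ : ℝ} (h0 : 0 ≤ Γ) {j : ℕ}
    (h : ∀ i < j, nrm i * nrm M ≤ Γ ∧ nrm i * nrm i ≤ Γ) : runningMax nrm M j ≤ Γ := by
  induction j with
  | zero => exact h0
  | succ j ih =>
    have hj := h j j.lt_succ_self
    exact max_le (max_le (ih fun i hi => h i (hi.trans j.lt_succ_self)) hj.1) hj.2

theorem runningMax_eq_iSup {nrm : ℕ → ℝ} {M : ℕ} (hM : 0 < M) :
    runningMax nrm M M = ⨆ j : Fin M, max (nrm j * nrm M) (nrm j ^ 2) := by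
  have : Nonempty (Fin M) := ⟨⟨0, hM⟩⟩
  refine le_antisymm (runningMax_le (Real.iSup_nonneg fun j => le_max_of_le_right (sq_nonneg _))
    fun i hi => ?_) (ciSup_le fun i => ?_)
  · rw [← sq, ← max_le_iff]
    exact le_ciSup (f := fun j : Fin M => max (nrm j * nrm M) (nrm j ^ 2))
      (Set.finite_range _).bddAbove ⟨i, hi⟩
  · have hmono : Monotone (runningMax nrm M) := monotone_nat_of_le_succ fun j =>
      (le_max_left _ _).trans (le_max_left _ _)
    refine le_trans ?_ (hmono (Nat.succ_le_of_lt i.2))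
    rw [sq]
    exact max_le_max_right _ (le_max_right _ _)

/-- The memory `m'` holds the same input as the memory `m`. -/
structure AgreesOnInput (m m' : Mem) : Prop where
  nat_rM : m'.nat rM = m.nat rM
  arr : ∀ a < aGam, m'.arr a = m.arr a

namespace AgreesOnInput

theorem refl (m : Mem) : AgreesOnInput m m :=
  ⟨rfl, fun _ _ => rfl⟩

theorem trans {m m' m'' : Mem} (h : AgreesOnInput m m') (h' : AgreesOnInput m' m'') :
    AgreesOnInput m m'' :=
  ⟨h'.nat_rM.trans h.nat_rM, fun a ha => (h'.arr a ha).trans (h.arr a ha)⟩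

theorem setNat (m : Mem) {r : ℕ} (hr : 0 ≠ r) (t : ℕ) : AgreesOnInput m (m.setNat r t) :=
  ⟨Mem.setNat_nat_of_ne _ _ hr, fun _ _ => rfl⟩

theorem setArr (m : Mem) {a : ℕ} (ha : aGam ≤ a) (i j : ℕ) (z : ℂ) :
    AgreesOnInput m (m.setArr a i j z) :=
  ⟨rfl, fun _ h => Mem.setArr_arr_of_ne _ _ _ _ (h.trans_le ha).ne⟩

theorem eval_sc {m m' : Mem} (h : AgreesOnInput m m') {a : ℕ} (ha : a < aGam) :
    (sc a).eval m' = (sc a).eval m :=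
  congrFun (congrFun (h.arr a ha) 0) 0

theorem eval_nrmOf_rM {m m' : Mem} (h : AgreesOnInput m m') :
    (nrmOf (.reg rM)).eval m' = (nrmOf (.reg rM)).eval m := by
  simp only [CExpr.eval, nrmOf, NExpr.eval, h.nat_rM, h.arr aNrm (by decide)]

end AgreesOnInput

section

variable {n : ℕ} {circ : ℕ → ℕ → Part → Circuit (n + 1)} {m : Mem} {M S K : ℕ}

theorem spec_setGammaMax {x : CExpr} {g y : ℝ} (hg : m.arr aGam 0 0 = g) (hx : x.eval m = y) :
    Spec circ (.ite (sc aGam) x (setSc aGam x) .skip) m (2 * x.cost + 7) fun m' =>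
      AgreesOnInput m m' ∧ m'.nat = m.nat ∧ m'.arr aGam 0 0 = (max g y : ℝ) := by
  have hg' : CExpr.eval m (sc aGam) = g := hg
  refine (Spec.ite (t := x.cost + 3) (fun h => ?_) fun h => ?_).mono
    (by simp [sc, CExpr.cost, NExpr.cost]; omega) fun _ h => h
  · rw [hg', hx, Complex.ofReal_re, Complex.ofReal_re] at h
    refine Spec.setSc ⟨.setArr _ le_rfl _ _ _, rfl, ?_⟩
    rw [Mem.setArr_arr_self, hx, max_eq_right h]
  · rw [hg', hx, Complex.ofReal_re, Complex.ofReal_re] at h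
    refine (Spec.skip ⟨.refl m, rfl, ?_⟩).mono (by omega) fun _ h => h
    rw [hg, max_eq_left h.le]

theorem spec_computeGamma {nrm : ℕ → ℝ} (hM : m.nat rM = M)
    (hn : ∀ e, m.arr aNrm e 0 = nrm e) :
    Spec circ computeGamma m (M * 60 + 10) fun m' =>
      AgreesOnInput m m' ∧ m'.arr aGam 0 0 = runningMax nrm M M := by
  refine Spec.seqSc (M * 60 + 2) (by simp [CExpr.cost]; omega) <|
    (Spec.loop (m := m.setArr aGam 0 0 (CExpr.eval m (.int 0))) (e := .reg rM) (k := M) (t := 59)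
      hM (fun j m' => AgreesOnInput m m' ∧ m'.arr aGam 0 0 = runningMax nrm M j)
      ⟨.setArr _ le_rfl _ _ _, by simp [runningMax, CExpr.eval]⟩ ?_).mono
    (by simp [NExpr.cost]) fun _ h => h
  rintro j - m₁ ⟨h₁, hΓ₁⟩
  replace h₁ := h₁.trans (.setNat m₁ (r := rJ) (by decide) j)
  have hx : CExpr.eval (m₁.setNat rJ j) (.mul (nrmOf (.reg rJ)) (nrmOf (.reg rM)))
      = (nrm j * nrm M : ℝ) := by
    simp [CExpr.eval, nrmOf, NExpr.eval, h₁.nat_rM, hM, h₁.arr aNrm (by decide), hn]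
  refine ((spec_setGammaMax (m := m₁.setNat rJ j) hΓ₁ hx).seq (t' := 21)
    fun m₂ ⟨h₂, hnat, hΓ₂⟩ => ?_).mono (by simp [CExpr.cost, nrmOf, NExpr.cost]) fun _ h => h
  replace h₂ := h₁.trans h₂
  have hy : CExpr.eval m₂ (nrmOf (.reg rJ)).sq = (nrm j * nrm j : ℝ) := by
    simp [CExpr.eval, CExpr.sq, nrmOf, NExpr.eval, hnat, h₂.arr aNrm (by decide), hn]
  exact (spec_setGammaMax hΓ₂ hy).mono (by simp [CExpr.cost, nrmOf, NExpr.cost, CExpr.sq])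
    fun m₃ ⟨h₃, _, hΓ₃⟩ => ⟨h₂.trans h₃, hΓ₃⟩

theorem spec_estimate (hS : m.nat rS = S) (hK : ∀ e f p, (circ e f p).size ≤ K) {e f : NExpr}
    (he : e.cost = 1) (hf : f.cost = 1) :
    Spec circ (estimate e f) m (S * (2 * K + 60) + 20) (AgreesForEstimate m) := by
  have htest : ∀ (m₁ : Mem) (p : Part), AgreesForEstimate m m₁ →
      Spec circ (.test aBit (.lit 0) (.lit 0) e f p) m₁ (K + 6) (AgreesForEstimate m) :=
    fun m₁ p h => (Spec.test fun z => h.trans (.setArr _ (.inr rfl) _ _ _)).mono (by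
      have := hK (e.eval m₁) (f.eval m₁) p
      rw [he, hf]; simp only [NExpr.cost]; omega) fun _ h => h
  refine Spec.seqSc (S * (2 * K + 60) + 16) (by simp [CExpr.cost]; omega) <|
    Spec.seqLoop (k := S) (2 * K + 59) 14 hS (fun _ => AgreesForEstimate m)
      (by simp [NExpr.cost]) (.setArr _ (.inl rfl) _ _ _) (fun t _ m₁ h => ?_) fun m' h =>
    (Spec.setSc (h.trans (.setArr _ (.inl rfl) _ _ _))).mono
      (by simp [CExpr.cost, sc, NExpr.cost]) fun _ h => h
  refine ((htest _ _ (h.trans (.setNat m₁ t))).seq fun m₂ h₂ =>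
    Spec.seqSc (t' := 16 + (K + 6) + 20) (K + 6 + 20) ?_ <|
      (htest _ _ (h₂.trans (.setArr _ (.inl rfl) _ _ _))).seq fun m₃ h₃ =>
        (Spec.setSc (h₃.trans (.setArr _ (.inl rfl) _ _ _))).mono ?_ fun _ h => h).mono
    (by omega) fun _ h => h
  · simp [CExpr.cost, sc, NExpr.cost]
    omega
  · simp [CExpr.cost, sc, NExpr.cost]

theorem spec_computeW (hM : m.nat rM = M) (hS : m.nat rS = S)
    (hK : ∀ e f p, (circ e f p).size ≤ K) :
    Spec circ computeW m (M * (M * (S * (2 * K + 60) + 40) + 20) + 5) fun m' =>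
      m'.nat rM = M ∧ m'.nat rS = S := by
  refine (Spec.loop (k := M) (t := M * (S * (2 * K + 60) + 40) + 19)
    (by simpa [NExpr.eval] using hM) (fun _ m' => m'.nat rM = M ∧ m'.nat rS = S) ⟨hM, hS⟩
    fun j _ m₁ ⟨hM₁, hS₁⟩ => ?_).mono (by simp [NExpr.cost]) fun _ h => h
  refine Spec.seqLoop (k := M) (S * (2 * K + 60) + 39) 15
    (by simpa [NExpr.eval, Mem.setNat_nat] using hM₁) (fun _ m' => m'.nat rM = M ∧ m'.nat rS = S)
    (by simp [NExpr.cost]) (by simpa [Mem.setNat_nat] using ⟨hM₁, hS₁⟩)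
    (fun k _ m₂ ⟨hM₂, hS₂⟩ => ?_) fun m₂ h =>
    (Spec.setArr h).mono (by simp [CExpr.cost, sc, NExpr.cost]) fun _ h => h
  refine ((spec_estimate (S := S) (by simpa [Mem.setNat_nat] using hS₂) hK rfl rfl).seq
    fun m₃ h₃ => Spec.setArr ⟨?_, ?_⟩).mono
      (by simp [CExpr.cost, sc, nrmOf, NExpr.cost]) fun _ h => h
  · simpa [h₃.nat, Mem.setNat_nat] using hM₂
  · simpa [h₃.nat, Mem.setNat_nat] using hS₂

theorem spec_computeQ (hM : m.nat rM = M) (hS : m.nat rS = S)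
    (hK : ∀ e f p, (circ e f p).size ≤ K) :
    Spec circ computeQ m (M * (S * (2 * K + 60) + 40) + 5) fun m' => m'.nat rM = M := by
  refine (Spec.loop (k := M) (t := S * (2 * K + 60) + 39)
    (by simpa [NExpr.eval] using hM) (fun _ m' => m'.nat rM = M ∧ m'.nat rS = S) ⟨hM, hS⟩
    fun j _ m₁ ⟨hM₁, hS₁⟩ => ?_).mono (by simp [NExpr.cost]) fun _ h => h.1
  refine ((spec_estimate (S := S) (by simpa [Mem.setNat_nat] using hS₁) hK rfl rfl).seq
    fun m₂ h₂ => Spec.setArr ⟨?_, ?_⟩).mono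
      (by simp [CExpr.cost, sc, nrmOf, NExpr.cost]) fun _ h => h
  · simpa [h₂.nat, Mem.setNat_nat] using hM₁
  · simpa [h₂.nat, Mem.setNat_nat] using hS₁

end

/-- The norms of the input vectors as they are indexed in the memory: the columns first, and the
right-hand side at index `M`. -/
def normAt {M : ℕ} (nrm : Fin M → ℝ) (nrmB : ℝ) (e : ℕ) : ℝ :=
  if h : e < M then nrm ⟨e, h⟩ else if e = M then nrmB else 0

/-- The number `T`. -/
def repetitionFactor {N M : ℕ} (A : Matrix (Fin N) (Fin M) ℂ) (b : EuclideanSpace ℂ (Fin N))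
    (nrmB ε ρ : ℝ) : ℝ :=
  ρ * (M * ‖pinv A‖ ^ 4 * (‖A‖ * ‖pinv A‖) ^ 4 * nrmB ^ 2 *
    (‖A‖ * (‖optSol A b‖ + 1) + ε) ^ 2) / ε ^ 4

/-- The number `S = ⌈Γ₁² T⌉` of repetitions of each Hadamard test. -/
def repetitions {N M : ℕ} (A : Matrix (Fin N) (Fin M) ℂ) (b : EuclideanSpace ℂ (Fin N))
    (nrm : Fin M → ℝ) (nrmB ε ρ : ℝ) : ℕ :=
  ⌈runningMax (normAt nrm nrmB) M M ^ 2 * repetitionFactor A b nrmB ε ρ⌉₊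

/-- Step 1 of the algorithm. -/
def preprocessing : Cmd := .seq computeGamma <| .seq computeLambda computeS

section

variable {n : ℕ} {circ : ℕ → ℕ → Part → Circuit (n + 1)} {N M : ℕ}
  {A : Matrix (Fin N) (Fin M) ℂ} {b : EuclideanSpace ℂ (Fin N)} {nrm : Fin M → ℝ}
  {nrmB ε ρ : ℝ} {m : Mem}

theorem normAt_coe (j : Fin M) : normAt nrm nrmB j = nrm j := by simp [normAt]

theorem normAt_self : normAt nrm nrmB M = nrmB := by simp [normAt]

theorem initMem_arr_aNrm (e : ℕ) : (initMem A b nrm nrmB ε ρ).arr aNrm e 0 = normAt nrm nrmB e := by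
  simp only [initMem, normAt]
  split_ifs <;> simp_all

theorem eval_initMem_nrmOf_rM :
    (nrmOf (.reg rM)).eval (initMem A b nrm nrmB ε ρ) = nrmB :=
  (initMem_arr_aNrm M).trans (congrArg _ normAt_self)

theorem spec_computeLambda (h : AgreesOnInput (initMem A b nrm nrmB ε ρ) m) :
    Spec circ computeLambda m 40
      (· = m.setArr aLam 0 0 (regularization A nrmB ε : ℝ)) := by
  have hε : (sc aEps).eval m = ε := h.eval_sc (by decide)
  have hA : (sc aA).eval m = (‖A‖ : ℝ) := h.eval_sc (by decide)
  have hA' : (sc aAinv).eval m = (‖pinv A‖ : ℝ) := h.eval_sc (by decide)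
  have hB : (nrmOf (.reg rM)).eval m = nrmB := h.eval_nrmOf_rM.trans eval_initMem_nrmOf_rM
  refine (Spec.setSc ?_).mono (by simp [CExpr.cost, sc, CExpr.sq, nrmOf, NExpr.cost]) fun _ h => h
  congr 1
  simp only [CExpr.eval, CExpr.sq, hε, hA, hA', hB, regularization]
  push_cast
  ring

theorem eval_exprT (h : AgreesOnInput (initMem A b nrm nrmB ε ρ) m) :
    exprT.eval m = (repetitionFactor A b nrmB ε ρ : ℝ) := by
  have hρ : (sc aRho).eval m = ρ := h.eval_sc (by decide)
  have hM : m.nat rM = M := h.nat_rM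
  have hA' : (sc aAinv).eval m = (‖pinv A‖ : ℝ) := h.eval_sc (by decide)
  have hA : (sc aA).eval m = (‖A‖ : ℝ) := h.eval_sc (by decide)
  have hB : (nrmOf (.reg rM)).eval m = nrmB := h.eval_nrmOf_rM.trans eval_initMem_nrmOf_rM
  have hx : (sc aXs).eval m = (‖optSol A b‖ : ℝ) := h.eval_sc (by decide)
  have hε : (sc aEps).eval m = ε := h.eval_sc (by decide)
  simp only [exprT, CExpr.eval, CExpr.sq, NExpr.eval, hρ, hM, hA', hA, hB, hx, hε,
    repetitionFactor]
  push_cast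
  ring

theorem spec_computeS (h : AgreesOnInput (initMem A b nrm nrmB ε ρ) m)
    (hΓ : m.arr aGam 0 0 = runningMax (normAt nrm nrmB) M M) :
    Spec circ computeS m (repetitions A b nrm nrmB ε ρ + 150)
      (· = m.setNat rS (repetitions A b nrm nrmB ε ρ)) := by
  have hS : (CExpr.eval m (.mul (sc aGam).sq exprT)).re
      = runningMax (normAt nrm nrmB) M M ^ 2 * repetitionFactor A b nrmB ε ρ := by
    have hΓ' : (sc aGam).eval m = _ := hΓ
    simp only [CExpr.eval, CExpr.sq, hΓ', eval_exprT h]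
    rw [← sq]
    norm_cast
  refine (Spec.ceil ?_).mono ?_ fun _ h => h
  · rw [hS, repetitions]
  · rw [hS]
    simp [exprT, CExpr.cost, sc, CExpr.sq, nrmOf, NExpr.cost, repetitions]

theorem spec_preprocessing : Spec circ preprocessing (initMem A b nrm nrmB ε ρ)
    (M * 60 + repetitions A b nrm nrmB ε ρ + 200)
    (IsReady M (repetitions A b nrm nrmB ε ρ) (normAt nrm nrmB) (regularization A nrmB ε)) := by
  refine ((spec_computeGamma (M := M) rfl initMem_arr_aNrm).seq fun m₁ ⟨h, hΓ⟩ =>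
    (spec_computeLambda h).seq ?_).mono (t := M * 60 + 10 +
      (40 + (repetitions A b nrm nrmB ε ρ + 150))) (by omega) fun _ h => h
  rintro _ rfl
  have h₂ := h.trans (.setArr m₁ (a := aLam) (by decide) 0 0 (regularization A nrmB ε : ℝ))
  refine (spec_computeS h₂ hΓ).mono le_rfl ?_
  rintro _ rfl
  have h₃ := h₂.trans (.setNat _ (r := rS) (by decide) (repetitions A b nrm nrmB ε ρ))
  exact ⟨h₃.nat_rM, Mem.setNat_nat_self _ _ _,
    fun e => by rw [h₃.arr _ (by decide), initMem_arr_aNrm],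
    by rw [Mem.setNat_arr, Mem.setArr_arr_self]⟩

end

/-! ### The quantum access model -/

theorem sum_pad {N : ℕ} {α : Type*} [AddCommMonoid α] (F : ℂ → ℂ → α) (hF : F 0 0 = 0)
    (v w : Fin N → ℂ) : ∑ x, F (pad v x) (pad w x) = ∑ i, F (v i) (w i) := by
  have hN : N ≤ 2 ^ Nat.clog 2 N := Nat.le_pow_clog (by norm_num) N
  let e (i : Fin N) : Basis (Nat.clog 2 N) := finFunctionFinEquiv.symm ⟨i, i.2.trans_le hN⟩
  have he (i : Fin N) : (finFunctionFinEquiv (e i) : ℕ) = i := by simp [e]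
  have hpad (u : Fin N → ℂ) (i : Fin N) : pad u (e i) = u i := by
    rw [pad, dif_pos (by rw [he]; exact i.2)]
    exact congrArg u (Fin.ext (he i))
  refine (Fintype.sum_of_injective e (fun i j h => ?_) _ _ (fun x hx => ?_) fun i => ?_).symm
  · rw [Fin.ext_iff, ← he i, ← he j, h]
  · have hx' : ¬ (finFunctionFinEquiv x : ℕ) < N := fun h =>
      hx ⟨⟨_, h⟩, finFunctionFinEquiv.symm_apply_apply x⟩
    rw [pad, pad, dif_neg hx', dif_neg hx', hF]
  · rw [hpad, hpad]

theorem Circuit.sum_norm_sq_state {n : ℕ} (c : Circuit n) : ∑ x, ‖c.state x‖ ^ 2 = 1 := by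
  rw [← ENNReal.ofReal_eq_one, ENNReal.ofReal_sum_of_nonneg fun _ _ => sq_nonneg _, c.sum_state]

theorem norm_eq_of_pad {N : ℕ} {v : Fin N → ℂ} {r : ℝ} (hr : 0 ≤ r) {c : Circuit (Nat.clog 2 N)}
    (h : ∀ x, pad v x = r * c.state x) : r = ‖(WithLp.toLp 2 v : EuclideanSpace ℂ (Fin N))‖ := by
  have hsum : ∑ x, ‖pad v x‖ ^ 2 = ∑ i, ‖v i‖ ^ 2 := sum_pad (fun z _ => ‖z‖ ^ 2) (by simp) v v
  simp only [h, norm_mul, mul_pow, ← Finset.mul_sum, c.sum_norm_sq_state, Complex.norm_real,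
    Real.norm_eq_abs, sq_abs, mul_one] at hsum
  rw [← sq_eq_sq₀ hr (norm_nonneg _), hsum, EuclideanSpace.norm_sq_eq]

/-- The amplitude `⟨0|U₁ᴴ U₂|0⟩`. -/
def overlap {n : ℕ} (c₁ c₂ : Circuit n) : ℂ := (c₁.mat.conjTranspose * c₂.mat) 0 0

theorem mul_overlap {N : ℕ} {v w : Fin N → ℂ} {r s : ℝ} {c₁ c₂ : Circuit (Nat.clog 2 N)}
    (h₁ : ∀ x, pad v x = r * c₁.state x) (h₂ : ∀ x, pad w x = s * c₂.state x) :
    (r * s : ℝ) * overlap c₁ c₂ = ∑ i, star (v i) * w i := by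
  rw [← sum_pad (fun z z' => star z * z') (by simp) v w, overlap, Matrix.mul_apply, Finset.mul_sum]
  refine Finset.sum_congr rfl fun x _ => ?_
  rw [h₁, h₂, Matrix.conjTranspose_apply, star_mul', Circuit.state, Circuit.state]
  simp only [RCLike.star_def, Complex.conj_ofReal, Complex.ofReal_mul]
  ring

/-! ### Concentration of the estimated system -/

theorem sub_le_sum_deviation {ι : Type*} [Fintype ι] {S : ℕ} {α v z : ι → ℂ} {r : ι → ℝ} {Γ s : ℝ}
    (hr : ∀ i, |r i| ≤ Γ) (hα : ∑ i, ‖α i‖ ^ 2 ≤ s ^ 2) :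
    (∑ i, α i * (z i - r i * v i)).re - s ^ 2 * Γ ^ 2 / (2 * S)
      ≤ ∑ i, deviation S (α i) (r i) (v i) (z i) := by
  simp only [deviation, Finset.sum_sub_distrib, Complex.re_sum, ← Finset.sum_div]
  gcongr
  calc ∑ i, (‖α i‖ * r i) ^ 2 ≤ ∑ i, ‖α i‖ ^ 2 * Γ ^ 2 := by
        refine Finset.sum_le_sum fun i _ => ?_
        rw [mul_pow, ← sq_abs (r i)]
        gcongr
        exact hr i
    _ ≤ s ^ 2 * Γ ^ 2 := by
        rw [← Finset.sum_mul]
        gcongr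

theorem inner_toEuclideanLin_eq_sum {ι : Type*} [Fintype ι] [DecidableEq ι]
    (u w : EuclideanSpace ℂ ι) (E : Matrix ι ι ℂ) : inner ℂ u (Matrix.toEuclideanLin E w)
      = ∑ p : ι × ι, star (u p.1) * w p.2 * E p.1 p.2 := by
  rw [PiLp.inner_apply, Fintype.sum_prod_type]
  refine Finset.sum_congr rfl fun j _ => ?_
  rw [RCLike.inner_apply, Matrix.ofLp_toLpLin, Matrix.toLin'_apply, Matrix.mulVec, dotProduct,
    Finset.sum_mul]
  refine Finset.sum_congr rfl fun k _ => ?_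
  rw [RCLike.star_def]
  ring

section

variable {M S : ℕ} {nrm : ℕ → ℝ} {μ : ℂ} {v : ℕ → ℕ → ℂ} {Γ : ℝ} {m : Mem}
  {u w : EuclideanSpace ℂ (Fin M)}

theorem sub_le_deviationW (hu : ‖u‖ ≤ 1) (hw : ‖w‖ ≤ 1)
    (hΓ : ∀ j < M, ∀ k ≤ M, |nrm j * nrm k| ≤ Γ) {E : Matrix (Fin M) (Fin M) ℂ}
    (hE : ∀ j k : Fin M, E j k = (m.arr aW j k - if j = k then μ else 0)
      - (nrm j * nrm k : ℝ) * v j k) (s : ℝ) :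
    s * (inner ℂ u (Matrix.toEuclideanLin E w)).re - s ^ 2 * Γ ^ 2 / (2 * S) ≤
      deviationW M S nrm μ v (fun j k => s * (star (Function.extend Fin.val u 0 j) *
        Function.extend Fin.val w 0 k)) m M := by
  have hnorm : ∑ p : Fin M × Fin M, ‖(s * (star (u p.1) * w p.2) : ℂ)‖ ^ 2 ≤ s ^ 2 :=
    calc ∑ p : Fin M × Fin M, ‖(s * (star (u p.1) * w p.2) : ℂ)‖ ^ 2
        = s ^ 2 * (‖u‖ * ‖w‖) ^ 2 := by
          rw [mul_pow, EuclideanSpace.norm_sq_eq, EuclideanSpace.norm_sq_eq, Finset.sum_mul_sum,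
            ← Fintype.sum_prod_type', Finset.mul_sum]
          simp [mul_pow]
      _ ≤ s ^ 2 := mul_le_of_le_one_right (sq_nonneg _)
          (pow_le_one₀ (by positivity) (mul_le_one₀ hu (norm_nonneg _) hw))
  refine le_trans (le_of_eq ?_) ((sub_le_sum_deviation (S := S) (v := fun p => v p.1 p.2)
    (z := fun p => m.arr aW p.1 p.2 - if p.1 = p.2 then μ else 0) (r := fun p => nrm p.1 * nrm p.2)
    (fun p => hΓ p.1 p.1.2 p.2 p.2.2.le) hnorm).trans (le_of_eq ?_))
  · rw [inner_toEuclideanLin_eq_sum, ← Complex.re_ofReal_mul, Finset.mul_sum]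
    simp only [hE, mul_assoc]
  · simp [deviationW, Fintype.sum_prod_type, Finset.sum_range, Fin.ext_iff,
      Fin.val_injective.extend_apply]

theorem sub_le_deviationQ (hu : ‖u‖ ≤ 1) (hΓ : ∀ j < M, ∀ k ≤ M, |nrm j * nrm k| ≤ Γ)
    {f : EuclideanSpace ℂ (Fin M)}
    (hf : ∀ j : Fin M, f j = m.arr aQ j 0 - (nrm j * nrm M : ℝ) * v j M) (s : ℝ) :
    s * (inner ℂ u f).re - s ^ 2 * Γ ^ 2 / (2 * S) ≤
      deviationQ M S nrm v (fun j => s * star (Function.extend Fin.val u 0 j)) m M := by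
  have hnorm : ∑ j, ‖(s * star (u j) : ℂ)‖ ^ 2 ≤ s ^ 2 :=
    calc ∑ j, ‖(s * star (u j) : ℂ)‖ ^ 2 = s ^ 2 * ‖u‖ ^ 2 := by
          rw [EuclideanSpace.norm_sq_eq, Finset.mul_sum]
          simp [mul_pow]
      _ ≤ s ^ 2 := mul_le_of_le_one_right (sq_nonneg _) (pow_le_one₀ (norm_nonneg _) hu)
  refine le_trans (le_of_eq ?_) ((sub_le_sum_deviation (S := S) (v := fun j : Fin M => v j M)
    (z := fun j : Fin M => m.arr aQ j 0) (r := fun j : Fin M => nrm j * nrm M)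
    (fun j => hΓ j j.2 M le_rfl) hnorm).trans (le_of_eq ?_))
  · rw [PiLp.inner_apply, ← Complex.re_ofReal_mul, Finset.mul_sum]
    simp only [RCLike.inner_apply, hf, RCLike.star_def]
    congr 2
    exact Finset.sum_congr rfl fun j _ => by ring
  · simp [deviationQ, Finset.sum_range, Fin.val_injective.extend_apply]

theorem deviationW_zero (j : ℕ) : deviationW M S nrm μ v (fun _ _ => 0) m j = 0 := by
  simp [deviationW, deviation]

theorem deviationQ_zero (j : ℕ) : deviationQ M S nrm v (fun _ => 0) m j = 0 := by
  simp [deviationQ, deviation]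

end

theorem expect_indicator_one {α : Type*} (p : PMF α) (B : Set α) :
    expect p (B.indicator 1) = p.toOuterMeasure B := by
  rw [expect, PMF.toOuterMeasure_apply]
  refine tsum_congr fun a => ?_
  by_cases h : a ∈ B <;> simp [h]

theorem toOuterMeasure_add_expect_indicator_compl {α : Type*} (p : PMF α) (B : Set α) :
    p.toOuterMeasure B + expect p (Bᶜ.indicator 1) = 1 := by
  rw [← expect_indicator_one, ← expect_add, ← expect_const p 1]
  congr 1
  exact Set.indicator_self_add_compl B (1 : α → ENNReal)

section

variable {n : ℕ} {circ : ℕ → ℕ → Part → Circuit (n + 1)} {c : Cmd} {m : Mem}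

theorem wp_indicator_one (B : Set Mem) :
    wp circ c (B.indicator 1) m = ((run circ c m).map Prod.fst).toOuterMeasure B := by
  rw [← expect_indicator_one, expect_map, wp]

theorem wp_indicator_le_of_wp_exp_le_one {X : Mem → ℝ}
    (h : wp circ c (fun m' => ENNReal.ofReal (Real.exp (X m'))) m ≤ 1) {B : Set Mem} {x : ℝ}
    (hB : ∀ m' ∈ B, x ≤ X m') :
    wp circ c (B.indicator 1) m ≤ ENNReal.ofReal (Real.exp (-x)) :=
  calc wp circ c (B.indicator 1) m
      ≤ wp circ c (fun m' => ENNReal.ofReal (Real.exp (-x)) * ENNReal.ofReal (Real.exp (X m'))) m :=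
        wp_mono fun m' => by
          by_cases hm' : m' ∈ B
          · rw [Set.indicator_of_mem hm', ← ENNReal.ofReal_mul (Real.exp_pos _).le, ← Real.exp_add,
              Pi.one_apply, ENNReal.one_le_ofReal]
            exact Real.one_le_exp (by linarith [hB m' hm'])
          · simp only [Set.indicator_of_notMem hm', zero_le]
    _ ≤ ENNReal.ofReal (Real.exp (-x)) := by
        rw [wp, expect_const_mul]
        exact mul_le_of_le_one_right' h

end

section

variable {n : ℕ} {circ : ℕ → ℕ → Part → Circuit (n + 1)} {M S : ℕ} {nrm : ℕ → ℝ} {μ : ℂ}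
  {v : ℕ → ℕ → ℂ} {Γ : ℝ} {m : Mem} {W : Matrix (Fin M) (Fin M) ℂ}
  {q u w : EuclideanSpace ℂ (Fin M)}

theorem sq_mul_div_le_of_lt {Γ S t y : ℝ} (hΓ0 : 0 < Γ) (hS : 0 < S) (ht : 0 ≤ t) (h : t < y) :
    t ^ 2 * S / (2 * Γ ^ 2) ≤ t * S / Γ ^ 2 * y - (t * S / Γ ^ 2) ^ 2 * Γ ^ 2 / (2 * S) :=
  calc t ^ 2 * S / (2 * Γ ^ 2)
      = t * S / Γ ^ 2 * t - (t * S / Γ ^ 2) ^ 2 * Γ ^ 2 / (2 * S) := by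
        field_simp
        ring
    _ ≤ _ := by gcongr

theorem wp_indicator_lt_inner_matW_le (hS : 0 < S) (hΓ0 : 0 < Γ)
    (hbias : ∀ j < M, ∀ k ≤ M, ∀ p, (circ j k p).bias = (p.phase * v j k).re)
    (hΓ : ∀ j < M, ∀ k ≤ M, |nrm j * nrm k| ≤ Γ) (hm : IsReady M S nrm μ m)
    (hW : ∀ j k : Fin M, W j k = (nrm j * nrm k : ℝ) * v j k + if j = k then μ else 0)
    {t : ℝ} (ht : 0 ≤ t) (hu : ‖u‖ ≤ 1) (hw : ‖w‖ ≤ 1) :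
    wp circ (.seq computeW computeQ)
      ({m' | t < (inner ℂ u (Matrix.toEuclideanLin (m'.matW M - W) w)).re}.indicator 1) m ≤
      ENNReal.ofReal (Real.exp (-(t ^ 2 * S / (2 * Γ ^ 2)))) := by
  refine wp_indicator_le_of_wp_exp_le_one (wp_estimates_le hS hbias
    (fun j k => (t * S / Γ ^ 2 : ℝ) * (star (Function.extend Fin.val u 0 j) *
      Function.extend Fin.val w 0 k)) (fun _ => 0) hm) fun m' hm' => ?_
  rw [deviationQ_zero, add_zero]
  refine (sq_mul_div_le_of_lt hΓ0 (Nat.cast_pos.2 hS) ht hm').trans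
    (sub_le_deviationW hu hw hΓ (fun j k => ?_) _)
  rw [Matrix.sub_apply, hW, Mem.matW, Matrix.of_apply]
  ring

theorem wp_indicator_lt_inner_vecQ_le (hS : 0 < S) (hΓ0 : 0 < Γ)
    (hbias : ∀ j < M, ∀ k ≤ M, ∀ p, (circ j k p).bias = (p.phase * v j k).re)
    (hΓ : ∀ j < M, ∀ k ≤ M, |nrm j * nrm k| ≤ Γ) (hm : IsReady M S nrm μ m)
    (hq : ∀ j : Fin M, q j = (nrm j * nrm M : ℝ) * v j M) {t : ℝ} (ht : 0 ≤ t) (hu : ‖u‖ ≤ 1) :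
    wp circ (.seq computeW computeQ)
      ({m' | t < (inner ℂ u (WithLp.toLp 2 (m'.vecQ M) - q)).re}.indicator 1) m ≤
      ENNReal.ofReal (Real.exp (-(t ^ 2 * S / (2 * Γ ^ 2)))) := by
  refine wp_indicator_le_of_wp_exp_le_one (wp_estimates_le hS hbias (fun _ _ => 0)
    (fun j => (t * S / Γ ^ 2 : ℝ) * star (Function.extend Fin.val u 0 j)) hm) fun m' hm' => ?_
  rw [deviationW_zero, zero_add]
  refine (sq_mul_div_le_of_lt hΓ0 (Nat.cast_pos.2 hS) ht hm').trans
    (sub_le_deviationQ hu hΓ (fun j => ?_) _)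
  rw [PiLp.sub_apply, hq]
  rfl

theorem exists_finset_norm_le_of_inner_le (M : ℕ) :
    ∃ s : Finset (EuclideanSpace ℂ (Fin M)), s.card ≤ 25 ^ M ∧ (∀ u ∈ s, ‖u‖ ≤ 1) ∧
      ∀ (t : ℝ) (E : Matrix (Fin M) (Fin M) ℂ) (f : EuclideanSpace ℂ (Fin M)),
        (∀ p ∈ s ×ˢ s, (inner ℂ p.1 (Matrix.toEuclideanLin E p.2)).re ≤ t) →
        (∀ u ∈ s, (inner ℂ u f).re ≤ t) → ‖E‖ ≤ 4 * t ∧ ‖f‖ ≤ 4 * t := by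
  obtain ⟨s, hcard, hball, hcover⟩ := exists_finset_isCover_closedBall (EuclideanSpace ℂ (Fin M))
  refine ⟨s, hcard.trans_eq ?_, fun u hu => mem_closedBall_zero_iff.1 (hball hu),
    fun t E f hE hf => ⟨?_, ?_⟩⟩
  · rw [finrank_real_of_complex, finrank_euclideanSpace, Fintype.card_fin, pow_mul]
    norm_num
  · rw [Matrix.l2_opNorm_def]
    exact opNorm_le_of_isCover hcover hcover fun u hu w hw =>
      hE (u, w) (Finset.mk_mem_product hu hw)
  · have hf' := norm_le_of_isCover hcover hf
    linarith [norm_nonneg f]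

theorem wp_indicator_compl_error_le (hS : 0 < S) (hΓ0 : 0 < Γ)
    (hbias : ∀ j < M, ∀ k ≤ M, ∀ p, (circ j k p).bias = (p.phase * v j k).re)
    (hΓ : ∀ j < M, ∀ k ≤ M, |nrm j * nrm k| ≤ Γ) (hm : IsReady M S nrm μ m)
    (hW : ∀ j k : Fin M, W j k = (nrm j * nrm k : ℝ) * v j k + if j = k then μ else 0)
    (hq : ∀ j : Fin M, q j = (nrm j * nrm M : ℝ) * v j M) {t : ℝ} (ht : 0 ≤ t) :
    wp circ (.seq computeW computeQ)
      ({m' | ‖m'.matW M - W‖ ≤ 4 * t ∧ ‖WithLp.toLp 2 (m'.vecQ M) - q‖ ≤ 4 * t}ᶜ.indicator 1) m ≤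
      ENNReal.ofReal (2 * 625 ^ M * Real.exp (-(t ^ 2 * S / (2 * Γ ^ 2)))) := by
  obtain ⟨s, hcard, hs, hnorm⟩ := exists_finset_norm_le_of_inner_le M
  set η := ENNReal.ofReal (Real.exp (-(t ^ 2 * S / (2 * Γ ^ 2)))) with hη
  let badW (p : EuclideanSpace ℂ (Fin M) × EuclideanSpace ℂ (Fin M)) : Set Mem :=
    {m' | t < (inner ℂ p.1 (Matrix.toEuclideanLin (m'.matW M - W) p.2)).re}
  let badQ (u : EuclideanSpace ℂ (Fin M)) : Set Mem :=
    {m' | t < (inner ℂ u (WithLp.toLp 2 (m'.vecQ M) - q)).re}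
  have hsub : {m' : Mem | ‖m'.matW M - W‖ ≤ 4 * t ∧ ‖WithLp.toLp 2 (m'.vecQ M) - q‖ ≤ 4 * t}ᶜ ⊆
      (⋃ p ∈ s ×ˢ s, badW p) ∪ ⋃ u ∈ s, badQ u := by
    refine Set.compl_subset_comm.1 fun m' hm' => ?_
    simp only [Set.compl_union, Set.compl_iUnion, Set.mem_inter_iff, Set.mem_iInter,
      Set.mem_compl_iff, badW, badQ, Set.mem_ofPred_eq, not_lt] at hm'
    exact hnorm t _ _ hm'.1 hm'.2
  have hbadW : ∀ p ∈ s ×ˢ s, wp circ (.seq computeW computeQ) ((badW p).indicator 1) m ≤ η :=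
    fun p hp => wp_indicator_lt_inner_matW_le hS hΓ0 hbias hΓ hm hW ht
      (hs _ (Finset.mem_product.1 hp).1) (hs _ (Finset.mem_product.1 hp).2)
  have hbadQ : ∀ u ∈ s, wp circ (.seq computeW computeQ) ((badQ u).indicator 1) m ≤ η :=
    fun u hu => wp_indicator_lt_inner_vecQ_le hS hΓ0 hbias hΓ hm hq ht (hs u hu)
  simp only [wp_indicator_one] at hbadW hbadQ ⊢
  calc _ ≤ _ := (MeasureTheory.measure_mono hsub).trans (MeasureTheory.measure_union_le _ _)
    _ ≤ ∑ _p ∈ s ×ˢ s, η + ∑ _u ∈ s, η := by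
        gcongr
        · exact (MeasureTheory.measure_biUnion_finset_le _ _).trans (Finset.sum_le_sum hbadW)
        · exact (MeasureTheory.measure_biUnion_finset_le _ _).trans (Finset.sum_le_sum hbadQ)
    _ = ((s.card * s.card + s.card : ℕ) : ENNReal) * η := by
        simp only [Finset.sum_const, Finset.card_product, nsmul_eq_mul, Nat.cast_add, add_mul]
    _ ≤ ((2 * 625 ^ M : ℕ) : ENNReal) * η := by
        gcongr
        calc s.card * s.card + s.card ≤ 25 ^ M * 25 ^ M + 25 ^ M * 25 ^ M := by
              gcongr
              exact hcard.trans (Nat.le_mul_of_pos_left _ (by positivity))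
          _ = 2 * 625 ^ M := by
            rw [← mul_pow, two_mul]
            norm_num
    _ = _ := by
        rw [hη, ENNReal.ofReal_mul (by positivity), ← ENNReal.ofReal_natCast]
        norm_num

theorem IsLinearSolver.spec {solve : Cmd} {C : ℝ} (h : IsLinearSolver solve C)
    (hM : m.nat rM = M) : Spec circ solve m ⌈C * ((M : ℝ) ^ 3 + 1)⌉₊ fun m' =>
      IsUnit (m.matW M).det → m'.vecX M = (m.matW M)⁻¹.mulVec (m.vecQ M) := fun r hr =>
  ⟨by exact_mod_cast (h.2 n circ m M hM r hr).1.trans (Nat.le_ceil _), (h.2 n circ m M hM r hr).2⟩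

theorem wp_solve_indicator_le {solve : Cmd} {C : ℝ} (hsolve : IsLinearSolver solve C)
    (hM : m.nat rM = M) {P : EuclideanSpace ℂ (Fin M) → Prop} {t : ℝ}
    (hP : ∀ (E : Matrix (Fin M) (Fin M) ℂ) (f : EuclideanSpace ℂ (Fin M)), ‖E‖ ≤ t → ‖f‖ ≤ t →
      IsUnit (W + E).det ∧ ∀ x, Matrix.toEuclideanLin (W + E) x = q + f → P x) :
    wp circ solve ({m' | P (WithLp.toLp 2 (m'.vecX M))}ᶜ.indicator 1) m ≤
      {m' : Mem | ‖m'.matW M - W‖ ≤ t ∧ ‖WithLp.toLp 2 (m'.vecQ M) - q‖ ≤ t}ᶜ.indicator 1 m := by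
  by_cases hm : ‖m.matW M - W‖ ≤ t ∧ ‖WithLp.toLp 2 (m.vecQ M) - q‖ ≤ t
  · obtain ⟨hunit, hsol⟩ := hP _ _ hm.1 hm.2
    rw [add_sub_cancel] at hunit
    rw [add_sub_cancel, add_sub_cancel] at hsol
    refine ((hsolve.spec hM).wp_le (K := 0) fun m' hm' => ?_).trans zero_le
    refine (Set.indicator_of_notMem (Set.notMem_compl_iff.2 (hsol _ ?_)) 1).le
    rw [Matrix.toLpLin_toLp, Matrix.toLin'_apply, hm' hunit, Matrix.mulVec_mulVec,
      Matrix.mul_nonsing_inv _ hunit, Matrix.one_mulVec]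
  · rw [Set.indicator_of_mem hm]
    refine (hsolve.spec hM).wp_le fun m' _ => ?_
    exact Set.indicator_le_self (M := ENNReal) _ _ m'

theorem wp_estimate_solve_le {solve : Cmd} {C : ℝ} (hsolve : IsLinearSolver solve C)
    (hS : 0 < S) (hΓ0 : 0 < Γ)
    (hbias : ∀ j < M, ∀ k ≤ M, ∀ p, (circ j k p).bias = (p.phase * v j k).re)
    (hΓ : ∀ j < M, ∀ k ≤ M, |nrm j * nrm k| ≤ Γ) (hm : IsReady M S nrm μ m) {K : ℕ}
    (hK : ∀ j k p, (circ j k p).size ≤ K)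
    (hW : ∀ j k : Fin M, W j k = (nrm j * nrm k : ℝ) * v j k + if j = k then μ else 0)
    (hq : ∀ j : Fin M, q j = (nrm j * nrm M : ℝ) * v j M)
    {P : EuclideanSpace ℂ (Fin M) → Prop} {t : ℝ} (ht : 0 ≤ t)
    (hP : ∀ (E : Matrix (Fin M) (Fin M) ℂ) (f : EuclideanSpace ℂ (Fin M)), ‖E‖ ≤ 4 * t →
      ‖f‖ ≤ 4 * t → IsUnit (W + E).det ∧ ∀ x, Matrix.toEuclideanLin (W + E) x = q + f → P x) :
    wp circ (.seq (.seq computeW computeQ) solve)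
      ({m' | P (WithLp.toLp 2 (m'.vecX M))}ᶜ.indicator 1) m ≤
      ENNReal.ofReal (2 * 625 ^ M * Real.exp (-(t ^ 2 * S / (2 * Γ ^ 2)))) := by
  have hspec := (spec_computeW hm.rM hm.rS hK).seq fun _ h₁ => spec_computeQ h₁.1 h₁.2 hK
  rw [wp_seq]
  exact (hspec.wp_mono fun m' hM => wp_solve_indicator_le hsolve hM hP).trans
    (wp_indicator_compl_error_le hS hΓ0 hbias hΓ hm hW hq ht)

end

/-! ### Analysis of the algorithm -/

theorem IsLinearSolver.mono {solve : Cmd} {C C' : ℝ} (h : IsLinearSolver solve C) (hC : C ≤ C') :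
    IsLinearSolver solve C' :=
  ⟨h.1, fun n circ m M hM r hr => ⟨(h.2 n circ m M hM r hr).1.trans
    (mul_le_mul_of_nonneg_right hC (by positivity)), (h.2 n circ m M hM r hr).2⟩⟩

theorem IsHadamardCompiler.mono {comp : ∀ n : ℕ, Circuit n → Circuit n → Part → Circuit (n + 1)}
    {C C' : ℝ} (h : IsHadamardCompiler comp C) (hC : C ≤ C') : IsHadamardCompiler comp C' :=
  fun n c₁ c₂ p => ⟨(h n c₁ c₂ p).1, (h n c₁ c₂ p).2.trans
    (mul_le_mul_of_nonneg_right hC (by positivity))⟩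

section

variable {N M : ℕ} {A : Matrix (Fin N) (Fin M) ℂ} {b : EuclideanSpace ℂ (Fin N)}
  {nrm : Fin M → ℝ} {U : Fin M → Circuit (Nat.clog 2 N)} {nrmB : ℝ} {Ub : Circuit (Nat.clog 2 N)}
  {d : ℕ} {ε ρ : ℝ}

theorem ColumnAccess.norm_eq (h : ColumnAccess A nrm U d) (j : Fin M) : nrm j = ‖column A j‖ :=
  norm_eq_of_pad (h.nonneg j) (h.column_eq j)

theorem VectorAccess.norm_eq (h : VectorAccess b nrmB Ub d) : nrmB = ‖b‖ :=
  norm_eq_of_pad h.pos.le h.vector_eq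

theorem VectorAccess.ne_zero (h : VectorAccess b nrmB Ub d) : b ≠ 0 :=
  norm_pos_iff.1 (h.norm_eq ▸ h.pos)

theorem pos_of_ne_zero (hA : A ≠ 0) : 0 < M := by
  obtain ⟨_, j, _⟩ : ∃ i j, A i j ≠ 0 := by
    by_contra! h
    exact hA (Matrix.ext h)
  exact j.pos

theorem max_le_Gamma1 (j : Fin M) : max (‖column A j‖ * ‖b‖) (‖column A j‖ ^ 2) ≤ Gamma1 A b :=
  le_ciSup (f := fun j : Fin M => max (‖column A j‖ * ‖b‖) (‖column A j‖ ^ 2))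
    (Set.finite_range _).bddAbove j

theorem Gamma1_pos (hA : A ≠ 0) : 0 < Gamma1 A b := by
  obtain ⟨j, hj⟩ : ∃ j, column A j ≠ 0 := by
    by_contra! h
    exact hA (Matrix.ext fun i j => congrArg (fun v : EuclideanSpace ℂ (Fin N) => v i) (h j))
  exact (pow_pos (norm_pos_iff.2 hj) 2).trans_le ((le_max_right _ _).trans (max_le_Gamma1 j))

theorem runningMax_eq_Gamma1 (hM : 0 < M) (hU : ColumnAccess A nrm U d)
    (hb : VectorAccess b nrmB Ub d) : runningMax (normAt nrm nrmB) M M = Gamma1 A b := by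
  rw [runningMax_eq_iSup hM, Gamma1]
  simp only [normAt_coe, normAt_self, hU.norm_eq, hb.norm_eq]

theorem abs_normAt_mul_normAt_le (hU : ColumnAccess A nrm U d) (hb : VectorAccess b nrmB Ub d)
    {j k : ℕ} (hj : j < M) (hk : k ≤ M) :
    |normAt nrm nrmB j * normAt nrm nrmB k| ≤ Gamma1 A b := by
  have hcol (i : Fin M) : normAt nrm nrmB i = ‖column A i‖ := (normAt_coe i).trans (hU.norm_eq i)
  lift j to Fin M using hj
  rcases hk.lt_or_eq with hk | rfl
  · lift k to Fin M using hk
    have hsq (i : Fin M) : ‖column A i‖ ^ 2 ≤ Gamma1 A b := (max_le_iff.1 (max_le_Gamma1 i)).2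
    rw [hcol, hcol, abs_of_nonneg (by positivity)]
    linarith [two_mul_le_add_sq ‖column A j‖ ‖column A k‖, hsq j, hsq k]
  · rw [hcol, normAt_self, hb.norm_eq, abs_of_nonneg (by positivity)]
    exact (max_le_iff.1 (max_le_Gamma1 j)).1

/-! ### The test circuits -/

/-- The circuit number `e`: it prepares column `e` if `e < M`, and `b` otherwise. -/
def circuitAt {n : ℕ} (U : Fin M → Circuit n) (Ub : Circuit n) (e : ℕ) : Circuit n :=
  if h : e < M then U ⟨e, h⟩ else Ub

theorem circuitAt_coe {n : ℕ} (U : Fin M → Circuit n) (Ub : Circuit n) (j : Fin M) :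
    circuitAt U Ub j = U j := by simp [circuitAt]

theorem circuitAt_self {n : ℕ} (U : Fin M → Circuit n) (Ub : Circuit n) :
    circuitAt U Ub M = Ub := by simp [circuitAt]

variable {comp : ∀ n : ℕ, Circuit n → Circuit n → Part → Circuit (n + 1)}

theorem bias_testCircuit {C : ℝ} (hcomp : IsHadamardCompiler comp C) {n : ℕ}
    (U : Fin M → Circuit n) (Ub : Circuit n) (e f : ℕ) (p : Part) :
    (testCircuit comp U Ub e f p).bias =
      (p.phase * overlap (circuitAt U Ub e) (circuitAt U Ub f)).re :=
  Circuit.bias_of_mat_eq_hadamardTest (hcomp n _ _ p).1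

theorem size_testCircuit_le {C : ℕ} (hcomp : IsHadamardCompiler comp C)
    (hU : ColumnAccess A nrm U d) (hb : VectorAccess b nrmB Ub d) (e f : ℕ) (p : Part) :
    (testCircuit comp U Ub e f p).size ≤ C * (2 * (d * Nat.clog 2 N) + 1) := by
  have hdepth (e : ℕ) : (circuitAt U Ub e).depth ≤ d := by
    rw [circuitAt]
    split_ifs
    exacts [hU.depth_le _, hb.depth_le]
  have hsize (e : ℕ) : (circuitAt U Ub e).size ≤ d * Nat.clog 2 N :=
    (Circuit.size_le _).trans (Nat.mul_le_mul_right _ (hdepth e))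
  have hle : (testCircuit comp U Ub e f p).size ≤
      C * ((circuitAt U Ub e).size + (circuitAt U Ub f).size + 1) := by
    exact_mod_cast (hcomp _ (circuitAt U Ub e) (circuitAt U Ub f) p).2
  refine hle.trans (Nat.mul_le_mul_left _ ?_)
  linarith [hsize e, hsize f]

theorem regularizedGram_apply_eq_overlap (hU : ColumnAccess A nrm U d) (μ : ℝ) (j k : Fin M) :
    regularizedGram A μ j k = (normAt nrm nrmB j * normAt nrm nrmB k : ℝ) *
      overlap (circuitAt U Ub j) (circuitAt U Ub k) + if j = k then (μ : ℂ) else 0 := by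
  rw [normAt_coe, normAt_coe, circuitAt_coe, circuitAt_coe,
    mul_overlap (hU.column_eq j) (hU.column_eq k)]
  simp [regularizedGram, Matrix.mul_apply, Matrix.one_apply]

theorem toEuclideanLin_conjTranspose_apply_eq_overlap (hU : ColumnAccess A nrm U d)
    (hb : VectorAccess b nrmB Ub d) (j : Fin M) :
    Matrix.toEuclideanLin A.conjTranspose b j = (normAt nrm nrmB j * normAt nrm nrmB M : ℝ) *
      overlap (circuitAt U Ub j) (circuitAt U Ub M) := by
  rw [normAt_coe, normAt_self, circuitAt_coe, circuitAt_self,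
    mul_overlap (hU.column_eq j) hb.vector_eq, Matrix.ofLp_toLpLin, Matrix.toLin'_apply]
  rfl

/-! ### Success probability -/

theorem repetitionFactor_pos (hA : A ≠ 0) (hb : 0 < nrmB) (hε : 0 < ε) (hρ : 0 < ρ) :
    0 < repetitionFactor A b nrmB ε ρ := by
  have : (0 : ℝ) < M := Nat.cast_pos.2 (pos_of_ne_zero hA)
  have : 0 < ‖A‖ := norm_pos_iff.2 hA
  have := norm_pinv_pos hA
  rw [repetitionFactor]
  positivity

theorem repetitions_eq (hA : A ≠ 0) (hU : ColumnAccess A nrm U d) (hb : VectorAccess b nrmB Ub d) :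
    repetitions A b nrm nrmB ε ρ = ⌈Gamma1 A b ^ 2 * repetitionFactor A b ‖b‖ ε ρ⌉₊ := by
  rw [repetitions, runningMax_eq_Gamma1 (pos_of_ne_zero hA) hU hb, hb.norm_eq]

theorem sq_tolerance_mul_repetitionFactor (hA : A ≠ 0) (hb : b ≠ 0) (hε : 0 < ε) :
    tolerance A b ε ^ 2 * repetitionFactor A b ‖b‖ ε ρ = ρ * M / 256 := by
  have : 0 < ‖A‖ := norm_pos_iff.2 hA
  have := norm_pinv_pos hA
  have : 0 < ‖b‖ := norm_pos_iff.2 hb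
  rw [tolerance, regularization, repetitionFactor]
  field_simp
  ring

theorem le_sq_tolerance_mul_repetitions (hA : A ≠ 0) (hU : ColumnAccess A nrm U d)
    (hb : VectorAccess b nrmB Ub d) (hε : 0 < ε) :
    ρ * M / 8192 ≤ (tolerance A b ε / 4) ^ 2 * repetitions A b nrm nrmB ε ρ /
      (2 * Gamma1 A b ^ 2) := by
  have hΓ := Gamma1_pos (b := b) hA
  rw [le_div_iff₀ (by positivity)]
  calc ρ * M / 8192 * (2 * Gamma1 A b ^ 2)
      = (tolerance A b ε / 4) ^ 2 * (Gamma1 A b ^ 2 * repetitionFactor A b ‖b‖ ε ρ) := by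
        linear_combination
          (-Gamma1 A b ^ 2 / 16) * sq_tolerance_mul_repetitionFactor (ρ := ρ) hA hb.ne_zero hε
    _ ≤ (tolerance A b ε / 4) ^ 2 * repetitions A b nrm nrmB ε ρ := by
        rw [repetitions_eq hA hU hb]
        gcongr
        exact Nat.le_ceil _

theorem two_mul_pow_mul_exp_neg_le (hM : 0 < M) {δ x : ℝ} (h0 : 0 < δ) (h1 : δ < 1)
    (hx : 11 * M * Real.log (2 / δ) ≤ x) : 2 * 625 ^ M * Real.exp (-x) ≤ δ := by
  have hexp : Real.exp (-(11 * M * Real.log (2 / δ))) = ((δ / 2) ^ 11) ^ M := by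
    rw [← pow_mul, ← Real.exp_log (show 0 < δ / 2 by positivity), ← Real.exp_nat_mul,
      ← inv_div 2 δ, Real.log_inv]
    push_cast
    ring_nf
  have hpow : 625 * (δ / 2) ^ 11 ≤ δ / 2 :=
    calc 625 * (δ / 2) ^ 11 = 625 * (δ / 2) ^ 10 * (δ / 2) := by ring
      _ ≤ 625 * (1 / 2) ^ 10 * (δ / 2) := by gcongr
      _ ≤ δ / 2 := by linarith
  calc 2 * 625 ^ M * Real.exp (-x) ≤ 2 * 625 ^ M * ((δ / 2) ^ 11) ^ M := by
        rw [← hexp]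
        gcongr
    _ = 2 * (625 * (δ / 2) ^ 11) ^ M := by rw [mul_pow, mul_assoc]
    _ ≤ 2 * (δ / 2) ^ M := by gcongr
    _ ≤ 2 * (δ / 2) := by
        gcongr
        exact pow_le_of_le_one (by positivity) (by linarith) hM.ne'
    _ = δ := by ring

theorem run_hybridAlgorithm {n : ℕ} {circ : ℕ → ℕ → Part → Circuit (n + 1)} {solve : Cmd}
    {m : Mem} : run circ (hybridAlgorithm solve) m =
      run circ (.seq preprocessing (.seq (.seq computeW computeQ) solve)) m := by
  simp only [hybridAlgorithm, preprocessing, run, PMF.bind_bind, PMF.bind_map, PMF.map_bind,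
    PMF.map_comp, Function.comp_def, add_assoc]

theorem wp_hybridAlgorithm_le {solve : Cmd} {C : ℝ} {C' : ℕ} (hsolve : IsLinearSolver solve C)
    (hcomp : IsHadamardCompiler comp C') (hA : A ≠ 0) (hU : ColumnAccess A nrm U d)
    (hb : VectorAccess b nrmB Ub d) (hε : 0 < ε) (hρ : 0 < ρ) :
    wp (testCircuit comp U Ub) (hybridAlgorithm solve)
      ({m | IsApproxSolution A b ε (WithLp.toLp 2 (m.vecX M))}ᶜ.indicator 1)
      (initMem A b nrm nrmB ε ρ) ≤
      ENNReal.ofReal (2 * 625 ^ M * Real.exp (-((tolerance A b ε / 4) ^ 2 *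
        repetitions A b nrm nrmB ε ρ / (2 * Gamma1 A b ^ 2)))) := by
  have hb0 := hb.ne_zero
  have hS : 0 < repetitions A b nrm nrmB ε ρ := by
    have := Gamma1_pos (b := b) hA
    have := repetitionFactor_pos (b := b) hA (norm_pos_iff.2 hb0) hε hρ
    rw [repetitions_eq hA hU hb, Nat.ceil_pos]
    positivity
  rw [wp, run_hybridAlgorithm, ← wp, wp_seq]
  refine spec_preprocessing.wp_le fun m hm => ?_
  refine wp_estimate_solve_le (W := regularizedGram A (regularization A ‖b‖ ε))
    (q := Matrix.toEuclideanLin A.conjTranspose b) hsolve hS (Gamma1_pos hA)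
    (fun j _ k _ => bias_testCircuit hcomp U Ub j k)
    (fun j hj k hk => abs_normAt_mul_normAt_le hU hb hj hk) hm (size_testCircuit_le hcomp hU hb)
    (hb.norm_eq ▸ regularizedGram_apply_eq_overlap hU _)
    (toEuclideanLin_conjTranspose_apply_eq_overlap hU hb)
    (div_nonneg (tolerance_pos hA hb0 hε).le zero_le_four) fun E f hE hf => ?_
  rw [mul_div_cancel₀ _ four_ne_zero] at hE hf
  exact ⟨isUnit_det_of_norm_le_tolerance hA hb0 hε hE, fun x hx =>
    isApproxSolution_of_norm_le_tolerance hA hb0 hε hE hf hx⟩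

theorem ofReal_one_sub_le_toOuterMeasure_runAlgorithm {solve : Cmd} {C : ℝ} {C' : ℕ}
    (hsolve : IsLinearSolver solve C) (hcomp : IsHadamardCompiler comp C') (hA : A ≠ 0)
    (hU : ColumnAccess A nrm U d) (hb : VectorAccess b nrmB Ub d) (hε : 0 < ε) {δ : ℝ}
    (h0 : 0 < δ) (h1 : δ < 1) :
    ENNReal.ofReal (1 - δ) ≤
      (runAlgorithm solve comp A b nrm U nrmB Ub ε (90112 * Real.log (2 / δ))).toOuterMeasure
        {r | IsApproxSolution A b ε r.1} := by
  have hlog : 0 < Real.log (2 / δ) := Real.log_pos (by rw [lt_div_iff₀ h0]; linarith)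
  set p := runAlgorithm solve comp A b nrm U nrmB Ub ε (90112 * Real.log (2 / δ)) with hp
  have hfail : expect p ({r | IsApproxSolution A b ε r.1}ᶜ.indicator 1) ≤ ENNReal.ofReal δ := by
    rw [hp, runAlgorithm, expect_map]
    refine (wp_hybridAlgorithm_le hsolve hcomp hA hU hb hε (by positivity)).trans
      (ENNReal.ofReal_le_ofReal (two_mul_pow_mul_exp_neg_le (pos_of_ne_zero hA) h0 h1 ?_))
    refine le_trans (le_of_eq ?_) (le_sq_tolerance_mul_repetitions hA hU hb hε)
    ring
  rw [ENNReal.ofReal_sub _ h0.le, ENNReal.ofReal_one, tsub_le_iff_right,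
    ← toOuterMeasure_add_expect_indicator_compl p {r | IsApproxSolution A b ε r.1}]
  gcongr

/-! ### Running time -/

/-- The number of steps of the algorithm for `M` columns, with `S` repetitions of Hadamard test
circuits of size `K` and `L` steps for the linear system. -/
def stepBound (M S K L : ℕ) : ℕ :=
  M * 60 + S + 200 + (M * (M * (S * (2 * K + 60) + 40) + 20) + 5 +
    (M * (S * (2 * K + 60) + 40) + 5) + L)

theorem spec_hybridAlgorithm {n K : ℕ} {circ : ℕ → ℕ → Part → Circuit (n + 1)} {solve : Cmd}
    {C : ℝ} (hsolve : IsLinearSolver solve C) (hK : ∀ e f p, (circ e f p).size ≤ K) :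
    Spec circ (hybridAlgorithm solve) (initMem A b nrm nrmB ε ρ)
      (stepBound M (repetitions A b nrm nrmB ε ρ) K ⌈C * ((M : ℝ) ^ 3 + 1)⌉₊) fun _ => True := by
  rw [Spec, run_hybridAlgorithm]
  exact spec_preprocessing.seq fun m hm =>
    ((spec_computeW hm.rM hm.rS hK).seq fun m₁ h₁ => spec_computeQ h₁.1 h₁.2 hK).seq fun m₂ h₂ =>
      (hsolve.spec h₂).mono le_rfl fun _ _ => trivial

theorem stepBound_le {S K L : ℕ} (hM : 0 < M) :
    stepBound M S K L ≤ (4 * K + 121) * (M ^ 2 * S) + 370 * M ^ 3 + L := by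
  have h₁ : M ≤ M ^ 2 := Nat.le_self_pow two_ne_zero M
  have h₂ : M ^ 2 ≤ M ^ 3 := Nat.pow_le_pow_right hM (by norm_num)
  have : 1 ≤ M := hM
  have h₄ : M * (S * (2 * K + 60)) ≤ M ^ 2 * (S * (2 * K + 60)) := Nat.mul_le_mul_right _ h₁
  have h₅ : S ≤ M ^ 2 * S := Nat.le_mul_of_pos_left _ (by positivity)
  rw [stepBound]
  linarith

theorem stepBound_le_mul {S n : ℕ} {X B ℓ : ℝ} (hM : 0 < M) (hS : (S : ℝ) ≤ X + 1) (hB0 : 0 ≤ B)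
    (hℓ : 1 / 2 ≤ ℓ) (hB : (M : ℝ) ^ 2 * X = 90112 * ℓ * B) :
    (stepBound M S (7 * (2 * n + 1)) ⌈300 * ((M : ℝ) ^ 3 + 1)⌉₊ : ℝ) ≤
      10 ^ 8 * ℓ * (1 + n) * (B + (M : ℝ) ^ 3) := by
  have hM' : (1 : ℝ) ≤ M := Nat.one_le_cast.2 hM
  have hM3 : (1 : ℝ) ≤ (M : ℝ) ^ 3 := one_le_pow₀ hM'
  have hceil : (⌈300 * ((M : ℝ) ^ 3 + 1)⌉₊ : ℝ) ≤ 300 * ((M : ℝ) ^ 3 + 1) + 1 :=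
    (Nat.ceil_lt_add_one (by positivity)).le
  have hMS : (M : ℝ) ^ 2 * S ≤ 90112 * ℓ * B + (M : ℝ) ^ 3 :=
    calc (M : ℝ) ^ 2 * S ≤ (M : ℝ) ^ 2 * (X + 1) := by gcongr
      _ = 90112 * ℓ * B + (M : ℝ) ^ 2 := by rw [mul_add, mul_one, hB]
      _ ≤ 90112 * ℓ * B + (M : ℝ) ^ 3 := by
        gcongr
        norm_num
  have hℓM : (M : ℝ) ^ 3 ≤ 2 * ℓ * (M : ℝ) ^ 3 :=
    le_mul_of_one_le_left (by positivity) (by linarith)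
  have : 0 ≤ ℓ := by linarith
  have : 0 ≤ ℓ * B := by positivity
  calc (stepBound M S (7 * (2 * n + 1)) ⌈300 * ((M : ℝ) ^ 3 + 1)⌉₊ : ℝ)
      ≤ (4 * (7 * (2 * n + 1)) + 121) * ((M : ℝ) ^ 2 * S) + 370 * (M : ℝ) ^ 3 +
          ⌈300 * ((M : ℝ) ^ 3 + 1)⌉₊ := by exact_mod_cast stepBound_le hM
    _ ≤ 149 * (1 + n) * (90112 * ℓ * B + (M : ℝ) ^ 3) + 971 * (1 + n) * (M : ℝ) ^ 3 := by
        have : (0 : ℝ) ≤ n := n.cast_nonneg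
        have : 4 * (7 * (2 * n + 1)) + 121 ≤ 149 * (1 + n : ℝ) := by linarith
        have : (M : ℝ) ^ 3 ≤ (1 + n) * (M : ℝ) ^ 3 :=
          le_mul_of_one_le_left (by positivity) (by linarith)
        have := mul_le_mul ‹4 * (7 * (2 * n + 1)) + 121 ≤ 149 * (1 + n : ℝ)› hMS (by positivity)
          (by positivity)
        linarith
    _ = (1 + n) * (149 * 90112 * (ℓ * B) + 1120 * (M : ℝ) ^ 3) := by ring
    _ ≤ (1 + n) * (10 ^ 8 * (ℓ * B) + 10 ^ 8 * (ℓ * (M : ℝ) ^ 3)) := by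
        refine mul_le_mul_of_nonneg_left ?_ (by positivity)
        linarith
    _ = 10 ^ 8 * ℓ * (1 + n) * (B + (M : ℝ) ^ 3) := by ring

theorem timeTerm_nonneg (hε : 0 < ε) : 0 ≤ timeTerm A b ε := by
  rw [timeTerm]
  positivity

theorem sq_mul_repetitionFactor : (M : ℝ) ^ 2 *
    (Gamma1 A b ^ 2 * repetitionFactor A b ‖b‖ ε ρ) = ρ * timeTerm A b ε := by
  rw [repetitionFactor, timeTerm, condNumber]
  ring

theorem snd_le_of_mem_support_runAlgorithm {solve : Cmd} (hsolve : IsLinearSolver solve 300)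
    (hcomp : IsHadamardCompiler comp (7 : ℕ)) (hA : A ≠ 0) (hU : ColumnAccess A nrm U d)
    (hb : VectorAccess b nrmB Ub d) (hε : 0 < ε) {δ : ℝ} (h0 : 0 < δ) (h1 : δ < 1)
    {r : EuclideanSpace ℂ (Fin M) × ℕ}
    (hr : r ∈ (runAlgorithm solve comp A b nrm U nrmB Ub ε (90112 * Real.log (2 / δ))).support) :
    (r.2 : ℝ) ≤ 10 ^ 8 * Real.log (2 / δ) * (1 + d * Nat.clog 2 N) *
      (timeTerm A b ε + (M : ℝ) ^ 3) := by
  obtain ⟨s, hs, rfl⟩ := (PMF.mem_support_map_iff _ _ _).1 hr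
  have hlog : 1 / 2 ≤ Real.log (2 / δ) := by
    have : Real.log 2 ≤ Real.log (2 / δ) :=
      Real.log_le_log two_pos ((le_div_iff₀ h0).2 (by linarith))
    linarith [Real.log_two_gt_d9]
  have hS : (repetitions A b nrm nrmB ε (90112 * Real.log (2 / δ)) : ℝ) ≤
      Gamma1 A b ^ 2 * repetitionFactor A b ‖b‖ ε (90112 * Real.log (2 / δ)) + 1 := by
    have := repetitionFactor_pos (b := b) (ρ := 90112 * Real.log (2 / δ)) hA
      (norm_pos_iff.2 hb.ne_zero) hε (by linarith)
    rw [repetitions_eq hA hU hb]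
    exact (Nat.ceil_lt_add_one (by positivity)).le
  calc (s.2 : ℝ) ≤ _ := Nat.cast_le.2
        (spec_hybridAlgorithm hsolve (size_testCircuit_le hcomp hU hb) s hs).1
    _ ≤ _ := stepBound_le_mul (pos_of_ne_zero hA) hS (timeTerm_nonneg hε) hlog
        sq_mul_repetitionFactor
    _ = _ := by push_cast; rfl

end

end HybridLS

end

theorem mainTheorem1 :
    ∃ (solve : Cmd) (comp : ∀ n : ℕ, Circuit n → Circuit n → Part → Circuit (n + 1)) (c C : ℝ),
      0 < c ∧ 0 < C ∧ IsLinearSolver solve C ∧ IsHadamardCompiler comp C ∧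
      ∀ (N M : ℕ) (A : Matrix (Fin N) (Fin M) ℂ) (b : EuclideanSpace ℂ (Fin N))
        (nrm : Fin M → ℝ) (U : Fin M → Circuit (Nat.clog 2 N))
        (nrmB : ℝ) (Ub : Circuit (Nat.clog 2 N)) (d : ℕ) (ε δ : ℝ),
        A ≠ 0 → ColumnAccess A nrm U d → VectorAccess b nrmB Ub d →
        0 < ε → 0 < δ → δ < 1 →
        -- correctness with high probability
        ENNReal.ofReal (1 - δ) ≤
          (runAlgorithm solve comp A b nrm U nrmB Ub ε (c * Real.log (2 / δ))).toOuterMeasure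
            {r | IsApproxSolution A b ε r.1} ∧
        -- running time, in every run
        ∀ r ∈ (runAlgorithm solve comp A b nrm U nrmB Ub ε (c * Real.log (2 / δ))).support,
          (r.2 : ℝ) ≤ C * Real.log (2 / δ) * (1 + d * Nat.clog 2 N) *
            (timeTerm A b ε + (M : ℝ) ^ 3) ∧
          ((M : ℝ) ^ 3 ≤ timeTerm A b ε →
            (r.2 : ℝ) ≤ C * Real.log (2 / δ) * (1 + d * Nat.clog 2 N) * timeTerm A b ε) := by
  obtain ⟨comp, hcomp⟩ := exists_isHadamardCompiler
  refine ⟨solver, comp, 90112, 2 * 10 ^ 8, by norm_num, by norm_num,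
    isLinearSolver_solver.mono (by norm_num), hcomp.mono (by norm_num), ?_⟩
  intro N M A b nrm U nrmB Ub d ε δ hA hU hb hε h0 h1
  have hcomp : IsHadamardCompiler comp ((7 : ℕ) : ℝ) := hcomp.mono (by norm_num)
  refine ⟨ofReal_one_sub_le_toOuterMeasure_runAlgorithm isLinearSolver_solver hcomp hA hU hb hε
    h0 h1, fun r hr => ?_⟩
  have htime := snd_le_of_mem_support_runAlgorithm isLinearSolver_solver hcomp hA hU hb hε h0 h1 hr
  have : 0 < Real.log (2 / δ) := Real.log_pos (by rw [lt_div_iff₀ h0]; linarith)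
  have := timeTerm_nonneg (A := A) (b := b) hε
  refine ⟨htime.trans ?_, fun h => htime.trans ?_⟩
  · gcongr
    norm_num
  · calc 10 ^ 8 * Real.log (2 / δ) * (1 + d * Nat.clog 2 N) * (timeTerm A b ε + (M : ℝ) ^ 3)
        ≤ 10 ^ 8 * Real.log (2 / δ) * (1 + d * Nat.clog 2 N) * (2 * timeTerm A b ε) := by
          gcongr
          linarith
      _ = 2 * 10 ^ 8 * Real.log (2 / δ) * (1 + d * Nat.clog 2 N) * timeTerm A b ε := by ring
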